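/- Let $\nu,L>0$, $\kappa_0=2\pi/L$. Let $H$ be the $L^2([0,L]^2)^2$-closure of the real, $L$-periodic, divergence-free, mean-zero trigonometric vector polynomials, with $L^2$ norm $|\cdot|$; let $\mathcal P$ be the orthogonal projection of $L^2([0,L]^2)^2$ onto $H$, $A=-\mathcal P\Delta$ the Stokes operator, with powers $A^{\sigma}$ given by its eigenfunction expansion, and $B(u,v)=\mathcal P((u\cdot\nabla)v)$. Let $H_{\mathbb C}=H+iH$, and extend $A^\sigma$ linearly and $B$ bilinearly to complex fields, keeping the same notation. For $g\in H$ let $\mathcal A$ be the global attractor of the Navier–Stokes equation $$\frac{du}{dt}+\nu Au+B(u,u)=g ,$$ that is, the set of all $u_0\in H$ for which there is a solution $u(t)$, $t\in\mathbb R$, with $u(0)=u_0$ and $\sup_{t\in\mathbb R}|u(t)|<\infty$. A solution in $\mathcal A$ is a solution $u(t)$, $t\in\mathbb R$, with $u(t)\in\mathcal A$ for all $t$. For $\delta>0$ let $\mathcal S(\delta)=\{\zeta\in\mathbb C:|\operatorname{Im}\zeta|<\delta\}$. **Theorem 2.1.** Suppose that $0\in\mathcal A$. Then there exist $\delta>0$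 and constants $\tilde R_\alpha\in[0,\infty)$, $\alpha\in\mathbb N$, such that every solution $u(\cdot)$ in $\mathcal A$ extends to a function $u(\zeta)$, $\zeta\in\mathcal S(\delta)$, which satisfies the Navier–Stokes equation with complexified time $$\frac{du(\zeta)}{d\zeta}+\nu Au(\zeta)+B(u(\zeta),u(\zeta))=g\quad\text{in }H_{\mathbb C},\qquad \zeta\in\mathcal S(\delta),$$ and, for every $\alpha\in\mathbb N$, the function $A^{\alpha/2}u(\zeta)$ is well defined, $H_{\mathbb C}$-valued and analytic on $\mathcal S(\delta)$, with $$|A^{\alpha/2}u(\zeta)|\le\tilde R_\alpha\,\nu\,\kappa_0^{\alpha}\qquad\text{for all }\zeta\in\mathcal S(\delta).$$ Here $\delta$ does not depend on $\alpha$ or on the solution, and $\tilde R_\alpha$ does not depend on the solution. Moreover, $\nu\kappa_0^2\delta$ can be chosen to depend only on the Grashof number $G=|g|/(\nu^2\kappa_0^2)$, and $\tilde R_\alpha$ only on $G$ and $\alpha$. -/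

import Mathlib

open MeasureTheory
open scoped ENNReal

namespace NSE2D

noncomputable section

/-- The periodic box `[0, L]²`: `L`-periodic functions of two variables are functions on this
torus, whose `volume` has total mass `L²`. -/
abbrev Torus (L : ℝ) : Type := Fin 2 → AddCircle L

/-- Values of (complexified) velocity fields, with the Hermitian norm. -/
abbrev Vec : Type := EuclideanSpace ℂ (Fin 2)

/-- Square integrable `ℂ²`-valued fields on the periodic box, with norm `(∫ |u|² dx)^{1/2}`. -/
abbrev Field (L : ℝ) [Fact (0 < L)] : Type := Lp Vec 2 (volume : Measure (Torus L))

/-- `κ₀ = 2π / L`. -/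
def kappa (L : ℝ) : ℝ := 2 * Real.pi / L

/-- The character `x ↦ exp (i κ₀ k · x)`. -/
def character (L : ℝ) (k : Fin 2 → ℤ) : C(Torus L, ℂ) where
  toFun x := ∏ i, fourier (k i) (x i)
  continuous_toFun := by fun_prop

/-- The field `x ↦ exp (i κ₀ k · x) a`, as an element of `L²`. -/
def mode (L : ℝ) [Fact (0 < L)] (k : Fin 2 → ℤ) (a : Vec) : Field L :=
  ContinuousMap.toLp (E := Vec) 2 (volume : Measure (Torus L)) ℂ
    ⟨fun x => character L k x • a, by fun_prop⟩

/-- The Fourier coefficient `û(k) = L⁻² ∫ u(x) exp (-i κ₀ k · x) dx`. -/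
def coeff (L : ℝ) [Fact (0 < L)] (u : Field L) (k : Fin 2 → ℤ) : Vec :=
  ((L : ℂ) ^ 2)⁻¹ • ∫ x : Torus L, (starRingEnd ℂ) (character L k x) • u x

/-- The real-valued trigonometric polynomials `v = ∑ₖ exp (i κ₀ k · x) a k` (finite sum) with
`∇ · v = 0` and `∫ v dx = 0`. Real-valuedness is `conj (a k) = a (-k)`, the divergence of `v` has
coefficients `i κ₀ k · a k`, and the integral of `v` is `L² a 0`. -/
def realTrigPoly (L : ℝ) [Fact (0 < L)] : Set (Field L) :=
  {v | ∃ a : (Fin 2 → ℤ) →₀ Vec,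
    (∀ k i, (starRingEnd ℂ) (a k i) = a (-k) i) ∧
    (∀ k, ∑ i, (k i : ℂ) * a k i = 0) ∧
    a 0 = 0 ∧
    v = a.sum fun k c => mode L k c}

/-- The phase space `H`: the `L²`-closure of those trigonometric polynomials. -/
def H (L : ℝ) [Fact (0 < L)] : Set (Field L) := closure (realTrigPoly L)

/-- The complexified phase space `H_ℂ = H + i H`, as a closed complex subspace of `L²`.
(`H + i H` is the complex span of the real subspace `H`; it is already closed.) -/
def HC (L : ℝ) [Fact (0 < L)] : Submodule ℂ (Field L) :=
  (Submodule.span ℂ (H L)).topologicalClosure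

/-- The eigenvalue `κ₀² |k|²` of the Stokes operator `A = -𝒫Δ = -Δ` on the fields
`exp (i κ₀ k · x) a` of `H_ℂ`. -/
def eigenvalue (L : ℝ) (k : Fin 2 → ℤ) : ℝ := kappa L ^ 2 * ∑ i, (k i : ℝ) ^ 2

/-- The terms of the eigenfunction expansion of `A^σ u`. -/
def powTerm (L : ℝ) [Fact (0 < L)] (σ : ℝ) (u : Field L) (k : Fin 2 → ℤ) : Field L :=
  mode L k (((eigenvalue L k ^ σ : ℝ) : ℂ) • coeff L u k)

/-- `𝒟(A^σ)_ℂ`: the fields of `H_ℂ` for which the expansion of `A^σ u` converges in `L²`. -/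
def stokesDom (L : ℝ) [Fact (0 < L)] (σ : ℝ) : Set (Field L) :=
  {u | u ∈ HC L ∧ Summable (powTerm L σ u)}

/-- The power `A^σ` of the (complexified) Stokes operator; meaningful on `stokesDom L σ`. -/
def stokesPow (L : ℝ) [Fact (0 < L)] (σ : ℝ) (u : Field L) : Field L :=
  ∑' k, powTerm L σ u k

/-- The `L²` partial derivative `∂v/∂xⱼ` of a field whose differentiated Fourier series converges
in `L²`, in particular of every `v` in `𝒟(A^{1/2})_ℂ`. -/
def pderiv (L : ℝ) [Fact (0 < L)] (j : Fin 2) (v : Field L) : Field L :=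
  ∑' k, mode L k ((Complex.I * (kappa L : ℂ) * (k j : ℂ)) • coeff L v k)

/-- The field `(u · ∇) v = u₁ ∂v/∂x₁ + u₂ ∂v/∂x₂`. -/
def advection (L : ℝ) [Fact (0 < L)] (u v : Field L) (x : Torus L) : Vec :=
  ∑ j, u x j • pderiv L j v x

/-- The Helmholtz–Leray projection: the orthogonal projection of `L²` onto `H_ℂ`. -/
def leray (L : ℝ) [Fact (0 < L)] (f : Field L) : Field L :=
  haveI : CompleteSpace (HC L) := Submodule.topologicalClosure.completeSpace _
  (HC L).starProjection f

open Classical in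
/-- `B(u, v) = 𝒫((u · ∇) v)`, complex bilinear. The field `(u · ∇) v` is square integrable
for `u` in `𝒟(A^{1/2})_ℂ` and `v` in `𝒟(A)_ℂ`, which is where `B` is used. -/
def B (L : ℝ) [Fact (0 < L)] (u v : Field L) : Field L :=
  if h : MemLp (advection L u v) 2 (volume : Measure (Torus L)) then leray L (h.toLp _) else 0

/-- `g - ν A u - B(u, u)`. -/
def rhs (ν L : ℝ) [Fact (0 < L)] (g u : Field L) : Field L :=
  g - (ν : ℂ) • stokesPow L 1 u - B L u u

/-- `u` solves `du/dt + ν A u + B(u, u) = g` in `H` for all real times `t`. -/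
def IsSolution (ν L : ℝ) [Fact (0 < L)] (g : Field L) (u : ℝ → Field L) : Prop :=
  ∀ t : ℝ, u t ∈ H L ∧ u t ∈ stokesDom L 1 ∧ HasDerivAt u (rhs ν L g (u t)) t

/-- The global attractor: the points of `H` through which there passes a solution that exists for
all real times and is bounded in `H`. -/
def attractor (ν L : ℝ) [Fact (0 < L)] (g : Field L) : Set (Field L) :=
  {u₀ | ∃ u : ℝ → Field L, IsSolution ν L g u ∧ u 0 = u₀ ∧ ∃ M : ℝ, ∀ t, ‖u t‖ ≤ M}

/-- `u` is a solution lying in the attractor. -/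
def IsSolutionInAttractor (ν L : ℝ) [Fact (0 < L)] (g : Field L) (u : ℝ → Field L) : Prop :=
  IsSolution ν L g u ∧ ∀ t : ℝ, u t ∈ attractor ν L g

/-- The strip `{ζ : |Im ζ| < δ}`. -/
def strip (δ : ℝ) : Set ℂ := {ζ | |ζ.im| < δ}

/-- `U` solves the equation with complexified time,
`dU/dζ + ν A U + B(U, U) = g` in `H_ℂ`, on the set `S` of complex times. -/
def IsComplexSolutionOn (ν L : ℝ) [Fact (0 < L)] (g : Field L) (S : Set ℂ) (U : ℂ → Field L) :
    Prop :=
  ∀ ζ ∈ S, U ζ ∈ HC L ∧ U ζ ∈ stokesDom L 1 ∧ HasDerivAt U (rhs ν L g (U ζ)) ζ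

/-- The generalized Grashof number `G = |g| / (ν² κ₀²)`. -/
def grashof (ν L : ℝ) [Fact (0 < L)] (g : Field L) : ℝ := ‖g‖ / (ν ^ 2 * kappa L ^ 2)

end

end NSE2D

/-! In two dimensions a divergence-free, mean-zero field has one scalar amplitude per wave vector,
along the unit vector `evec k` orthogonal to `k`. After scaling out `ν` and `κ₀`, the equation
becomes `a_k' = f_k - |k|² a_k - nl a a k`, and the Grashof number is the only parameter left in the
bounds.

Analyticity in time. Put `u(t₀ + λ s)` and treat the direction `λ`, with `|λ - 1| ≤ 1/2`, as an
element of the closed algebra generated by the coordinate function of that disc. The Duhamel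
equation is solved by contraction in `ℓ¹` over the wave vectors, with values in continuous functions
of `s` with values in this algebra (`exists_mild_solution`). The nonlinearity loses one factor
`|k|`, the heat kernel returns it at the price of `√T`, so the existence time depends only on the
`ℓ¹` size of the data. Elements of the algebra are holomorphic in `λ`, hence at `s = T` the solution
is holomorphic in `ζ = t₀ + λ T`; uniqueness (`SeqSol.eq_of_regular`) identifies it with the given
solution at real times.

Uniformity. Energy and enstrophy estimates bound bounded solutions: `‖a‖ ≤ Γ`, then `A^{1/2} a` at
all times, then `A a` at some time in every short window. This bounds the `ℓ¹` norm at suitable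
starting times, so every real time is the centre of a disc of fixed radius to which the solution
extends. The identity theorem glues the discs to a strip and carries the equation over
(`SeqSol.exists_extension`).

All orders. The force is only assumed to lie in `H`; this is where `0 ∈ 𝒜` enters. If `v` is a
bounded solution with `v(0) = 0`, then `v'(0) = g`. Suppose `A^{s/2}` of every extended solution is
bounded on a strip. Cauchy's estimate bounds `A^{s/2}` of the time derivatives on a smaller strip,
in particular `A^{s/2} g`; then `ν A u = g - u' - B(u, u)` gives the bound of order `s + 1`, since
`B` costs one derivative and `A` gains two. The widths decrease, but not below half of the initial
one (`SeqSol.exists_smooth_extension`). -/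

namespace NSE2D

/-! ### Square-summable sequences with explicit bounds -/

/-- The sequence `x` is square summable with `ℓ²` norm at most `C`. -/
def L2Bd {ι : Type*} (x : ι → ℝ) (C : ℝ) : Prop :=
  0 ≤ C ∧ ∀ s : Finset ι, ∑ k ∈ s, x k ^ 2 ≤ C ^ 2

namespace L2Bd

variable {ι : Type*} {x y : ι → ℝ} {C D : ℝ}

theorem mono (h : L2Bd y C) (hxy : ∀ k, |x k| ≤ y k) : L2Bd x C :=
  ⟨h.1, fun s => (Finset.sum_le_sum fun k _ => sq_le_sq' (by linarith [neg_abs_le (x k), hxy k])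
    ((le_abs_self _).trans (hxy k))).trans (h.2 s)⟩

theorem mono_right (h : L2Bd x C) (hCD : C ≤ D) : L2Bd x D :=
  ⟨h.1.trans hCD, fun s => (h.2 s).trans (pow_le_pow_left₀ h.1 hCD 2)⟩

theorem sum_mul_le (hx : L2Bd x C) (hy : L2Bd y D) (s : Finset ι) :
    ∑ k ∈ s, x k * y k ≤ C * D := by
  have h1 := Finset.sum_mul_sq_le_sq_mul_sq s x y
  have h2 : (∑ k ∈ s, x k ^ 2) * ∑ k ∈ s, y k ^ 2 ≤ C ^ 2 * D ^ 2 :=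
    mul_le_mul (hx.2 s) (hy.2 s) (Finset.sum_nonneg fun _ _ => sq_nonneg _) (sq_nonneg _)
  exact le_of_sq_le_sq (by nlinarith) (mul_nonneg hx.1 hy.1)

theorem add (hx : L2Bd x C) (hy : L2Bd y D) : L2Bd (fun k => x k + y k) (C + D) := by
  refine ⟨add_nonneg hx.1 hy.1, fun s => ?_⟩
  have : ∑ k ∈ s, (x k + y k) ^ 2
      = ∑ k ∈ s, x k ^ 2 + 2 * ∑ k ∈ s, x k * y k + ∑ k ∈ s, y k ^ 2 := by
    rw [Finset.mul_sum, ← Finset.sum_add_distrib, ← Finset.sum_add_distrib]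
    exact Finset.sum_congr rfl fun _ _ => by ring
  rw [this]
  nlinarith [hx.2 s, hy.2 s, hx.sum_mul_le hy s]

theorem const_mul (hx : L2Bd x C) {c : ℝ} (hc : 0 ≤ c) : L2Bd (fun k => c * x k) (c * C) := by
  refine ⟨mul_nonneg hc hx.1, fun s => ?_⟩
  simp_rw [mul_pow, ← Finset.mul_sum]
  exact mul_le_mul_of_nonneg_left (hx.2 s) (sq_nonneg _)

theorem summable (hx : L2Bd x C) : Summable fun k => x k ^ 2 :=
  summable_of_sum_le (fun _ => sq_nonneg _) hx.2

theorem tsum_le (hx : L2Bd x C) : ∑' k, x k ^ 2 ≤ C ^ 2 :=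
  hx.summable.tsum_le_of_sum_le hx.2

theorem abs_le (hx : L2Bd x C) (k : ι) : |x k| ≤ C := by
  have := hx.2 {k}
  rw [Finset.sum_singleton] at this
  exact abs_le_of_sq_le_sq this hx.1

theorem of_tsum_le (h : Summable fun k => x k ^ 2) (hC : 0 ≤ C) (h2 : ∑' k, x k ^ 2 ≤ C ^ 2) :
    L2Bd x C :=
  ⟨hC, fun s => (h.sum_le_tsum s fun _ _ => sq_nonneg _).trans h2⟩

theorem of_summable (h : Summable fun k => x k ^ 2) : L2Bd x (Real.sqrt (∑' k, x k ^ 2)) :=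
  of_tsum_le h (Real.sqrt_nonneg _) (Real.sq_sqrt (tsum_nonneg fun _ => sq_nonneg _)).ge

theorem of_l1 (h0 : ∀ k, 0 ≤ x k) (h : Summable x) (hC : ∑' k, x k ≤ C) : L2Bd x C := by
  refine ⟨(tsum_nonneg h0).trans hC, fun s => ?_⟩
  have h1 : ∑ k ∈ s, x k ≤ C := (h.sum_le_tsum s fun _ _ => h0 _).trans hC
  have h2 : 0 ≤ ∑ k ∈ s, x k := Finset.sum_nonneg fun _ _ => h0 _
  exact (Finset.sum_sq_le_sq_sum_of_nonneg fun _ _ => h0 _).trans (pow_le_pow_left₀ h2 h1 2)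

theorem summable_mul (hx : L2Bd x C) (hy : L2Bd y D) (hx0 : ∀ k, 0 ≤ x k) (hy0 : ∀ k, 0 ≤ y k) :
    Summable fun k => x k * y k :=
  summable_of_sum_le (fun _ => mul_nonneg (hx0 _) (hy0 _)) (hx.sum_mul_le hy)

theorem tsum_mul_le (hx : L2Bd x C) (hy : L2Bd y D) (hx0 : ∀ k, 0 ≤ x k) (hy0 : ∀ k, 0 ≤ y k) :
    ∑' k, x k * y k ≤ C * D :=
  (hx.summable_mul hy hx0 hy0).tsum_le_of_sum_le (hx.sum_mul_le hy)

end L2Bd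

/-! ### Convolutions -/

section Conv

variable {Γ : Type*} [AddCommGroup Γ]

/-- The convolution of two sequences. -/
noncomputable def conv (f g : Γ → ℝ) (k : Γ) : ℝ := ∑' l, f l * g (k - l)

/-- The change of variables `(l, m) ↦ (l, l + m)`. -/
def shearEquiv (Γ : Type*) [AddCommGroup Γ] : Γ × Γ ≃ Γ × Γ where
  toFun p := (p.1, p.1 + p.2)
  invFun p := (p.1, p.2 - p.1)
  left_inv p := by simp
  right_inv p := by simp

theorem conv_nonneg {f g : Γ → ℝ} (hf : ∀ k, 0 ≤ f k) (hg : ∀ k, 0 ≤ g k) (k : Γ) :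
    0 ≤ conv f g k := tsum_nonneg fun _ => mul_nonneg (hf _) (hg _)

theorem summable_prod_conv {f g : Γ → ℝ} (hf : ∀ k, 0 ≤ f k) (hg : ∀ k, 0 ≤ g k)
    (hfs : Summable f) (hgs : Summable g) :
    Summable fun p : Γ × Γ => f p.1 * g (p.2 - p.1) := by
  have := hfs.mul_of_nonneg hgs hf hg
  rw [← (shearEquiv Γ).symm.summable_iff] at this
  exact this

theorem summable_conv_term {f g : Γ → ℝ} (hf : ∀ k, 0 ≤ f k) (hg : ∀ k, 0 ≤ g k)
    (hfs : Summable f) (hgs : Summable g) (k : Γ) : Summable fun l => f l * g (k - l) :=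
  (summable_prod_conv hf hg hfs hgs).prod_symm.prod_factor k

theorem summable_conv {f g : Γ → ℝ} (hf : ∀ k, 0 ≤ f k) (hg : ∀ k, 0 ≤ g k)
    (hfs : Summable f) (hgs : Summable g) : Summable (conv f g) :=
  (summable_prod_conv hf hg hfs hgs).prod_symm.prod

theorem tsum_conv {f g : Γ → ℝ} (hf : ∀ k, 0 ≤ f k) (hg : ∀ k, 0 ≤ g k)
    (hfs : Summable f) (hgs : Summable g) : ∑' k, conv f g k = (∑' k, f k) * ∑' k, g k := by
  have h := summable_prod_conv hf hg hfs hgs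
  rw [hfs.tsum_mul_tsum hgs (hfs.mul_of_nonneg hgs hf hg)]
  have h1 : ∑' p : Γ × Γ, f p.1 * g p.2 = ∑' p : Γ × Γ, f p.1 * g (p.2 - p.1) :=
    ((shearEquiv Γ).symm.tsum_eq fun p : Γ × Γ => f p.1 * g p.2).symm
  rw [h1, ← (Equiv.prodComm Γ Γ).tsum_eq]
  exact (h.prod_symm.tsum_prod' h.prod_symm.prod_factor).symm

theorem summable_conv_term_l2 {f g : Γ → ℝ} {D : ℝ} (hf : ∀ k, 0 ≤ f k) (hg : ∀ k, 0 ≤ g k)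
    (hfs : Summable f) (hgs : L2Bd g D) (k : Γ) : Summable fun l => f l * g (k - l) := by
  refine Summable.of_nonneg_of_le (fun _ => mul_nonneg (hf _) (hg _)) (fun l => ?_)
    (hfs.mul_right D)
  exact mul_le_mul_of_nonneg_left ((le_abs_self _).trans (hgs.abs_le _)) (hf l)

/-- Young's inequality `ℓ¹ * ℓ² ⊆ ℓ²`. -/
theorem L2Bd.conv {f g : Γ → ℝ} {C D : ℝ} (hf : ∀ k, 0 ≤ f k) (hg : ∀ k, 0 ≤ g k)
    (hfs : Summable f) (hfC : ∑' k, f k ≤ C) (hgs : L2Bd g D) : L2Bd (conv f g) (C * D) := by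
  have hC : 0 ≤ C := (tsum_nonneg hf).trans hfC
  have hg2 : ∀ k, 0 ≤ g k ^ 2 := fun _ => sq_nonneg _
  -- Cauchy–Schwarz for the splitting `f g = √f · (√f g)`; summing over `k` then reduces the claim
  -- to `ℓ¹ * ℓ¹`.
  have hpt : ∀ k, NSE2D.conv f g k ^ 2 ≤ (∑' k, f k) * NSE2D.conv f (fun k => g k ^ 2) k := by
    intro k
    have hs2 := summable_conv_term hf hg2 hfs hgs.summable k
    have hA : L2Bd (fun l => Real.sqrt (f l)) (Real.sqrt (∑' k, f k)) := by
      refine .of_tsum_le ?_ (Real.sqrt_nonneg _) ?_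
      · simpa only [Real.sq_sqrt (hf _)] using hfs
      · simp only [Real.sq_sqrt (hf _), Real.sq_sqrt (tsum_nonneg hf), le_refl]
    have hB : L2Bd (fun l => Real.sqrt (f l) * g (k - l))
        (Real.sqrt (NSE2D.conv f (fun k => g k ^ 2) k)) := by
      refine .of_tsum_le ?_ (Real.sqrt_nonneg _) ?_
      · simpa only [mul_pow, Real.sq_sqrt (hf _)] using hs2
      · simp only [mul_pow, Real.sq_sqrt (hf _), Real.sq_sqrt (conv_nonneg hf hg2 k)]
        exact le_rfl
    have := hA.tsum_mul_le hB (fun _ => Real.sqrt_nonneg _)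
      (fun _ => mul_nonneg (Real.sqrt_nonneg _) (hg _))
    simp only [← mul_assoc, Real.mul_self_sqrt (hf _)] at this
    calc NSE2D.conv f g k ^ 2 ≤ (Real.sqrt (∑' k, f k) *
          Real.sqrt (NSE2D.conv f (fun k => g k ^ 2) k)) ^ 2 :=
          pow_le_pow_left₀ (conv_nonneg hf hg k) this 2
      _ = _ := by rw [mul_pow, Real.sq_sqrt (tsum_nonneg hf), Real.sq_sqrt (conv_nonneg hf hg2 k)]
  refine ⟨mul_nonneg hC hgs.1, fun s => ?_⟩
  have hsc := summable_conv hf hg2 hfs hgs.summable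
  calc ∑ k ∈ s, NSE2D.conv f g k ^ 2
      ≤ ∑ k ∈ s, (∑' k, f k) * NSE2D.conv f (fun k => g k ^ 2) k := Finset.sum_le_sum fun k _ => hpt k
    _ ≤ (∑' k, f k) * ∑' k, NSE2D.conv f (fun k => g k ^ 2) k := by
        rw [← Finset.mul_sum]
        exact mul_le_mul_of_nonneg_left (hsc.sum_le_tsum s fun _ _ => conv_nonneg hf hg2 _)
          (tsum_nonneg hf)
    _ ≤ C * (C * D ^ 2) := by
        rw [tsum_conv hf hg2 hfs hgs.summable]
        have := mul_le_mul hfC hgs.tsum_le (tsum_nonneg hg2) hC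
        exact mul_le_mul hfC this (mul_nonneg (tsum_nonneg hf) (tsum_nonneg hg2)) hC
    _ = (C * D) ^ 2 := by ring

theorem conv_comm (f g : Γ → ℝ) (k : Γ) : conv f g k = conv g f k := by
  unfold conv
  rw [← (Equiv.subLeft k).tsum_eq]
  exact tsum_congr fun l => by simp [mul_comm]

end Conv

/-! ### Wave vectors and the coefficients of the nonlinearity -/

/-- The Euclidean length of a wave vector. -/
noncomputable def wlen (k : Fin 2 → ℤ) : ℝ := Real.sqrt (∑ i, (k i : ℝ) ^ 2)

/-- The cross product of two wave vectors. -/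
def cross (l m : Fin 2 → ℤ) : ℝ := (l 0 : ℝ) * m 1 - l 1 * m 0

/-- The dot product of two wave vectors. -/
def wdot (l m : Fin 2 → ℤ) : ℝ := (l 0 : ℝ) * m 0 + l 1 * m 1

theorem wlen_sq (k : Fin 2 → ℤ) : wlen k ^ 2 = (k 0 : ℝ) ^ 2 + (k 1 : ℝ) ^ 2 := by
  rw [wlen, Real.sq_sqrt (Finset.sum_nonneg fun _ _ => sq_nonneg _), Fin.sum_univ_two]

theorem wlen_nonneg (k : Fin 2 → ℤ) : 0 ≤ wlen k := Real.sqrt_nonneg _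

@[simp] theorem wlen_zero : wlen 0 = 0 := by simp [wlen]

@[simp] theorem wlen_neg (k : Fin 2 → ℤ) : wlen (-k) = wlen k := by simp [wlen]

theorem norm_le_wlen (k : Fin 2 → ℤ) : ‖k‖ ≤ wlen k := by
  refine (pi_norm_le_iff_of_nonneg (wlen_nonneg k)).2 fun i => ?_
  rw [Int.norm_eq_abs]
  refine abs_le_of_sq_le_sq ?_ (wlen_nonneg k)
  rw [wlen_sq]
  fin_cases i <;> simp <;> positivity

theorem one_le_wlen {k : Fin 2 → ℤ} (hk : k ≠ 0) : 1 ≤ wlen k := by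
  refine le_trans ?_ (norm_le_wlen k)
  obtain ⟨i, hi⟩ := Function.ne_iff.1 hk
  refine le_trans ?_ (norm_le_pi_norm k i)
  rw [Int.norm_eq_abs]
  exact_mod_cast Int.one_le_abs hi

theorem wlen_pos {k : Fin 2 → ℤ} (hk : k ≠ 0) : 0 < wlen k := zero_lt_one.trans_le (one_le_wlen hk)

theorem abs_cross_le (l m : Fin 2 → ℤ) : |cross l m| ≤ wlen l * wlen m := by
  refine abs_le_of_sq_le_sq ?_ (mul_nonneg (wlen_nonneg _) (wlen_nonneg _))
  rw [mul_pow, wlen_sq, wlen_sq, cross]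
  nlinarith [sq_nonneg ((l 0 : ℝ) * m 0 + l 1 * m 1)]

theorem abs_wdot_le (l m : Fin 2 → ℤ) : |wdot l m| ≤ wlen l * wlen m := by
  refine abs_le_of_sq_le_sq ?_ (mul_nonneg (wlen_nonneg _) (wlen_nonneg _))
  rw [mul_pow, wlen_sq, wlen_sq, wdot]
  nlinarith [sq_nonneg ((l 0 : ℝ) * m 1 - l 1 * m 0)]

theorem wlen_add_le (l m : Fin 2 → ℤ) : wlen (l + m) ≤ wlen l + wlen m := by
  refine le_of_sq_le_sq ?_ (add_nonneg (wlen_nonneg _) (wlen_nonneg _))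
  have h := (le_abs_self _).trans (abs_wdot_le l m)
  rw [wdot] at h
  rw [add_sq, wlen_sq, wlen_sq, wlen_sq]
  simp only [Pi.add_apply, Int.cast_add]
  nlinarith

/-- The coefficient of `a l * b m` in the component along `l + m` of `B`. -/
noncomputable def coef (l m : Fin 2 → ℤ) : ℝ :=
  -(cross l m * wdot m (l + m)) / (wlen l * wlen m * wlen (l + m))

/-- The coefficient of the nonlinearity in vorticity form. -/
noncomputable def vcoef (l m : Fin 2 → ℤ) : ℝ :=
  -(cross l m * wlen m) / (wlen l * wlen (l + m))

theorem cross_add_right (l m : Fin 2 → ℤ) : cross l (l + m) = cross l m := by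
  simp only [cross, Pi.add_apply, Int.cast_add]; ring

theorem cross_neg_left (l m : Fin 2 → ℤ) : cross (-l) m = -cross l m := by
  simp only [cross, Pi.neg_apply, Int.cast_neg]; ring

theorem wdot_comm (l m : Fin 2 → ℤ) : wdot l m = wdot m l := by simp only [wdot]; ring

theorem abs_coef_le_right (l m : Fin 2 → ℤ) : |coef l m| ≤ wlen m := by
  have h1 := abs_cross_le l m
  have h2 := abs_wdot_le m (l + m)
  rw [coef, abs_div, abs_neg, abs_mul]
  have hd := mul_nonneg (mul_nonneg (wlen_nonneg l) (wlen_nonneg m)) (wlen_nonneg (l + m))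
  rw [abs_of_nonneg hd]
  refine div_le_of_le_mul₀ hd (wlen_nonneg m) ?_
  calc _ ≤ (wlen l * wlen m) * (wlen m * wlen (l + m)) :=
        mul_le_mul h1 h2 (abs_nonneg _) (mul_nonneg (wlen_nonneg _) (wlen_nonneg _))
    _ = _ := by ring

/-- Since `l × m = l × (l + m)`, the derivative can be moved onto the product (the divergence form
of `B`). This makes the nonlinearity meaningful for `ℓ¹` amplitudes, with a single factor `|k|`
lost. -/
theorem abs_coef_le_sum (l m : Fin 2 → ℤ) : |coef l m| ≤ wlen (l + m) := by
  have h1 := abs_cross_le l (l + m)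
  rw [cross_add_right] at h1
  have h2 := abs_wdot_le m (l + m)
  rw [coef, abs_div, abs_neg, abs_mul]
  have hd := mul_nonneg (mul_nonneg (wlen_nonneg l) (wlen_nonneg m)) (wlen_nonneg (l + m))
  rw [abs_of_nonneg hd]
  refine div_le_of_le_mul₀ hd (wlen_nonneg _) ?_
  calc _ ≤ (wlen l * wlen (l + m)) * (wlen m * wlen (l + m)) :=
        mul_le_mul h1 h2 (abs_nonneg _) (mul_nonneg (wlen_nonneg _) (wlen_nonneg _))
    _ = _ := by ring

theorem abs_vcoef_le_right (l m : Fin 2 → ℤ) : |vcoef l m| ≤ wlen m := by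
  have h1 := abs_cross_le l (l + m)
  rw [cross_add_right] at h1
  have hd := mul_nonneg (wlen_nonneg l) (wlen_nonneg (l + m))
  rw [vcoef, abs_div, abs_neg, abs_mul, abs_of_nonneg hd, abs_of_nonneg (wlen_nonneg m)]
  refine div_le_of_le_mul₀ hd (wlen_nonneg _) ?_
  calc _ ≤ (wlen l * wlen (l + m)) * wlen m := mul_le_mul_of_nonneg_right h1 (wlen_nonneg _)
    _ = _ := by ring

/-- Exchanging the second input with the output, and `l` with `-l`, flips the cross product and
preserves the rest. This is the Fourier form of `(B(a, d), d) = 0`. -/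
theorem coef_antisymm (l m : Fin 2 → ℤ) : coef (-l) (l + m) = -coef l m := by
  simp only [coef, cross_neg_left, cross_add_right, neg_add_cancel_left, wlen_neg,
    wdot_comm (l + m) m]
  ring

/-- The same antisymmetry after weighting the output by `|k|²`; it expresses that the vorticity is
merely transported, and yields `(B(a, a), A a) = 0`. -/
theorem vcoef_antisymm (l m : Fin 2 → ℤ) :
    vcoef (-l) (l + m) * wlen m ^ 2 = -(vcoef l m * wlen (l + m) ^ 2) := by
  simp only [vcoef, cross_neg_left, cross_add_right, neg_add_cancel_left, wlen_neg]
  rcases eq_or_ne (wlen m) 0 with h | h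
  · simp [h]
  rcases eq_or_ne (wlen (l + m)) 0 with h' | h'
  · simp [h']
  rcases eq_or_ne (wlen l) 0 with h'' | h''
  · simp [h'']
  field_simp

/-- Velocity and vorticity forms differ, but have the same symmetrization because `m·(l+m) - l·(l+m)
= |m|² - |l|²`. They therefore define the same quadratic term `B(a, a)`. -/
theorem coef_add_swap (l m : Fin 2 → ℤ) :
    coef l m + coef m l = vcoef l m + vcoef m l := by
  simp only [vcoef, coef, add_comm m l]
  rcases eq_or_ne m 0 with rfl | hm
  · simp [cross]
  rcases eq_or_ne l 0 with rfl | hl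
  · simp [cross]
  rcases eq_or_ne (wlen (l + m)) 0 with h' | h'
  · simp [h']
  have hm' := (wlen_pos hm).ne'
  have hl' := (wlen_pos hl).ne'
  field_simp
  have h1 : cross m l = -cross l m := by simp only [cross]; ring
  have h2 : wdot m (l + m) - wdot l (l + m) = wlen m ^ 2 - wlen l ^ 2 := by
    simp only [wdot, wlen_sq, Pi.add_apply, Int.cast_add]; ring
  rw [h1]
  linear_combination (-cross l m) * h2

theorem wlen_pow_mul_abs_coef_le (s : ℕ) (l m : Fin 2 → ℤ) :
    wlen (l + m) ^ s * |coef l m| ≤ 2 ^ s * (wlen l ^ (s + 1) + wlen m ^ (s + 1)) := by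
  have h0 := wlen_add_le l m
  have hc := abs_coef_le_right l m
  have hl := wlen_nonneg l
  have hm := wlen_nonneg m
  -- Applied with `x = max(|l|, |m|)`, using `|l + m| ≤ 2x`.
  have key : ∀ x : ℝ, wlen l ≤ x → wlen m ≤ x →
      wlen (l + m) ^ s * |coef l m| ≤ 2 ^ s * x ^ (s + 1) := by
    intro x h1 h2
    calc _ ≤ (2 * x) ^ s * x := mul_le_mul (pow_le_pow_left₀ (wlen_nonneg _) (by linarith) s)
            (hc.trans h2) (abs_nonneg _) (by have := hl.trans h1; positivity)
      _ = _ := by rw [mul_pow, pow_succ]; ring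
  rcases le_total (wlen l) (wlen m) with h | h
  · refine (key _ h le_rfl).trans ?_
    gcongr
    exact le_add_of_nonneg_left (by positivity)
  · refine (key _ le_rfl h).trans ?_
    gcongr
    exact le_add_of_nonneg_right (by positivity)

/-- The sum of `|k|⁻ᵖ` over nonzero wave vectors converges for `p > 2`. -/
theorem summable_wlen_rpow {p : ℝ} (hp : 2 < p) :
    Summable fun k : Fin 2 → ℤ => if k = 0 then 0 else wlen k ^ (-p) := by
  refine Summable.of_nonneg_of_le (fun k => ?_) (fun k => ?_)
    (EisensteinSeries.summable_one_div_norm_rpow hp)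
  · split_ifs
    · exact le_rfl
    · exact Real.rpow_nonneg (wlen_nonneg k) _
  · split_ifs with h
    · exact Real.rpow_nonneg (norm_nonneg _) _
    · exact Real.rpow_le_rpow_of_nonpos (norm_pos_iff.2 h) (norm_le_wlen k) (by linarith)

end NSE2D

namespace NSE2D

/-! ### The bilinear term in Fourier variables -/

section Nl

variable {A : Type*} [NormedRing A] [NormedAlgebra ℂ A]

/-- The Fourier coefficients of `B (a, b)`, for coefficients in a normed algebra. -/
noncomputable def nl (a b : (Fin 2 → ℤ) → A) (k : Fin 2 → ℤ) : A :=
  ∑' l, (coef l (k - l) : ℂ) • (a l * b (k - l))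

theorem norm_coef_smul_le (a b : (Fin 2 → ℤ) → A) (k l : Fin 2 → ℤ) :
    ‖(coef l (k - l) : ℂ) • (a l * b (k - l))‖ ≤ wlen k * (‖a l‖ * ‖b (k - l)‖) := by
  rw [norm_smul, Complex.norm_real, Real.norm_eq_abs]
  have := abs_coef_le_sum l (k - l)
  rw [add_sub_cancel] at this
  exact mul_le_mul this (norm_mul_le _ _) (norm_nonneg _) (wlen_nonneg _)

theorem norm_coef_smul_le' (a b : (Fin 2 → ℤ) → A) (k l : Fin 2 → ℤ) :
    ‖(coef l (k - l) : ℂ) • (a l * b (k - l))‖ ≤ ‖a l‖ * (wlen (k - l) * ‖b (k - l)‖) := by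
  rw [norm_smul, Complex.norm_real, Real.norm_eq_abs]
  refine (mul_le_mul (abs_coef_le_right l (k - l)) (norm_mul_le _ _) (norm_nonneg _)
    (wlen_nonneg _)).trans (le_of_eq (by ring))

theorem summable_nl_term [CompleteSpace A] {a b : (Fin 2 → ℤ) → A} {k : Fin 2 → ℤ}
    (h : Summable fun l => ‖a l‖ * ‖b (k - l)‖) :
    Summable fun l => (coef l (k - l) : ℂ) • (a l * b (k - l)) :=
  .of_norm_bounded (h.mul_left (wlen k)) fun l => norm_coef_smul_le a b k l

theorem norm_nl_le {a b : (Fin 2 → ℤ) → A} {k : Fin 2 → ℤ}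
    (h : Summable fun l => ‖a l‖ * ‖b (k - l)‖) :
    ‖nl a b k‖ ≤ wlen k * conv (fun l => ‖a l‖) (fun l => ‖b l‖) k := by
  refine (tsum_of_norm_bounded (h.mul_left (wlen k)).hasSum
    fun l => norm_coef_smul_le a b k l).trans (le_of_eq ?_)
  rw [tsum_mul_left]; rfl

theorem norm_nl_le' {a b : (Fin 2 → ℤ) → A} {k : Fin 2 → ℤ}
    (h : Summable fun l => ‖a l‖ * (wlen (k - l) * ‖b (k - l)‖)) :
    ‖nl a b k‖ ≤ conv (fun l => ‖a l‖) (fun l => wlen l * ‖b l‖) k :=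
  tsum_of_norm_bounded h.hasSum fun l => norm_coef_smul_le' a b k l

theorem nl_sub_left [CompleteSpace A] {a a' b : (Fin 2 → ℤ) → A} {k : Fin 2 → ℤ}
    (h : Summable fun l => ‖a l‖ * ‖b (k - l)‖) (h' : Summable fun l => ‖a' l‖ * ‖b (k - l)‖) :
    nl (fun l => a l - a' l) b k = nl a b k - nl a' b k := by
  rw [nl, nl, nl, ← (summable_nl_term h).tsum_sub (summable_nl_term h')]
  exact tsum_congr fun l => by rw [sub_mul, smul_sub]

theorem nl_sub_right [CompleteSpace A] {a b b' : (Fin 2 → ℤ) → A} {k : Fin 2 → ℤ}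
    (h : Summable fun l => ‖a l‖ * ‖b (k - l)‖) (h' : Summable fun l => ‖a l‖ * ‖b' (k - l)‖) :
    nl a (fun l => b l - b' l) k = nl a b k - nl a b' k := by
  rw [nl, nl, nl, ← (summable_nl_term h).tsum_sub (summable_nl_term h')]
  exact tsum_congr fun l => by rw [mul_sub, smul_sub]

/-- A tame estimate: all `s + 1` derivatives fall on one factor and the other is measured in `ℓ¹`
only, so the bound is linear in the top norm `D`. -/
theorem wlen_pow_mul_norm_nl_le {a : (Fin 2 → ℤ) → A} {s : ℕ} {C D : ℝ}
    (ha : Summable fun k => ‖a k‖) (haC : ∑' k, ‖a k‖ ≤ C)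
    (hD : L2Bd (fun k => wlen k ^ (s + 1) * ‖a k‖) D) :
    L2Bd (fun k => wlen k ^ s * ‖nl a a k‖) (2 ^ s * (2 * (C * D))) := by
  have h0 : ∀ k, 0 ≤ ‖a k‖ := fun k => norm_nonneg _
  have h1 : ∀ k, 0 ≤ wlen k ^ (s + 1) * ‖a k‖ :=
    fun k => mul_nonneg (pow_nonneg (wlen_nonneg k) _) (h0 k)
  have hconv := L2Bd.conv h0 h1 ha haC hD
  refine ((hconv.const_mul zero_le_two).const_mul (by positivity : (0 : ℝ) ≤ 2 ^ s)).mono fun k => ?_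
  have hs1 := summable_conv_term_l2 h0 h1 ha hD k
  have hs2 : Summable fun l => wlen l ^ (s + 1) * ‖a l‖ * ‖a (k - l)‖ := by
    rw [← (Equiv.subLeft k).summable_iff]
    simpa [Function.comp_def, mul_comm] using hs1
  rw [abs_of_nonneg (mul_nonneg (pow_nonneg (wlen_nonneg k) _) (norm_nonneg _))]
  have hc : conv (fun k => wlen k ^ (s + 1) * ‖a k‖) (fun k => ‖a k‖) k
      = conv (fun k => ‖a k‖) (fun k => wlen k ^ (s + 1) * ‖a k‖) k := conv_comm _ _ _
  have hb : ∀ l, ‖((wlen k ^ s : ℝ) : ℂ) • (coef l (k - l) : ℂ) • (a l * a (k - l))‖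
      ≤ 2 ^ s * (wlen l ^ (s + 1) * ‖a l‖ * ‖a (k - l)‖
        + ‖a l‖ * (wlen (k - l) ^ (s + 1) * ‖a (k - l)‖)) := by
    intro l
    have := wlen_pow_mul_abs_coef_le s l (k - l)
    rw [add_sub_cancel] at this
    rw [smul_smul, norm_smul, norm_mul, Complex.norm_real, Complex.norm_real, Real.norm_eq_abs,
      Real.norm_eq_abs, abs_of_nonneg (pow_nonneg (wlen_nonneg k) s)]
    calc _ ≤ 2 ^ s * (wlen l ^ (s + 1) + wlen (k - l) ^ (s + 1)) * (‖a l‖ * ‖a (k - l)‖) :=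
          mul_le_mul this (norm_mul_le _ _) (norm_nonneg _)
            (by have := wlen_nonneg l; have := wlen_nonneg (k - l); positivity)
      _ = _ := by ring
  have hfin := tsum_of_norm_bounded ((hs2.add hs1).mul_left (2 ^ s)).hasSum hb
  rw [tsum_const_smul'' , norm_smul, Complex.norm_real, Real.norm_eq_abs,
    abs_of_nonneg (pow_nonneg (wlen_nonneg k) s), tsum_mul_left, hs2.tsum_add hs1] at hfin
  refine hfin.trans (le_of_eq ?_)
  congr 1
  rw [two_mul]
  nth_rewrite 1 [← hc]
  rfl

end Nl

/-! ### Orthogonality relations -/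

section Trilinear

theorem summable_trilinear {Γ : Type*} [AddCommGroup Γ] {f g h : Γ → ℝ} {D E : ℝ}
    (hf : ∀ k, 0 ≤ f k) (hg : ∀ k, 0 ≤ g k) (hh : ∀ k, 0 ≤ h k) (hfs : Summable f)
    (hgs : L2Bd g D) (hhs : L2Bd h E) :
    Summable fun p : Γ × Γ => f p.2 * g (p.1 - p.2) * h p.1 := by
  refine (summable_prod_of_nonneg
    fun p => mul_nonneg (mul_nonneg (hf p.2) (hg (p.1 - p.2))) (hh p.1)).2 ⟨fun k => ?_, ?_⟩
  · exact (summable_conv_term_l2 hf hg hfs hgs k).mul_right (h k)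
  · have := (L2Bd.conv hf hg hfs le_rfl hgs).summable_mul hhs (conv_nonneg hf hg) hh
    refine this.congr fun k => ?_
    exact tsum_mul_right.symm

open ComplexConjugate in
theorem re_tsum_antisymm {q : (Fin 2 → ℤ) → (Fin 2 → ℤ) → ℝ}
    (hq : ∀ l m, q (-l) (l + m) = -q l m) {a d : (Fin 2 → ℤ) → ℂ}
    (ha : ∀ k, a (-k) = conj (a k)) :
    (∑' p : (Fin 2 → ℤ) × (Fin 2 → ℤ),
      (q p.2 (p.1 - p.2) : ℂ) * (a p.2 * d (p.1 - p.2)) * conj (d p.1)).re = 0 := by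
  set F : (Fin 2 → ℤ) × (Fin 2 → ℤ) → ℂ := fun p =>
    (q p.2 (p.1 - p.2) : ℂ) * (a p.2 * d (p.1 - p.2)) * conj (d p.1) with hF
  -- With `k = l + m` the involution `(k, l) ↦ (k - l, -l)` exchanges the two occurrences of `d`;
  -- together with the reality of `a` it sends each term to minus its conjugate.
  let e : (Fin 2 → ℤ) × (Fin 2 → ℤ) ≃ (Fin 2 → ℤ) × (Fin 2 → ℤ) :=
    { toFun := fun p => (p.1 - p.2, -p.2)
      invFun := fun p => (p.1 - p.2, -p.2)
      left_inv := fun p => by simp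
      right_inv := fun p => by simp }
  have h1 : ∀ p, F (e p) = -conj (F p) := by
    intro p
    have := hq p.2 (p.1 - p.2)
    rw [add_sub_cancel] at this
    simp only [hF, e, Equiv.coe_fn_mk, ha, map_mul, Complex.conj_conj, sub_neg_eq_add,
      sub_add_cancel, this, Complex.conj_ofReal, Complex.ofReal_neg]
    ring
  have h2 : ∑' p, F p = -conj (∑' p, F p) := by
    rw [Complex.conj_tsum, ← tsum_neg, ← e.tsum_eq F]
    exact tsum_congr h1
  have h3 := congrArg Complex.re h2
  rw [Complex.neg_re, Complex.conj_re] at h3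
  linarith

open ComplexConjugate in
/-- `Re (B (a, d), d) = 0` for real `a`. -/
theorem re_tsum_nl_mul_conj {a d : (Fin 2 → ℤ) → ℂ} {D E : ℝ}
    (ha : ∀ k, a (-k) = conj (a k)) (has : Summable fun k => ‖a k‖)
    (hd : L2Bd (fun k => ‖d k‖) D) (hd1 : L2Bd (fun k => wlen k * ‖d k‖) E) :
    (∑' k, nl a d k * conj (d k)).re = 0 := by
  have hw : ∀ k, 0 ≤ wlen k * ‖d k‖ := fun k => mul_nonneg (wlen_nonneg _) (norm_nonneg _)
  have hS := summable_trilinear (fun k => norm_nonneg (a k)) hw (fun k => norm_nonneg (d k)) has hd1 hd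
  have hS' : Summable fun p : (Fin 2 → ℤ) × (Fin 2 → ℤ) =>
      (coef p.2 (p.1 - p.2) : ℂ) * (a p.2 * d (p.1 - p.2)) * conj (d p.1) := by
    refine .of_norm_bounded hS fun p => ?_
    rw [norm_mul, RCLike.norm_conj]
    exact mul_le_mul_of_nonneg_right (norm_coef_smul_le' a d p.1 p.2) (norm_nonneg _)
  rw [← re_tsum_antisymm coef_antisymm ha (d := d), hS'.tsum_prod]
  congr 1
  exact tsum_congr fun k => tsum_mul_right.symm

/-- Average the sum with its image under `l ↦ k - l` and use `coef_add_swap`. -/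
theorem nl_self_eq_vcoef {a : (Fin 2 → ℤ) → ℂ} {D : ℝ} (has : Summable fun k => ‖a k‖)
    (ha1 : L2Bd (fun k => wlen k * ‖a k‖) D) (k : Fin 2 → ℤ) :
    nl a a k = ∑' l, (vcoef l (k - l) : ℂ) * (a l * a (k - l)) := by
  have hw : ∀ k, 0 ≤ wlen k * ‖a k‖ := fun k => mul_nonneg (wlen_nonneg _) (norm_nonneg _)
  have hb := summable_conv_term_l2 (fun k => norm_nonneg (a k)) hw has ha1 k
  have h1 : Summable fun l => (coef l (k - l) : ℂ) * (a l * a (k - l)) :=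
    .of_norm_bounded hb fun l => norm_coef_smul_le' a a k l
  have h2 : Summable fun l => (vcoef l (k - l) : ℂ) * (a l * a (k - l)) := by
    refine .of_norm_bounded hb fun l => ?_
    rw [norm_mul, Complex.norm_real, Real.norm_eq_abs, norm_mul]
    refine (mul_le_mul_of_nonneg_right (abs_vcoef_le_right l (k - l))
      (by positivity)).trans (le_of_eq (by ring))
  have h1' := (Equiv.subLeft k).tsum_eq fun l => (coef l (k - l) : ℂ) * (a l * a (k - l))
  have h2' := (Equiv.subLeft k).tsum_eq fun l => (vcoef l (k - l) : ℂ) * (a l * a (k - l))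
  have s1 := (Equiv.subLeft k).summable_iff.2 h1
  have s2 := (Equiv.subLeft k).summable_iff.2 h2
  simp only [Equiv.subLeft_apply, sub_sub_cancel, Function.comp_def] at h1' h2' s1 s2
  have key : ∑' l, ((coef l (k - l) : ℂ) * (a l * a (k - l)) + (coef (k - l) l : ℂ) * (a (k - l) * a l))
      = ∑' l, ((vcoef l (k - l) : ℂ) * (a l * a (k - l))
        + (vcoef (k - l) l : ℂ) * (a (k - l) * a l)) := by
    refine tsum_congr fun l => ?_
    have : (coef l (k - l) : ℂ) + coef (k - l) l = vcoef l (k - l) + vcoef (k - l) l :=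
      mod_cast coef_add_swap l (k - l)
    linear_combination (a l * a (k - l)) * this
  rw [h1.tsum_add s1, h2.tsum_add s2, h1', h2', ← two_mul, ← two_mul] at key
  exact mul_left_cancel₀ two_ne_zero key

open ComplexConjugate in
/-- `(B (a, a), A a) = 0` for real `a`. -/
theorem re_tsum_nl_mul_stokes {a : (Fin 2 → ℤ) → ℂ} {D E : ℝ}
    (ha : ∀ k, a (-k) = conj (a k)) (has : Summable fun k => ‖a k‖)
    (ha1 : L2Bd (fun k => wlen k * ‖a k‖) D) (ha2 : L2Bd (fun k => wlen k ^ 2 * ‖a k‖) E) :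
    (∑' k, nl a a k * ((wlen k ^ 2 : ℝ) * conj (a k))).re = 0 := by
  have hw : ∀ k, 0 ≤ wlen k * ‖a k‖ := fun k => mul_nonneg (wlen_nonneg _) (norm_nonneg _)
  have hw2 : ∀ k, 0 ≤ wlen k ^ 2 * ‖a k‖ :=
    fun k => mul_nonneg (pow_nonneg (wlen_nonneg _) _) (norm_nonneg _)
  have hS := summable_trilinear (fun k => norm_nonneg (a k)) hw hw2 has ha1 ha2
  have hS' : Summable fun p : (Fin 2 → ℤ) × (Fin 2 → ℤ) =>
      ((vcoef p.2 (p.1 - p.2) * wlen p.1 ^ 2 : ℝ) : ℂ) *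
        (a p.2 * a (p.1 - p.2)) * conj (a p.1) := by
    refine .of_norm_bounded hS fun p => ?_
    rw [norm_mul, RCLike.norm_conj, norm_mul, Complex.norm_real, Real.norm_eq_abs,
      abs_mul, abs_of_nonneg (pow_nonneg (wlen_nonneg p.1) 2), norm_mul]
    have := mul_le_mul_of_nonneg_right (abs_vcoef_le_right p.2 (p.1 - p.2))
      (by have := wlen_nonneg p.1; positivity :
        0 ≤ wlen p.1 ^ 2 * (‖a p.2‖ * ‖a (p.1 - p.2)‖) * ‖a p.1‖)
    calc _ = |vcoef p.2 (p.1 - p.2)| *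
          (wlen p.1 ^ 2 * (‖a p.2‖ * ‖a (p.1 - p.2)‖) * ‖a p.1‖) := by ring
      _ ≤ _ := this
      _ = _ := by ring
  have hq : ∀ l m, (fun l m => vcoef l m * wlen (l + m) ^ 2) (-l) (l + m)
      = -(fun l m => vcoef l m * wlen (l + m) ^ 2) l m := by
    intro l m
    simpa using vcoef_antisymm l m
  rw [← re_tsum_antisymm (q := fun l m => vcoef l m * wlen (l + m) ^ 2) hq ha (d := a)]
  simp only [add_sub_cancel]
  rw [hS'.tsum_prod]
  congr 1
  refine tsum_congr fun k => ?_
  rw [nl_self_eq_vcoef has ha1]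
  refine tsum_mul_right.symm.trans (tsum_congr fun l => ?_)
  push_cast
  ring

-- The derivative is moved from `w` to the factor `d` tested against, so that differences of
-- solutions are controlled with only the `ℓ¹` norm of `w`.
open ComplexConjugate in
theorem norm_tsum_nl_mul_conj_le {d w : (Fin 2 → ℤ) → ℂ} {W D E : ℝ}
    (hw : Summable fun k => ‖w k‖) (hW : ∑' k, ‖w k‖ ≤ W)
    (hd : L2Bd (fun k => ‖d k‖) D) (hd1 : L2Bd (fun k => wlen k * ‖d k‖) E) :
    ‖∑' k, nl d w k * conj (d k)‖ ≤ W * D * E := by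
  have hwn : ∀ k, 0 ≤ ‖w k‖ := fun k => norm_nonneg _
  have hdn : ∀ k, 0 ≤ ‖d k‖ := fun k => norm_nonneg _
  have hdn1 : ∀ k, 0 ≤ wlen k * ‖d k‖ := fun k => mul_nonneg (wlen_nonneg _) (hdn k)
  have hc := L2Bd.conv hwn hdn hw hW hd
  have hcn := conv_nonneg hwn hdn
  have hs := hc.summable_mul hd1 hcn hdn1
  refine (tsum_of_norm_bounded hs.hasSum fun k => ?_).trans (hc.tsum_mul_le hd1 hcn hdn1)
  rw [norm_mul, RCLike.norm_conj]
  have hsk : Summable fun l => ‖d l‖ * ‖w (k - l)‖ := by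
    have := (Equiv.subLeft k).summable_iff.2 (summable_conv_term_l2 hwn hdn hw hd k)
    simpa [Function.comp_def, mul_comm] using this
  have := norm_nl_le hsk
  rw [conv_comm] at this
  refine (mul_le_mul_of_nonneg_right this (hdn k)).trans (le_of_eq (by ring))

end Trilinear

end NSE2D

namespace NSE2D

set_option linter.unusedSectionVars false

/-! ### The heat semigroup with values in a Banach algebra -/

section Heat

variable {A : Type*} [NormedCommRing A] [NormedAlgebra ℂ A] [CompleteSpace A]

/-- `exp (-s λ)`. -/
noncomputable def sg (lam : A) (s : ℝ) : A := NormedSpace.exp ((-s) • lam)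

theorem sg_zero (lam : A) : sg lam 0 = 1 := by simp [sg]

theorem sg_add (lam : A) (s t : ℝ) : sg lam (s + t) = sg lam s * sg lam t := by
  let _ : NormedAlgebra ℚ A := NormedAlgebra.restrictScalars ℚ ℝ A
  rw [sg, sg, sg, ← NormedSpace.exp_add_of_commute (Commute.all _ _), ← add_smul, neg_add]

theorem hasDerivAt_sg (lam : A) (s : ℝ) : HasDerivAt (sg lam) (-(lam * sg lam s)) s := by
  have h := (hasDerivAt_exp_smul_const (𝕂 := ℝ) lam (-s)).scomp s (hasDerivAt_neg s)
  rw [neg_one_smul, mul_comm] at h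
  exact h

theorem continuous_sg (lam : A) : Continuous (sg lam) :=
  continuous_iff_continuousAt.2 fun s => (hasDerivAt_sg lam s).continuousAt

/-- The Duhamel integral `∫₀ˢ exp (-c (s - r) λ) λ F r dr`. -/
noncomputable def duhamel (lam : A) (c : ℝ) (F : ℝ → A) (s : ℝ) : A :=
  sg lam (c * s) * ∫ r in (0 : ℝ)..s, sg lam (-(c * r)) * (lam * F r)

theorem continuous_duhamel_integrand (lam : A) (c : ℝ) {F : ℝ → A} (hF : Continuous F) :
    Continuous fun r => sg lam (-(c * r)) * (lam * F r) :=
  ((continuous_sg lam).comp (by fun_prop)).mul (by fun_prop)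

theorem hasDerivAt_duhamel (lam : A) (c : ℝ) {F : ℝ → A} (hF : Continuous F) (s : ℝ) :
    HasDerivAt (duhamel lam c F) (lam * F s - c • (lam * duhamel lam c F s)) s := by
  have hcont := continuous_duhamel_integrand lam c hF
  have h1 : HasDerivAt (fun s : ℝ => sg lam (c * s)) (c • -(lam * sg lam (c * s))) s := by
    have h := (hasDerivAt_sg lam (c * s)).scomp s ((hasDerivAt_id s).const_mul c)
    rw [mul_one] at h
    exact h
  have h2 := intervalIntegral.integral_hasDerivAt_right (hcont.intervalIntegrable 0 s)
    (hcont.stronglyMeasurableAtFilter _ _) hcont.continuousAt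
  refine (h1.mul h2).congr_deriv ?_
  rw [← mul_assoc (sg lam (c * s)), ← sg_add, add_neg_cancel, sg_zero, one_mul, duhamel]
  simp only [smul_neg, neg_mul, smul_mul_assoc, mul_assoc]
  abel

/-- The factored definition is easy to differentiate but contains growing exponentials; estimates
need this form, where only times `s - r ≥ 0` occur. -/
theorem duhamel_eq (lam : A) (c : ℝ) {F : ℝ → A} (hF : Continuous F) (s : ℝ) :
    duhamel lam c F s = ∫ r in (0 : ℝ)..s, sg lam (c * (s - r)) * (lam * F r) := by
  have h := (ContinuousLinearMap.mul ℝ A (sg lam (c * s))).intervalIntegral_comp_comm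
    ((continuous_duhamel_integrand lam c hF).intervalIntegrable (μ := volume) 0 s)
  rw [duhamel, ← ContinuousLinearMap.mul_apply' (𝕜 := ℝ), ← h]
  refine intervalIntegral.integral_congr fun r _ => ?_
  simp only [ContinuousLinearMap.mul_apply']
  rw [← mul_assoc, ← sg_add]
  congr 2
  ring

theorem duhamel_sub (lam : A) (c : ℝ) {F G : ℝ → A} (hF : Continuous F) (hG : Continuous G)
    (s : ℝ) : duhamel lam c (fun r => F r - G r) s = duhamel lam c F s - duhamel lam c G s := by
  rw [duhamel, duhamel, duhamel, ← mul_sub, ← intervalIntegral.integral_sub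
    ((continuous_duhamel_integrand lam c hF).intervalIntegrable _ _)
    ((continuous_duhamel_integrand lam c hG).intervalIntegrable _ _)]
  simp only [mul_sub]

/-- The hypotheses on the complexified time direction `λ`. -/
structure IsDamping (lam : A) : Prop where
  -- Both constants come from the disc `|λ - 1| ≤ 1/2`, on which `|λ| ≤ 3/2` and `Re λ ≥ 1/2`.
  norm_le : ‖lam‖ ≤ 3 / 2
  norm_sg_le : ∀ s, 0 ≤ s → ‖sg lam s‖ ≤ Real.exp (-s / 2)

variable {lam : A} (hl : IsDamping lam)
include hl

theorem IsDamping.norm_one_le : ‖(1 : A)‖ ≤ 1 := by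
  simpa [sg_zero] using hl.norm_sg_le 0 le_rfl

theorem IsDamping.norm_sg_le_one {s : ℝ} (hs : 0 ≤ s) : ‖sg lam s‖ ≤ 1 :=
  (hl.norm_sg_le s hs).trans (Real.exp_le_one_iff.2 (by linarith))

theorem IsDamping.norm_integrand_le {c : ℝ} (hc : 0 ≤ c) {F : ℝ → A} {M : ℝ} (hM : ∀ r, ‖F r‖ ≤ M)
    {r s : ℝ} (hrs : r ≤ s) :
    ‖sg lam (c * (s - r)) * (lam * F r)‖ ≤ Real.exp (-(c * (s - r)) / 2) * (3 / 2 * M) := by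
  refine (norm_mul_le _ _).trans (mul_le_mul (hl.norm_sg_le _ (mul_nonneg hc (by linarith)))
    ?_ (norm_nonneg _) (Real.exp_pos _).le)
  exact (norm_mul_le _ _).trans (mul_le_mul hl.norm_le (hM r) (norm_nonneg _) (by norm_num))

theorem IsDamping.norm_duhamel_le {c : ℝ} (hc : 0 ≤ c) {F : ℝ → A} (hF : Continuous F) {M : ℝ}
    (hM : ∀ r, ‖F r‖ ≤ M) {s : ℝ} (hs : 0 ≤ s) : ‖duhamel lam c F s‖ ≤ 3 / 2 * M * s := by
  have hM0 : 0 ≤ M := (norm_nonneg _).trans (hM 0)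
  rw [duhamel_eq lam c hF]
  have := intervalIntegral.norm_integral_le_of_norm_le_const (a := 0) (b := s)
    (f := fun r => sg lam (c * (s - r)) * (lam * F r)) (C := 3 / 2 * M) (fun r hr => by
      rw [Set.uIoc_of_le hs] at hr
      refine (hl.norm_integrand_le hc hM hr.2).trans (mul_le_of_le_one_left (by positivity) ?_)
      refine Real.exp_le_one_iff.2 ?_
      have := mul_nonneg hc (sub_nonneg.2 hr.2)
      linarith)
  rwa [sub_zero, abs_of_nonneg hs] at this

theorem IsDamping.mul_norm_duhamel_le {c : ℝ} (hc : 0 ≤ c) {F : ℝ → A} (hF : Continuous F) {M : ℝ}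
    (hM : ∀ r, ‖F r‖ ≤ M) {s : ℝ} (hs : 0 ≤ s) : c * ‖duhamel lam c F s‖ ≤ 3 * M := by
  have hM0 : 0 ≤ M := (norm_nonneg _).trans (hM 0)
  rcases hc.eq_or_lt with rfl | hc'
  · simpa using hM0
  rw [duhamel_eq lam c hF]
  -- An explicit primitive of the majorant: `∫ exp(-c(s-r)/2) dr ≤ 2/c`, and `(2/c)(3/2) M = 3M/c`.
  have hder : ∀ r : ℝ, HasDerivAt (fun r => 2 / c * (Real.exp (-(c * (s - r)) / 2) * (3 / 2 * M)))
      (Real.exp (-(c * (s - r)) / 2) * (3 / 2 * M)) r := by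
    intro r
    have h1 : HasDerivAt (fun r => -(c * (s - r)) / 2) (c / 2) r := by
      have := ((((hasDerivAt_id r).const_sub s).const_mul c).neg).div_const 2
      exact this.congr_deriv (by ring)
    refine ((h1.exp.mul_const (3 / 2 * M)).const_mul (2 / c)).congr_deriv ?_
    field_simp
  have hcont : Continuous fun r => Real.exp (-(c * (s - r)) / 2) * (3 / 2 * M) := by fun_prop
  have h1 := intervalIntegral.norm_integral_le_of_norm_le (μ := volume) hs
    (f := fun r => sg lam (c * (s - r)) * (lam * F r))
    (g := fun r => Real.exp (-(c * (s - r)) / 2) * (3 / 2 * M))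
    (Filter.Eventually.of_forall fun r hr => hl.norm_integrand_le hc hM hr.2)
    (hcont.intervalIntegrable _ _)
  rw [intervalIntegral.integral_eq_sub_of_hasDerivAt (fun r _ => hder r)
    (hcont.intervalIntegrable _ _)] at h1
  refine (mul_le_mul_of_nonneg_left h1 hc).trans ?_
  rw [sub_self, mul_zero, neg_zero, zero_div, Real.exp_zero, ← mul_sub, ← mul_assoc,
    mul_div_cancel₀ _ hc'.ne']
  have := mul_nonneg (Real.exp_pos (-(c * (s - 0)) / 2)).le hM0
  linarith

end Heat

/-! ### Local existence -/

section Local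

variable {A : Type*} [NormedCommRing A] [NormedAlgebra ℂ A] [CompleteSpace A]

open Set

/-- The Duhamel integral as an operator on continuous functions on `[0, T]`. -/
noncomputable def duhamelC (lam : A) {T : ℝ} (hT : 0 ≤ T) (c : ℝ) (F : C(Icc 0 T, A)) :
    C(Icc 0 T, A) where
  toFun s := duhamel lam c (fun r => F (projIcc 0 T hT r)) s
  continuous_toFun := by
    have hF : Continuous fun r => F (projIcc 0 T hT r) := F.continuous.comp continuous_projIcc
    exact (continuous_iff_continuousAt.2
      fun s => (hasDerivAt_duhamel lam c hF s).continuousAt).comp continuous_subtype_val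

/-- The contribution of the initial value. -/
noncomputable def heatC (lam : A) (T c : ℝ) (u : ℂ) : C(Icc 0 T, A) where
  toFun s := u • sg lam (c * s)
  continuous_toFun := ((continuous_sg lam).comp (by fun_prop)).const_smul u

variable {lam : A} (hl : IsDamping lam) {T : ℝ} (hT : 0 ≤ T)

theorem duhamelC_sub (c : ℝ) (F G : C(Icc 0 T, A)) :
    duhamelC lam hT c (F - G) = duhamelC lam hT c F - duhamelC lam hT c G := by
  ext s
  exact duhamel_sub lam c (F.continuous.comp continuous_projIcc)
    (G.continuous.comp continuous_projIcc) s

theorem duhamelC_zero (c : ℝ) : duhamelC lam hT c 0 = 0 := by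
  have := duhamelC_sub (lam := lam) hT c 0 0
  simpa using this

include hl

theorem norm_heatC_le {c : ℝ} (hc : 0 ≤ c) (u : ℂ) : ‖heatC lam T c u‖ ≤ ‖u‖ := by
  refine (ContinuousMap.norm_le _ (norm_nonneg u)).2 fun s => ?_
  refine (norm_smul_le _ _).trans (mul_le_of_le_one_right (norm_nonneg u)
    (hl.norm_sg_le_one (mul_nonneg hc s.2.1)))

theorem norm_duhamelC_le {c : ℝ} (hc : 0 ≤ c) (F : C(Icc 0 T, A)) :
    ‖duhamelC lam hT c F‖ ≤ 3 / 2 * ‖F‖ * T := by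
  refine (ContinuousMap.norm_le _ (by positivity)).2 fun s => ?_
  refine (hl.norm_duhamel_le hc (F.continuous.comp continuous_projIcc)
    (fun r => F.norm_coe_le_norm _) s.2.1).trans ?_
  exact mul_le_mul_of_nonneg_left s.2.2 (by positivity)

theorem mul_norm_duhamelC_le {c : ℝ} (hc : 0 ≤ c) (F : C(Icc 0 T, A)) :
    c * ‖duhamelC lam hT c F‖ ≤ 3 * ‖F‖ := by
  rcases hc.eq_or_lt with rfl | hc'
  · simp
  rw [← le_div_iff₀' hc']
  refine (ContinuousMap.norm_le _ (by positivity)).2 fun s => ?_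
  rw [le_div_iff₀' hc']
  exact hl.mul_norm_duhamel_le hc (F.continuous.comp continuous_projIcc)
    (fun r => F.norm_coe_le_norm _) s.2.1

/-- Parabolic smoothing: the geometric mean of the bounds `(3/2)‖F‖T` and `3‖F‖/w²` is at most `3 √T
‖F‖/w`. With `w = |k|` this recovers the derivative lost in the nonlinearity. -/
theorem norm_duhamelC_le_sqrt {w C : ℝ} (hw : 0 ≤ w) (hC : 0 ≤ C) {F : C(Icc 0 T, A)}
    (hF : ‖F‖ ≤ w * C) : ‖duhamelC lam hT (w ^ 2) F‖ ≤ 3 * Real.sqrt T * C := by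
  rcases hw.eq_or_lt with rfl | hw'
  · have : F = 0 := by simpa using hF
    rw [this, duhamelC_zero, norm_zero]
    positivity
  have h1 := norm_duhamelC_le hl hT (sq_nonneg w) F
  have h2 := mul_norm_duhamelC_le hl hT (sq_nonneg w) F
  set N := ‖duhamelC lam hT (w ^ 2) F‖
  have hN : 0 ≤ N := norm_nonneg _
  refine le_of_sq_le_sq ?_ (by positivity)
  have h3 : w ^ 2 * N * N ≤ 3 * (w * C) * (3 / 2 * (w * C) * T) := by
    refine mul_le_mul (h2.trans (by linarith)) (h1.trans ?_) hN (by positivity)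
    gcongr
  have h4 : w ^ 2 * N ^ 2 ≤ w ^ 2 * (3 * Real.sqrt T * C) ^ 2 := by
    rw [mul_pow, mul_pow, Real.sq_sqrt hT]
    have : 0 ≤ w ^ 2 * (T * C ^ 2) := by positivity
    nlinarith
  exact le_of_mul_le_mul_left h4 (by positivity)

end Local

end NSE2D

namespace NSE2D

set_option linter.unusedSectionVars false

/-! ### The space `ℓ¹` of amplitude families, and the contraction argument in it. -/

section LpOne

variable {ι E : Type*} [NormedAddCommGroup E]

theorem memℓp_one_iff {f : ι → E} : Memℓp f 1 ↔ Summable fun k => ‖f k‖ := by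
  rw [memℓp_gen_iff (by norm_num)]
  simp

theorem lp_one_summable (f : lp (fun _ : ι => E) 1) : Summable fun k => ‖f k‖ :=
  memℓp_one_iff.1 f.2

theorem lp_one_norm_eq (f : lp (fun _ : ι => E) 1) : ‖f‖ = ∑' k, ‖f k‖ := by
  rw [lp.norm_eq_tsum_rpow (by norm_num)]
  simp

end LpOne

section Local

open Set

variable {A : Type*} [NormedCommRing A] [NormedAlgebra ℂ A] [CompleteSpace A]
variable {lam : A} (hl : IsDamping lam) {T : ℝ} (hT : 0 ≤ T)
include hl

theorem norm_algebraMap_le (z : ℂ) : ‖algebraMap ℂ C(Icc 0 T, A) z‖ ≤ ‖z‖ := by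
  rw [norm_algebraMap]
  refine mul_le_of_le_one_right (norm_nonneg z) ?_
  exact (ContinuousMap.norm_le _ zero_le_one).2 fun s => hl.norm_one_le

/-- Bounds for the part of the Duhamel formula coming from the initial value and the force. -/
theorem norm_base_le {u f : (Fin 2 → ℤ) → ℂ} (hf0 : f 0 = 0) (k : Fin 2 → ℤ) :
    ‖heatC lam T (wlen k ^ 2) (u k) + duhamelC lam hT (wlen k ^ 2) (algebraMap ℂ _ (f k))‖
      ≤ ‖u k‖ + 3 * (‖f k‖ / wlen k ^ 2) := by
  refine (norm_add_le _ _).trans (add_le_add (norm_heatC_le hl (sq_nonneg _) _) ?_)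
  rcases eq_or_ne k 0 with rfl | hk
  · simp [hf0, duhamelC_zero]
  · have hw := wlen_pos hk
    rw [← mul_div_assoc, le_div_iff₀' (by positivity)]
    exact (mul_norm_duhamelC_le hl hT (sq_nonneg _) _).trans
      (mul_le_mul_of_nonneg_left (norm_algebraMap_le hl _) (by norm_num))

/-- The Duhamel formula has a solution on a time interval whose length is controlled by the `ℓ¹`
norm of the data. -/
theorem exists_mild_solution {u f : (Fin 2 → ℤ) → ℂ} {ρ : ℝ} (hf0 : f 0 = 0)
    (hu : Summable fun k => ‖u k‖) (hf : Summable fun k => ‖f k‖ / wlen k ^ 2)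
    (hρ : ∑' k, ‖u k‖ + 3 * ∑' k, ‖f k‖ / wlen k ^ 2 ≤ ρ) (hsmall : 24 * ρ * Real.sqrt T ≤ 1) :
    ∃ b : (Fin 2 → ℤ) → C(Icc 0 T, A), Summable (fun k => ‖b k‖) ∧ ∑' k, ‖b k‖ ≤ 2 * ρ ∧
      ∀ k, b k = heatC lam T (wlen k ^ 2) (u k)
        + duhamelC lam hT (wlen k ^ 2) (algebraMap ℂ _ (f k) - nl b b k) := by
  set base : (Fin 2 → ℤ) → C(Icc 0 T, A) := fun k =>
    heatC lam T (wlen k ^ 2) (u k) + duhamelC lam hT (wlen k ^ 2) (algebraMap ℂ _ (f k)) with hbase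
  have hbs' : Summable fun k => ‖u k‖ + 3 * (‖f k‖ / wlen k ^ 2) := hu.add (hf.mul_left 3)
  have hbs : Summable fun k => ‖base k‖ :=
    .of_nonneg_of_le (fun _ => norm_nonneg _) (norm_base_le hl hT hf0) hbs'
  have hbρ : ∑' k, ‖base k‖ ≤ ρ := by
    refine (hbs.tsum_le_tsum (norm_base_le hl hT hf0) hbs').trans ?_
    rwa [hu.tsum_add (hf.mul_left 3), tsum_mul_left]
  have hρ0 : 0 ≤ ρ := (tsum_nonneg fun _ => norm_nonneg _).trans hbρ
  have hn : ∀ (b : (Fin 2 → ℤ) → C(Icc 0 T, A)) k, 0 ≤ ‖b k‖ := fun _ _ => norm_nonneg _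
  set B : ((Fin 2 → ℤ) → C(Icc 0 T, A)) → ((Fin 2 → ℤ) → C(Icc 0 T, A)) →
    (Fin 2 → ℤ) → C(Icc 0 T, A) := fun b b' k => duhamelC lam hT (wlen k ^ 2) (nl b b' k) with hB
  have hBk : ∀ b b', Summable (fun k => ‖b k‖) → Summable (fun k => ‖b' k‖) → ∀ k,
      ‖B b b' k‖ ≤ 3 * Real.sqrt T * conv (fun l => ‖b l‖) (fun l => ‖b' l‖) k := by
    intro b b' hb hb' k
    exact norm_duhamelC_le_sqrt hl hT (wlen_nonneg k) (conv_nonneg (hn b) (hn b') k)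
      (norm_nl_le (summable_conv_term (hn b) (hn b') hb hb' k))
  have hBs : ∀ b b', Summable (fun k => ‖b k‖) → Summable (fun k => ‖b' k‖) →
      Summable fun k => ‖B b b' k‖ := fun b b' hb hb' =>
    .of_nonneg_of_le (fun _ => norm_nonneg _) (hBk b b' hb hb')
      ((summable_conv (hn b) (hn b') hb hb').mul_left _)
  have hBt : ∀ b b', Summable (fun k => ‖b k‖) → Summable (fun k => ‖b' k‖) →
      ∑' k, ‖B b b' k‖ ≤ 3 * Real.sqrt T * ((∑' k, ‖b k‖) * ∑' k, ‖b' k‖) := by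
    intro b b' hb hb'
    refine ((hBs b b' hb hb').tsum_le_tsum (hBk b b' hb hb')
      ((summable_conv (hn b) (hn b') hb hb').mul_left _)).trans ?_
    rw [tsum_mul_left, tsum_conv (hn b) (hn b') hb hb']
  set Φ : lp (fun _ : Fin 2 → ℤ => C(Icc 0 T, A)) 1 → lp (fun _ : Fin 2 → ℤ => C(Icc 0 T, A)) 1 :=
    fun b => ⟨fun k => base k - B b b k, (memℓp_one_iff.2 hbs).sub
      (memℓp_one_iff.2 (hBs b b (lp_one_summable b) (lp_one_summable b)))⟩ with hΦ
  -- On the ball of radius `2ρ` the quadratic part has norm at most `3√T·4ρ² ≤ ρ/2`.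
  have hmaps : MapsTo Φ (Metric.closedBall 0 (2 * ρ)) (Metric.closedBall 0 (2 * ρ)) := by
    intro b hb
    rw [mem_closedBall_zero_iff] at hb ⊢
    have hbsum := lp_one_summable b
    rw [lp_one_norm_eq] at hb ⊢
    have h1 : ∑' k, ‖Φ b k‖ ≤ ∑' k, (‖base k‖ + ‖B b b k‖) :=
      (lp_one_summable (Φ b)).tsum_le_tsum (fun k => norm_sub_le _ _)
        (hbs.add (hBs b b hbsum hbsum))
    rw [hbs.tsum_add (hBs b b hbsum hbsum)] at h1
    have h2 := hBt b b hbsum hbsum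
    have h3 : (∑' k, ‖b k‖) * ∑' k, ‖b k‖ ≤ 2 * ρ * (2 * ρ) :=
      mul_le_mul hb hb (tsum_nonneg fun _ => norm_nonneg _) (by positivity)
    have h4 := mul_le_mul_of_nonneg_left h3 (by positivity : 0 ≤ 3 * Real.sqrt T)
    nlinarith
  -- The Lipschitz constant is `3√T·(2ρ + 2ρ) = 12ρ√T`; the number 24 in the smallness condition
  -- makes it at most `1/2`.
  have hlip : ∀ b ∈ Metric.closedBall (0 : lp (fun _ : Fin 2 → ℤ => C(Icc 0 T, A)) 1) (2 * ρ),
      ∀ b' ∈ Metric.closedBall (0 : lp (fun _ : Fin 2 → ℤ => C(Icc 0 T, A)) 1) (2 * ρ),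
      ‖Φ b - Φ b'‖ ≤ 1 / 2 * ‖b - b'‖ := by
    intro b hb b' hb'
    rw [mem_closedBall_zero_iff] at hb hb'
    have s1 := lp_one_summable b
    have s2 := lp_one_summable b'
    have s3 := lp_one_summable (b - b')
    rw [lp_one_norm_eq] at hb hb' ⊢
    -- Bilinearity: `B(b,b) - B(b',b') = B(b-b',b) + B(b',b-b')`.
    have hid : ∀ k, (Φ b - Φ b') k = -(B (b - b' : lp _ 1) b k + B b' (b - b' : lp _ 1) k) := by
      intro k
      have e1 := nl_sub_left (summable_conv_term (hn b) (hn b) s1 s1 k)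
        (summable_conv_term (hn b') (hn b) s2 s1 k)
      have e2 := nl_sub_right (summable_conv_term (hn b') (hn b) s2 s1 k)
        (summable_conv_term (hn b') (hn b') s2 s2 k)
      have e1' : B (b - b' : lp _ 1) b k = B b b k - B b' b k := by
        simp only [hB]; rw [← duhamelC_sub, ← e1]; rfl
      have e2' : B b' (b - b' : lp _ 1) k = B b' b k - B b' b' k := by
        simp only [hB]; rw [← duhamelC_sub, ← e2]; rfl
      rw [e1', e2', lp.coeFn_sub, Pi.sub_apply]
      simp only [hΦ]
      abel
    have hs := (hBs _ _ s3 s1).add (hBs _ _ s2 s3)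
    have h1 : ∑' k, ‖(Φ b - Φ b') k‖
        ≤ ∑' k, (‖B (b - b' : lp _ 1) b k‖ + ‖B b' (b - b' : lp _ 1) k‖) := by
      refine (lp_one_summable (Φ b - Φ b')).tsum_le_tsum (fun k => ?_) hs
      rw [hid, norm_neg]
      exact norm_add_le _ _
    rw [(hBs _ _ s3 s1).tsum_add (hBs _ _ s2 s3)] at h1
    have h2 := hBt _ _ s3 s1
    have h3 := hBt _ _ s2 s3
    set N := ∑' k, ‖(b - b') k‖
    have hN : 0 ≤ N := tsum_nonneg fun _ => norm_nonneg _
    have h4 := mul_le_mul_of_nonneg_left hb hN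
    have h5 := mul_le_mul_of_nonneg_right hb' hN
    rw [lp_one_norm_eq]
    change _ ≤ 1 / 2 * N
    have hq : 0 ≤ 3 * Real.sqrt T := by positivity
    calc _ ≤ 3 * Real.sqrt T * (N * (2 * ρ)) + 3 * Real.sqrt T * (2 * ρ * N) :=
          h1.trans (add_le_add (h2.trans (mul_le_mul_of_nonneg_left h4 hq))
            (h3.trans (mul_le_mul_of_nonneg_left h5 hq)))
      _ = 1 / 2 * (24 * ρ * Real.sqrt T) * N := by ring
      _ ≤ 1 / 2 * 1 * N := by gcongr
      _ = 1 / 2 * N := by ring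
  have hcontr : ContractingWith (1 / 2) (hmaps.restrict Φ _ _) := by
    refine ⟨by rw [← NNReal.coe_lt_coe]; norm_num, LipschitzWith.of_dist_le_mul fun b b' => ?_⟩
    have := hlip b.1 b.2 b'.1 b'.2
    rw [Subtype.dist_eq, Subtype.dist_eq, dist_eq_norm, dist_eq_norm]
    simpa using this
  obtain ⟨b, hb, hfix, -⟩ := ContractingWith.exists_fixedPoint'
    (Metric.isClosed_closedBall.isComplete) hmaps hcontr
    (Metric.mem_closedBall_self (by positivity : 0 ≤ 2 * ρ)) (edist_ne_top _ _)
  refine ⟨b, lp_one_summable b, ?_, fun k => ?_⟩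
  · rwa [mem_closedBall_zero_iff, lp_one_norm_eq] at hb
  · rw [duhamelC_sub]
    conv_lhs => rw [← show Φ b = b from hfix]
    simp only [hΦ, hbase, hB]
    abel

end Local

end NSE2D

namespace NSE2D

open Set Filter Topology ComplexConjugate

/-! ### Sequence spaces -/

/-- Square-summable families of Fourier amplitudes. -/
abbrev Amp : Type := lp (fun _ : Fin 2 → ℤ => ℂ) 2

theorem Amp.norm_sq_eq (x : Amp) : ‖x‖ ^ 2 = ∑' k, ‖x k‖ ^ 2 := by
  have := lp.norm_rpow_eq_tsum (p := 2) (by norm_num) x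
  simpa using this

theorem Amp.summable_sq (x : Amp) : Summable fun k => ‖x k‖ ^ 2 := by
  have := (lp.memℓp x).summable (by norm_num)
  simpa using this

theorem Amp.l2Bd (x : Amp) : L2Bd (fun k => ‖x k‖) ‖x‖ :=
  .of_tsum_le x.summable_sq (norm_nonneg x) x.norm_sq_eq.ge

theorem Amp.norm_le_of_l2Bd {x : Amp} {C : ℝ} (h : L2Bd (fun k => ‖x k‖) C) : ‖x‖ ≤ C :=
  le_of_sq_le_sq (x.norm_sq_eq.trans_le h.tsum_le) h.1

theorem L2Bd.memℓp {x : (Fin 2 → ℤ) → ℂ} {C : ℝ} (h : L2Bd (fun k => ‖x k‖) C) : Memℓp x 2 := by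
  rw [memℓp_gen_iff (by norm_num)]
  simpa using h.summable

/-- An amplitude family from a square-summable sequence. -/
def L2Bd.toAmp {x : (Fin 2 → ℤ) → ℂ} {C : ℝ} (h : L2Bd (fun k => ‖x k‖) C) : Amp := ⟨x, h.memℓp⟩

theorem Amp.tendsto_of_dominated {α : Type*} {l : Filter α} {x : α → Amp} {y : Amp}
    {M : (Fin 2 → ℤ) → ℝ} {C : ℝ} (hM : L2Bd M C) (h : ∀ k, Tendsto (fun a => x a k) l (𝓝 (y k)))
    (hb : ∀ᶠ a in l, ∀ k, ‖x a k - y k‖ ≤ M k) : Tendsto x l (𝓝 y) := by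
  rw [tendsto_iff_norm_sub_tendsto_zero]
  have h1 : Tendsto (fun a => ∑' k, ‖(x a - y) k‖ ^ 2) l (𝓝 (∑' _ : Fin 2 → ℤ, (0 : ℝ))) := by
    refine tendsto_tsum_of_dominated_convergence hM.summable (fun k => ?_) ?_
    · have := ((h k).sub_const (y k)).norm.pow 2
      simpa using this
    · filter_upwards [hb] with a ha k
      rw [Real.norm_eq_abs, abs_of_nonneg (sq_nonneg _)]
      exact pow_le_pow_left₀ (norm_nonneg _) (ha k) 2
  rw [tsum_zero] at h1
  have h2 := h1.sqrt
  rw [Real.sqrt_zero] at h2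
  refine h2.congr fun a => ?_
  rw [← Amp.norm_sq_eq, Real.sqrt_sq (norm_nonneg _)]

theorem Amp.hasDerivAt_apply {x : ℝ → Amp} {x' : Amp} {t : ℝ} (h : HasDerivAt x x' t)
    (k : Fin 2 → ℤ) : HasDerivAt (fun s => x s k) (x' k) t := by
  rw [hasDerivAt_iff_tendsto_slope] at h ⊢
  have h1 := ((lp.lipschitzWith_one_eval (E := fun _ : Fin 2 → ℤ => ℂ) 2 k).continuous.tendsto
    x').comp h
  refine h1.congr fun s => ?_
  simp only [Function.comp_apply, slope_def_module]
  rfl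

/-- By the mean value inequality a square-summable majorant of the coordinate derivatives also
dominates the difference quotients, so coordinatewise convergence upgrades to convergence in `ℓ²`.
-/
theorem Amp.hasDerivAt_of_dominated {x : ℝ → Amp} {y : ℝ → (Fin 2 → ℤ) → ℂ} {x' : Amp}
    {D : (Fin 2 → ℤ) → ℝ} {C a b t : ℝ} (hD : L2Bd D C) (ht : t ∈ Ioo a b)
    (h : ∀ s ∈ Ioo a b, ∀ k, HasDerivAt (fun s => x s k) (y s k) s)
    (hb : ∀ s ∈ Ioo a b, ∀ k, ‖y s k‖ ≤ D k) (hx' : ∀ k, x' k = y t k) : HasDerivAt x x' t := by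
  rw [hasDerivAt_iff_tendsto_slope]
  refine Amp.tendsto_of_dominated (hD.const_mul zero_le_two) (fun k => ?_) ?_
  · have h1 := hasDerivAt_iff_tendsto_slope.1 (h t ht k)
    rw [hx']
    refine h1.congr fun s => ?_
    simp only [slope_def_module]
    rfl
  · have hmem : Ioo a b ∈ 𝓝[≠] t := mem_nhdsWithin_of_mem_nhds (Ioo_mem_nhds ht.1 ht.2)
    filter_upwards [hmem, self_mem_nhdsWithin] with s hs hst k
    have h1 : ‖x s k - x t k‖ ≤ D k * ‖s - t‖ :=
      (convex_Ioo a b).norm_image_sub_le_of_norm_hasDerivWithin_le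
        (fun r hr => (h r hr k).hasDerivWithinAt) (fun r hr => hb r hr k) ht hs
    have h2 : slope x t s k = (s - t)⁻¹ • (x s k - x t k) := by
      simp only [slope_def_module]; rfl
    have h3 : 0 < ‖s - t‖ := norm_pos_iff.2 (sub_ne_zero.2 hst)
    rw [h2, two_mul]
    refine (norm_sub_le _ _).trans (add_le_add ?_ (hx' k ▸ hb t ht k))
    rw [norm_smul, norm_inv, inv_mul_le_iff₀ h3, mul_comm]
    exact h1

theorem Amp.hasDerivAt_norm_sq {x : ℝ → Amp} {x' : Amp} {t : ℝ} (h : HasDerivAt x x' t) :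
    HasDerivAt (fun s => ‖x s‖ ^ 2) (2 * (∑' k, x' k * conj (x t k)).re) t := by
  have h1 := h.inner ℂ h
  have h2 := Complex.reCLM.hasFDerivAt.comp_hasDerivAt t h1
  have e1 : inner ℂ (x t) x' = ∑' k, x' k * conj (x t k) := by
    rw [lp.inner_eq_tsum]
    exact tsum_congr fun k => by rw [RCLike.inner_apply]
  have e2 : Complex.re (inner ℂ x' (x t)) = Complex.re (inner ℂ (x t) x') := by
    rw [← inner_conj_symm x' (x t), Complex.conj_re]
  have h3 : ((fun s => ‖x s‖ ^ 2) : ℝ → ℝ) = Complex.reCLM ∘ fun s => inner ℂ (x s) (x s) := by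
    funext s
    rw [Function.comp_apply, Complex.reCLM_apply, inner_self_eq_norm_sq_to_K]
    norm_cast
  rw [h3]
  refine h2.congr_deriv ?_
  rw [Complex.reCLM_apply, Complex.add_re, e2, e1]
  ring

/-! ### Summability from higher norms -/

/-- The square root of `∑ |k|⁻³` over the nonzero wave vectors. -/
noncomputable def latticeConst : ℝ :=
  Real.sqrt (∑' k : Fin 2 → ℤ, if k = 0 then 0 else wlen k ^ (-3 : ℝ))

theorem latticeConst_nonneg : 0 ≤ latticeConst := Real.sqrt_nonneg _

theorem l2Bd_lattice :
    L2Bd (fun k : Fin 2 → ℤ => if k = 0 then 0 else (Real.sqrt (wlen k ^ 3))⁻¹) latticeConst := by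
  have h : ∀ k : Fin 2 → ℤ, (if k = 0 then 0 else (Real.sqrt (wlen k ^ 3))⁻¹ : ℝ) ^ 2
      = if k = 0 then 0 else wlen k ^ (-3 : ℝ) := by
    intro k
    split_ifs with hk
    · simp
    · have hw := wlen_nonneg k
      rw [inv_pow, Real.sq_sqrt (by positivity), Real.rpow_neg hw]
      norm_cast
  refine .of_tsum_le ?_ latticeConst_nonneg ?_
  · simp only [h]
    exact summable_wlen_rpow (by norm_num)
  · simp only [h]
    rw [latticeConst, Real.sq_sqrt]
    exact tsum_nonneg fun k => by
      split_ifs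
      · exact le_rfl
      · exact Real.rpow_nonneg (wlen_nonneg k) _

/-- An Agmon-type inequality: write `x = |k|^{-3/2} · |k|^{3/2} x`, where `∑ |k|⁻³` converges in two
dimensions and `|k|³x² = (|k|x)(|k|²x)`. Only the square root of the higher norm `E` appears, which
matters in `exists_time_small`. -/
theorem summable_of_l2Bd_wlen {x : (Fin 2 → ℤ) → ℝ} {D E : ℝ} (hx0 : x 0 = 0) (hx : ∀ k, 0 ≤ x k)
    (hD : L2Bd (fun k => wlen k * x k) D) (hE : L2Bd (fun k => wlen k ^ 2 * x k) E) :
    Summable x ∧ ∑' k, x k ≤ latticeConst * Real.sqrt (D * E) := by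
  have h1 : L2Bd (fun k => Real.sqrt (wlen k ^ 3) * x k) (Real.sqrt (D * E)) := by
    refine ⟨Real.sqrt_nonneg _, fun s => ?_⟩
    rw [Real.sq_sqrt (mul_nonneg hD.1 hE.1)]
    refine le_trans (le_of_eq (Finset.sum_congr rfl fun k _ => ?_)) (hD.sum_mul_le hE s)
    rw [mul_pow, Real.sq_sqrt (pow_nonneg (wlen_nonneg k) 3)]
    ring
  have hp : ∀ k : Fin 2 → ℤ, 0 ≤ (if k = 0 then 0 else (Real.sqrt (wlen k ^ 3))⁻¹ : ℝ) := by
    intro k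
    split_ifs
    · exact le_rfl
    · positivity
  have hq : ∀ k, 0 ≤ Real.sqrt (wlen k ^ 3) * x k := fun k => mul_nonneg (Real.sqrt_nonneg _) (hx k)
  have hs := l2Bd_lattice.summable_mul h1 hp hq
  have ht := l2Bd_lattice.tsum_mul_le h1 hp hq
  have he : (fun k : Fin 2 → ℤ => (if k = 0 then 0 else (Real.sqrt (wlen k ^ 3))⁻¹ : ℝ) *
      (Real.sqrt (wlen k ^ 3) * x k)) = x := by
    funext k
    split_ifs with hk
    · rw [hk, hx0, zero_mul]
    · have := wlen_pos hk
      rw [inv_mul_cancel_left₀ (by positivity)]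
  rw [he] at hs
  simp only [congrFun he] at ht
  exact ⟨hs, ht⟩

theorem summable_div_wlen_sq {x : (Fin 2 → ℤ) → ℝ} {C : ℝ} (hx : ∀ k, 0 ≤ x k) (hC : L2Bd x C) :
    Summable (fun k => x k / wlen k ^ 2) ∧ ∑' k, x k / wlen k ^ 2 ≤ latticeConst * C := by
  have h0 : ∀ k, 0 ≤ x k / wlen k ^ 2 := fun k => div_nonneg (hx k) (sq_nonneg _)
  have h2 : L2Bd (fun k => wlen k ^ 2 * (x k / wlen k ^ 2)) C := by
    refine hC.mono fun k => ?_
    rw [abs_of_nonneg (mul_nonneg (sq_nonneg _) (h0 k))]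
    rcases eq_or_ne (wlen k) 0 with h | h
    · simpa [h] using hx k
    · rw [mul_div_cancel₀ _ (pow_ne_zero 2 h)]
  have h1 : L2Bd (fun k => wlen k * (x k / wlen k ^ 2)) C := by
    refine h2.mono fun k => ?_
    rw [abs_of_nonneg (mul_nonneg (wlen_nonneg _) (h0 k))]
    refine mul_le_mul_of_nonneg_right ?_ (h0 k)
    rcases eq_or_ne k 0 with rfl | hk
    · simp
    · exact le_self_pow₀ (one_le_wlen hk) two_ne_zero
  have := summable_of_l2Bd_wlen (by simp) h0 h1 h2
  rwa [Real.sqrt_mul_self hC.1] at this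

theorem L2Bd.of_wlen_succ {x : (Fin 2 → ℤ) → ℝ} {C : ℝ} {s : ℕ} (hx0 : x 0 = 0)
    (hx : ∀ k, 0 ≤ x k) (h : L2Bd (fun k => wlen k ^ (s + 1) * x k) C) :
    L2Bd (fun k => wlen k ^ s * x k) C := by
  refine h.mono fun k => ?_
  rw [abs_of_nonneg (mul_nonneg (pow_nonneg (wlen_nonneg k) s) (hx k))]
  rcases eq_or_ne k 0 with rfl | hk
  · simp [hx0]
  · exact mul_le_mul_of_nonneg_right (pow_le_pow_right₀ (one_le_wlen hk) s.le_succ) (hx k)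

/-! ### Solutions in Fourier variables -/

/-- `x` is the value of the vector field at `a`. -/
def IsField (f a x : (Fin 2 → ℤ) → ℂ) : Prop :=
  ∀ k, x k = f k - (wlen k ^ 2 : ℝ) * a k - nl a a k

/-- Global solutions in Fourier variables. -/
structure SeqSol (f : (Fin 2 → ℤ) → ℂ) (a : ℝ → Amp) : Prop where
  zero : ∀ t, a t 0 = 0
  real : ∀ t k, a t (-k) = conj (a t k)
  dom : ∀ t, ∃ C, L2Bd (fun k => wlen k ^ 2 * ‖a t k‖) C
  deriv : ∀ t, ∃ a' : Amp, IsField f (a t) a' ∧ HasDerivAt a a' t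

theorem summable_mul_conj {x y : (Fin 2 → ℤ) → ℂ} {C D : ℝ} (hx : L2Bd (fun k => ‖x k‖) C)
    (hy : L2Bd (fun k => ‖y k‖) D) : Summable fun k => x k * conj (y k) :=
  .of_norm_bounded (hx.summable_mul hy (fun _ => norm_nonneg _) fun _ => norm_nonneg _)
    fun k => by rw [norm_mul, RCLike.norm_conj]

theorem re_tsum_mul_conj_le {x y : (Fin 2 → ℤ) → ℂ} {C D : ℝ} (hx : L2Bd (fun k => ‖x k‖) C)
    (hy : L2Bd (fun k => ‖y k‖) D) : (∑' k, x k * conj (y k)).re ≤ C * D := by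
  refine (Complex.re_le_norm _).trans ?_
  refine (tsum_of_norm_bounded
    (hx.summable_mul hy (fun _ => norm_nonneg _) fun _ => norm_nonneg _).hasSum
    fun k => ?_).trans (hx.tsum_mul_le hy (fun _ => norm_nonneg _) fun _ => norm_nonneg _)
  rw [norm_mul, RCLike.norm_conj]

end NSE2D

namespace NSE2D

open Set Filter Topology ComplexConjugate

/-! ### Energy and enstrophy balances -/

/-- The squared norm of `A^{1/2} a`. -/
noncomputable def enst (a : (Fin 2 → ℤ) → ℂ) : ℝ := ∑' k, (wlen k * ‖a k‖) ^ 2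

/-- The squared norm of `A a`. -/
noncomputable def palin (a : (Fin 2 → ℤ) → ℂ) : ℝ := ∑' k, (wlen k ^ 2 * ‖a k‖) ^ 2

theorem enst_nonneg (a : (Fin 2 → ℤ) → ℂ) : 0 ≤ enst a := tsum_nonneg fun _ => sq_nonneg _

theorem palin_nonneg (a : (Fin 2 → ℤ) → ℂ) : 0 ≤ palin a := tsum_nonneg fun _ => sq_nonneg _

/-- Regular amplitudes: mean zero and in the domain of the Stokes operator. -/
structure Regular (a : (Fin 2 → ℤ) → ℂ) : Prop where
  zero : a 0 = 0
  summable_sq : Summable fun k => (wlen k ^ 2 * ‖a k‖) ^ 2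

namespace Regular

variable {a : (Fin 2 → ℤ) → ℂ} (h : Regular a)
include h

theorem l2Bd_two : L2Bd (fun k => wlen k ^ 2 * ‖a k‖) (Real.sqrt (palin a)) :=
  .of_summable h.summable_sq

theorem l2Bd_one' : L2Bd (fun k => wlen k * ‖a k‖) (Real.sqrt (palin a)) := by
  have := L2Bd.of_wlen_succ (s := 1) (by simp [h.zero]) (fun k => norm_nonneg (a k)) h.l2Bd_two
  simpa using this

theorem l2Bd_one : L2Bd (fun k => wlen k * ‖a k‖) (Real.sqrt (enst a)) :=
  .of_summable h.l2Bd_one'.summable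

theorem l2Bd_zero : L2Bd (fun k => ‖a k‖) (Real.sqrt (enst a)) := by
  have := L2Bd.of_wlen_succ (s := 0) (C := Real.sqrt (enst a)) (by simp [h.zero])
    (fun k => norm_nonneg (a k)) (by simpa using h.l2Bd_one)
  simpa using this

theorem summable : Summable fun k => ‖a k‖ :=
  (summable_of_l2Bd_wlen (by simp [h.zero]) (fun _ => norm_nonneg _) h.l2Bd_one h.l2Bd_two).1

theorem tsum_le : ∑' k, ‖a k‖ ≤ latticeConst * Real.sqrt (Real.sqrt (enst a) * Real.sqrt (palin a)) :=
  (summable_of_l2Bd_wlen (by simp [h.zero]) (fun _ => norm_nonneg _) h.l2Bd_one h.l2Bd_two).2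

theorem exists_l2Bd_nl {b : (Fin 2 → ℤ) → ℂ} (hb : Regular b) :
    ∃ C, L2Bd (fun k => ‖nl a b k‖) C := by
  have hw : ∀ k, 0 ≤ wlen k * ‖b k‖ := fun k => mul_nonneg (wlen_nonneg k) (norm_nonneg _)
  have hc := L2Bd.conv (fun k => norm_nonneg (a k)) hw h.summable le_rfl hb.l2Bd_one
  refine ⟨_, hc.mono fun k => ?_⟩
  rw [abs_of_nonneg (norm_nonneg _)]
  exact norm_nl_le' (summable_conv_term_l2 (fun k => norm_nonneg (a k)) hw h.summable hb.l2Bd_one k)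

theorem sub {b : (Fin 2 → ℤ) → ℂ} (hb : Regular b) : Regular fun k => a k - b k where
  zero := by rw [h.zero, hb.zero, sub_zero]
  summable_sq := by
    refine ((h.l2Bd_two.add hb.l2Bd_two).mono fun k => ?_).summable
    rw [abs_of_nonneg (mul_nonneg (sq_nonneg _) (norm_nonneg _)), ← mul_add]
    exact mul_le_mul_of_nonneg_left (norm_sub_le _ _) (sq_nonneg _)

end Regular

theorem mul_conj_weight (w : ℝ) (z : ℂ) : ((w : ℂ) * z) * ((w : ℂ) * conj z) = ((w * ‖z‖) ^ 2 : ℝ) := by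
  rw [mul_mul_mul_comm, Complex.mul_conj, Complex.normSq_eq_norm_sq]
  push_cast
  ring

theorem mul_conj_weight' (w : ℝ) (z : ℂ) : ((w ^ 2 : ℝ) : ℂ) * z * conj z = ((w * ‖z‖) ^ 2 : ℝ) := by
  rw [← mul_conj_weight]
  push_cast
  ring

theorem Regular.re_energy_le {f a x : (Fin 2 → ℤ) → ℂ} {Γ C : ℝ} (h : Regular a)
    (hr : ∀ k, a (-k) = conj (a k)) (hf : L2Bd (fun k => ‖f k‖) Γ)
    (ha : L2Bd (fun k => ‖a k‖) C) (hx : IsField f a x) :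
    (∑' k, x k * conj (a k)).re ≤ Γ * C - enst a := by
  obtain ⟨N, hN⟩ := h.exists_l2Bd_nl h
  have s1 := summable_mul_conj hf ha
  have s2 : Summable fun k => (((wlen k * ‖a k‖) ^ 2 : ℝ) : ℂ) :=
    (Complex.hasSum_ofReal.2 h.l2Bd_one.summable.hasSum).summable
  have s3 := summable_mul_conj hN ha
  have e : ∑' k, x k * conj (a k) = ∑' k, (f k * conj (a k) - (((wlen k * ‖a k‖) ^ 2 : ℝ) : ℂ)
      - nl a a k * conj (a k)) :=
    tsum_congr fun k => by rw [hx k, sub_mul, sub_mul, mul_conj_weight']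
  rw [e, (s1.sub s2).tsum_sub s3, s1.tsum_sub s2, Complex.sub_re, Complex.sub_re,
    re_tsum_nl_mul_conj hr h.summable ha h.l2Bd_one, ← Complex.ofReal_tsum, Complex.ofReal_re]
  have := re_tsum_mul_conj_le hf ha
  rw [enst]
  linarith

/-- Pairing with `A a` rather than `a`: the trilinear term again vanishes, a feature of the periodic
two-dimensional case. -/
theorem Regular.re_enstrophy_le {f a x : (Fin 2 → ℤ) → ℂ} {Γ : ℝ} (h : Regular a)
    (hr : ∀ k, a (-k) = conj (a k)) (hf : L2Bd (fun k => ‖f k‖) Γ) (hx : IsField f a x) :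
    (∑' k, x k * conj ((wlen k ^ 2 : ℝ) * a k)).re ≤ Γ * Real.sqrt (palin a) - palin a := by
  obtain ⟨N, hN⟩ := h.exists_l2Bd_nl h
  have ha2 : L2Bd (fun k => ‖((wlen k ^ 2 : ℝ) : ℂ) * a k‖) (Real.sqrt (palin a)) := by
    simpa [abs_of_nonneg, wlen_nonneg] using h.l2Bd_two
  have s1 := summable_mul_conj hf ha2
  have s2 : Summable fun k => (((wlen k ^ 2 * ‖a k‖) ^ 2 : ℝ) : ℂ) :=
    (Complex.hasSum_ofReal.2 h.l2Bd_two.summable.hasSum).summable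
  have s3 := summable_mul_conj hN ha2
  have hz := re_tsum_nl_mul_stokes hr h.summable h.l2Bd_one h.l2Bd_two
  simp only [map_mul, Complex.conj_ofReal] at s1 s3 ⊢
  have e : ∑' k, x k * ((wlen k ^ 2 : ℝ) * conj (a k))
      = ∑' k, (f k * ((wlen k ^ 2 : ℝ) * conj (a k)) - (((wlen k ^ 2 * ‖a k‖) ^ 2 : ℝ) : ℂ)
      - nl a a k * ((wlen k ^ 2 : ℝ) * conj (a k))) :=
    tsum_congr fun k => by rw [hx k, sub_mul, sub_mul, mul_conj_weight]
  rw [e, (s1.sub s2).tsum_sub s3, s1.tsum_sub s2, Complex.sub_re, Complex.sub_re, hz,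
    ← Complex.ofReal_tsum, Complex.ofReal_re]
  have := re_tsum_mul_conj_le hf ha2
  simp only [map_mul, Complex.conj_ofReal] at this
  rw [palin] at this ⊢
  linarith

namespace SeqSol

variable {f : (Fin 2 → ℤ) → ℂ} {a : ℝ → Amp} (hs : SeqSol f a)
include hs

theorem regular (t : ℝ) : Regular (a t) :=
  ⟨hs.zero t, (hs.dom t).choose_spec.summable⟩

theorem norm_sq_le_enst (t : ℝ) : ‖a t‖ ^ 2 ≤ enst (a t) := by
  have := Amp.norm_le_of_l2Bd (hs.regular t).l2Bd_zero
  calc _ ≤ Real.sqrt (enst (a t)) ^ 2 := pow_le_pow_left₀ (norm_nonneg _) this 2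
    _ = _ := Real.sq_sqrt (enst_nonneg _)

variable {Γ : ℝ} (hf : L2Bd (fun k => ‖f k‖) Γ)
include hf

theorem energy_inequality (t : ℝ) :
    ∃ e, HasDerivAt (fun s => ‖a s‖ ^ 2) e t ∧ e ≤ Γ ^ 2 - enst (a t) := by
  obtain ⟨a', ha', hd⟩ := hs.deriv t
  refine ⟨_, Amp.hasDerivAt_norm_sq hd, ?_⟩
  have h1 := (hs.regular t).re_energy_le (hs.real t) hf (a t).l2Bd ha'
  have h2 := hs.norm_sq_le_enst t
  -- `2Γ‖a‖ ≤ Γ² + ‖a‖²`, and `‖a‖²` is absorbed by the enstrophy because nonzero wave vectors have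
  -- length at least 1.
  nlinarith [sq_nonneg (Γ - ‖a t‖)]

/-- The function `exp(s)(‖a(s)‖² - Γ²)` is nonincreasing and, because of the bound for all past
times, has an upper bound tending to 0 at `-∞`; hence it is never positive. -/
theorem norm_le_of_bounded {M : ℝ} (hM : ∀ t, ‖a t‖ ≤ M) (t : ℝ) : ‖a t‖ ≤ Γ := by
  by_contra hlt
  rw [not_le] at hlt
  choose e he1 he2 using hs.energy_inequality hf
  have hd : ∀ s, HasDerivAt (fun s => Real.exp s * (‖a s‖ ^ 2 - Γ ^ 2))
      (Real.exp s * (‖a s‖ ^ 2 - Γ ^ 2) + Real.exp s * e s) s := fun s =>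
    (Real.hasDerivAt_exp s).mul ((he1 s).sub_const _)
  have hanti : Antitone fun s => Real.exp s * (‖a s‖ ^ 2 - Γ ^ 2) := by
    refine antitone_of_hasDerivAt_nonpos hd fun s => ?_
    have h2 := hs.norm_sq_le_enst s
    have := mul_nonneg (Real.exp_pos s).le (by linarith [he2 s] : 0 ≤ -(‖a s‖ ^ 2 - Γ ^ 2) - e s)
    simp only [Pi.zero_apply]
    linarith
  have hpos : 0 < Real.exp t * (‖a t‖ ^ 2 - Γ ^ 2) :=
    mul_pos (Real.exp_pos t) (sub_pos.2 (pow_lt_pow_left₀ hlt hf.1 two_ne_zero))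
  have hlim : Tendsto (fun s => Real.exp s * M ^ 2) atBot (𝓝 (0 * M ^ 2)) :=
    Real.tendsto_exp_atBot.mul_const _
  rw [zero_mul] at hlim
  obtain ⟨s, hs1, hs2⟩ := ((hlim.eventually (gt_mem_nhds hpos)).and (eventually_le_atBot t)).exists
  have h3 := hanti hs2
  have h4 : ‖a s‖ ^ 2 ≤ M ^ 2 := pow_le_pow_left₀ (norm_nonneg _) (hM s) 2
  have h5 := mul_le_mul_of_nonneg_left (by nlinarith [sq_nonneg Γ] : ‖a s‖ ^ 2 - Γ ^ 2 ≤ M ^ 2)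
    (Real.exp_pos s).le
  simp only at h3
  linarith

/-- By the mean value theorem on a unit interval, `‖a‖²` has derivative at least `-Γ²` somewhere;
the energy inequality at that time bounds the enstrophy. -/
theorem exists_enst_le (hM : ∀ t, ‖a t‖ ≤ Γ) (t : ℝ) :
    ∃ s ∈ Ioo (t - 1) t, enst (a s) ≤ 2 * Γ ^ 2 := by
  choose e he1 he2 using hs.energy_inequality hf
  obtain ⟨c, hc, hc2⟩ := exists_hasDerivAt_eq_slope (fun s => ‖a s‖ ^ 2) e
    (by linarith : t - 1 < t) (fun s _ => (he1 s).continuousAt.continuousWithinAt) fun s _ => he1 s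
  refine ⟨c, hc, ?_⟩
  have h1 := pow_le_pow_left₀ (norm_nonneg _) (hM (t - 1)) 2
  rw [sub_sub_cancel, div_one] at hc2
  have := he2 c
  nlinarith [sq_nonneg ‖a t‖]

omit hf in
/-- Uniqueness: a solution coincides with any regular solution with the same initial value, also
when the latter is parametrized with speed `r`. -/
theorem eq_of_regular {w : ℝ → Amp} {T W r t₀ : ℝ} (hT : 0 ≤ T) (hr : 0 < r)
    (hc : ContinuousOn w (Icc 0 T)) (h0 : w 0 = a t₀)
    (hw : ∀ s ∈ Ioo 0 T, ∃ (x : (Fin 2 → ℤ) → ℂ) (w' : Amp), IsField f (w s) x ∧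
      (∀ k, w' k = r * x k) ∧ HasDerivAt w w' s)
    (hreg : ∀ s ∈ Ioo 0 T, Regular (w s)) (hW : ∀ s ∈ Ioo 0 T, ∑' k, ‖w s k‖ ≤ W)
    {s : ℝ} (hsT : s ∈ Icc 0 T) : w s = a (t₀ + r * s) := by
  set d : ℝ → Amp := fun s => a (t₀ + r * s) - w s with hd
  have hlin : ∀ s : ℝ, HasDerivAt (fun s => t₀ + r * s) r s := fun s => by
    simpa using ((hasDerivAt_id s).const_mul r).const_add t₀
  have hac : Continuous fun s => a (t₀ + r * s) := by
    have h1 : Continuous a := continuous_iff_continuousAt.2 fun t =>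
      (hs.deriv t).choose_spec.2.continuousAt
    exact h1.comp (by fun_prop)
  have hder : ∀ s ∈ Ioo 0 T, ∃ e, HasDerivAt (fun s => ‖d s‖ ^ 2) e s ∧
      e ≤ r * W ^ 2 / 2 * ‖d s‖ ^ 2 := by
    intro s hsI
    obtain ⟨x, w', hx, hw', hwd⟩ := hw s hsI
    obtain ⟨a', ha', had⟩ := hs.deriv (t₀ + r * s)
    have hdd : HasDerivAt d (r • a' - w') s := (had.scomp s (hlin s)).sub hwd
    refine ⟨_, Amp.hasDerivAt_norm_sq hdd, ?_⟩
    have ra := hs.regular (t₀ + r * s)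
    have rw' := hreg s hsI
    have rd : Regular (d s) := ra.sub rw'
    have ld := (d s).l2Bd
    obtain ⟨N1, hN1⟩ := ra.exists_l2Bd_nl rd
    obtain ⟨N2, hN2⟩ := rd.exists_l2Bd_nl rw'
    have s1 : Summable fun k => (((wlen k * ‖d s k‖) ^ 2 : ℝ) : ℂ) :=
      (Complex.hasSum_ofReal.2 rd.l2Bd_one.summable.hasSum).summable
    have s2 := summable_mul_conj hN1 ld
    have s3 := summable_mul_conj hN2 ld
    have hn : ∀ (b : (Fin 2 → ℤ) → ℂ) k, 0 ≤ ‖b k‖ := fun _ _ => norm_nonneg _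
    -- `B(a,a) - B(w,w) = B(a,d) + B(d,w)`. The first term is orthogonal to `d`, for which only `a`
    -- has to be real.
    have e : ∀ k, (r • a' - w' : Amp) k * conj (d s k) = (r : ℂ) *
        (-(((wlen k * ‖d s k‖) ^ 2 : ℝ) : ℂ) - nl (a (t₀ + r * s)) (d s) k * conj (d s k)
          - nl (d s) (w s) k * conj (d s k)) := by
      intro k
      have e1 : nl (a (t₀ + r * s)) (d s) k
          = nl (a (t₀ + r * s)) (a (t₀ + r * s)) k - nl (a (t₀ + r * s)) (w s) k :=
        nl_sub_right (summable_conv_term (hn _) (hn _) ra.summable ra.summable k)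
          (summable_conv_term (hn _) (hn _) ra.summable rw'.summable k)
      have e2 : nl (d s) (w s) k = nl (a (t₀ + r * s)) (w s) k - nl (w s) (w s) k :=
        nl_sub_left (summable_conv_term (hn _) (hn _) ra.summable rw'.summable k)
          (summable_conv_term (hn _) (hn _) rw'.summable rw'.summable k)
      have e3 : (r • a' - w' : Amp) k = r * a' k - w' k := by
        rw [lp.coeFn_sub, Pi.sub_apply, lp.coeFn_smul, Pi.smul_apply, Complex.real_smul]
      have e4 : d s k = a (t₀ + r * s) k - w s k := rfl
      rw [e1, e2, e3, hw', ha' k, hx k, ← mul_conj_weight', e4]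
      ring
    rw [tsum_congr e, tsum_mul_left, Complex.re_ofReal_mul, ((s1.neg).sub s2).tsum_sub s3,
      (s1.neg).tsum_sub s2, tsum_neg, Complex.sub_re, Complex.sub_re,
      re_tsum_nl_mul_conj (hs.real _) ra.summable ld rd.l2Bd_one, Complex.neg_re,
      ← Complex.ofReal_tsum, Complex.ofReal_re]
    have h1 := norm_tsum_nl_mul_conj_le rw'.summable (hW s hsI) ld rd.l2Bd_one
    have h2 := (Complex.abs_re_le_norm _).trans h1
    have h3 := neg_abs_le (∑' k, nl (d s) (w s) k * conj (d s k)).re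
    have h4 : Real.sqrt (enst (d s)) ^ 2 = ∑' k, (wlen k * ‖d s k‖) ^ 2 :=
      Real.sq_sqrt (enst_nonneg _)
    rw [← h4]
    set D1 := Real.sqrt (enst (d s))
    -- Young's inequality `W‖d‖D1 ≤ D1² + W²‖d‖²/4` absorbs the derivative of `d` into the
    -- dissipation; Gronwall with the integrating factor below gives `d = 0`.
    have h5 : -D1 ^ 2 - 0 - (∑' k, nl (d s) (w s) k * conj (d s k)).re
        ≤ W ^ 2 / 4 * ‖d s‖ ^ 2 := by
      nlinarith [sq_nonneg (D1 - W * ‖d s‖ / 2)]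
    nlinarith [mul_le_mul_of_nonneg_left h5 hr.le]
  have hcd : ContinuousOn (fun s => ‖d s‖ ^ 2 * Real.exp (-(r * W ^ 2 / 2 * s))) (Icc 0 T) :=
    ((hac.continuousOn.sub hc).norm.pow 2).mul (by fun_prop)
  have hanti : AntitoneOn (fun s => ‖d s‖ ^ 2 * Real.exp (-(r * W ^ 2 / 2 * s))) (Icc 0 T) := by
    have hD : ∀ s ∈ Ioo 0 T, ∃ e,
        HasDerivAt (fun s => ‖d s‖ ^ 2 * Real.exp (-(r * W ^ 2 / 2 * s))) e s ∧ e ≤ 0 := by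
      intro s hsI
      obtain ⟨e, he1, he2⟩ := hder s hsI
      have h1 : HasDerivAt (fun s => -(r * W ^ 2 / 2 * s)) (-(r * W ^ 2 / 2)) s := by
        exact (((hasDerivAt_id s).const_mul (r * W ^ 2 / 2)).neg).congr_deriv (by simp)
      refine ⟨_, he1.mul h1.exp, ?_⟩
      have := mul_nonneg (Real.exp_pos (-(r * W ^ 2 / 2 * s))).le (sub_nonneg.2 he2)
      linarith
    refine antitoneOn_of_deriv_nonpos (convex_Icc 0 T) hcd ?_ ?_
    · rw [interior_Icc]
      intro s hsI
      exact (hD s hsI).choose_spec.1.differentiableAt.differentiableWithinAt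
    · rw [interior_Icc]
      intro s hsI
      rw [(hD s hsI).choose_spec.1.deriv]
      exact (hD s hsI).choose_spec.2
  have h1 := hanti ⟨le_rfl, hT⟩ hsT hsT.1
  simp only [hd, h0, mul_zero, add_zero, sub_self, norm_zero, ne_eq, OfNat.ofNat_ne_zero,
    not_false_eq_true, zero_pow, zero_mul] at h1
  have h2 : ‖a (t₀ + r * s) - w s‖ ^ 2 ≤ 0 := by
    by_contra h3
    exact absurd h1 (not_le.2 (mul_pos (not_le.1 h3) (Real.exp_pos _)))
  have h3 : ‖a (t₀ + r * s) - w s‖ = 0 := by nlinarith [norm_nonneg (a (t₀ + r * s) - w s)]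
  exact (sub_eq_zero.1 (norm_eq_zero.1 h3)).symm

end SeqSol

end NSE2D

namespace NSE2D

open Set Filter Topology ComplexConjugate

set_option linter.unusedSectionVars false

/-! ### Regularity of mild solutions -/

section Mild

variable {A : Type*} [NormedCommRing A] [NormedAlgebra ℂ A] [CompleteSpace A]

theorem nl_zero_mode (a b : (Fin 2 → ℤ) → A) : nl a b 0 = 0 := by
  have h : ∀ l, (coef l (0 - l) : ℂ) • (a l * b (0 - l)) = 0 := by
    intro l
    have := abs_coef_le_sum l (0 - l)
    rw [add_sub_cancel, wlen_zero] at this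
    rw [abs_eq_zero.1 (le_antisymm this (abs_nonneg _)), Complex.ofReal_zero, zero_smul]
  rw [nl, tsum_congr h, tsum_zero]

theorem map_nl {A' : Type*} [NormedRing A'] [NormedAlgebra ℂ A'] (φ : A →ₐ[ℂ] A')
    (hφ : Continuous φ) {a b : (Fin 2 → ℤ) → A} {k : Fin 2 → ℤ}
    (h : Summable fun l => ‖a l‖ * ‖b (k - l)‖) [T2Space A'] :
    φ (nl a b k) = nl (fun l => φ (a l)) (fun l => φ (b l)) k := by
  have := ((summable_nl_term h).hasSum.map (φ : A →+ A') hφ).tsum_eq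
  rw [nl, nl]
  refine this.symm.trans (tsum_congr fun l => ?_)
  change φ (_ • _) = _
  rw [map_smul, map_mul]

variable {lam : A} (hl : IsDamping lam) {T : ℝ} (hT : 0 ≤ T)
  {u f : (Fin 2 → ℤ) → ℂ} {Γ : ℝ} {b : (Fin 2 → ℤ) → C(Icc 0 T, A)}
  (hf0 : f 0 = 0) (hf : L2Bd (fun k => ‖f k‖) Γ) (hu : Regular u)
  (hb : Summable fun k => ‖b k‖)
  (hfix : ∀ k, b k = heatC lam T (wlen k ^ 2) (u k)
        + duhamelC lam hT (wlen k ^ 2) (algebraMap ℂ _ (f k) - nl b b k))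
include hl hf0 hf hu hb hfix

theorem mild_zero : b 0 = 0 := by
  rw [hfix 0, nl_zero_mode, hf0, hu.zero, map_zero, sub_zero, duhamelC_zero, add_zero]
  ext s
  simp [heatC]

theorem mild_wlen_sq_le (k : Fin 2 → ℤ) :
    wlen k ^ 2 * ‖b k‖ ≤ wlen k ^ 2 * ‖u k‖ + 3 * ‖f k‖ + 3 * ‖nl b b k‖ := by
  have h1 := norm_heatC_le hl (T := T) (sq_nonneg (wlen k)) (u k)
  have h2 := mul_norm_duhamelC_le hl hT (sq_nonneg (wlen k)) (algebraMap ℂ _ (f k) - nl b b k)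
  have h3 : ‖algebraMap ℂ C(Icc 0 T, A) (f k) - nl b b k‖ ≤ ‖f k‖ + ‖nl b b k‖ :=
    (norm_sub_le _ _).trans (add_le_add_left (norm_algebraMap_le hl _) _)
  have h4 := (congrArg norm (hfix k)).trans_le (norm_add_le _ _)
  have h5 := mul_le_mul_of_nonneg_left h4 (sq_nonneg (wlen k))
  have h6 := mul_le_mul_of_nonneg_left h1 (sq_nonneg (wlen k))
  linarith

/-- Two bootstrap steps. The divergence form bounds `nl b b` by `|k|` times a convolution in `ℓ²`,
so one division by `|k|` gives `|k| b ∈ ℓ²`. The tame estimate then puts `nl b b` itself in `ℓ²`,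
and `|k|² b ∈ ℓ²` follows. Since the norms of `b k` are suprema over `[0, T]`, this is one majorant
for all times. -/
theorem mild_majorant : ∃ E, L2Bd (fun k => wlen k ^ 2 * ‖b k‖) E := by
  have hn : ∀ k, 0 ≤ ‖b k‖ := fun k => norm_nonneg _
  have hb2 : L2Bd (fun k => ‖b k‖) (∑' k, ‖b k‖) := .of_l1 hn hb le_rfl
  have hc := L2Bd.conv hn hn hb le_rfl hb2
  have h1 : L2Bd (fun k => wlen k ^ (0 + 1) * ‖b k‖) _ :=
    ((hu.l2Bd_one.add (hf.const_mul zero_le_three)).add (hc.const_mul zero_le_three)).mono fun k => by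
      rw [zero_add, pow_one, abs_of_nonneg (mul_nonneg (wlen_nonneg k) (hn k))]
      have hcn := conv_nonneg hn hn k
      rcases eq_or_ne k 0 with rfl | hk
      · rw [wlen_zero, zero_mul, zero_mul]; positivity
      · have hw := wlen_pos hk
        have h2 := mild_wlen_sq_le hl hT hf0 hf hu hb hfix k
        have h3 := norm_nl_le (summable_conv_term hn hn hb hb k)
        refine le_of_mul_le_mul_left ?_ hw
        have h4 : ‖f k‖ ≤ wlen k * ‖f k‖ :=
          le_mul_of_one_le_left (norm_nonneg _) (one_le_wlen hk)
        nlinarith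
  have h2 := wlen_pow_mul_norm_nl_le hb le_rfl h1
  simp only [pow_zero, one_mul] at h2
  exact ⟨_, ((hu.l2Bd_two.add (hf.const_mul zero_le_three)).add
    (h2.const_mul zero_le_three)).mono fun k => by
      rw [abs_of_nonneg (mul_nonneg (sq_nonneg _) (hn k))]
      exact mild_wlen_sq_le hl hT hf0 hf hu hb hfix k⟩

omit hl hf0 hf hu hb in
theorem mild_hasDerivAt (k : Fin 2 → ℤ) {s : ℝ} (hs : s ∈ Ioo 0 T) :
    HasDerivAt (fun s => b k (projIcc 0 T hT s))
      (lam * (algebraMap ℂ A (f k) - nl b b k (projIcc 0 T hT s))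
        - (wlen k ^ 2) • (lam * b k (projIcc 0 T hT s))) s := by
  set c := wlen k ^ 2
  have hF : Continuous fun r => (algebraMap ℂ C(Icc 0 T, A) (f k) - nl b b k) (projIcc 0 T hT r) :=
    (ContinuousMap.continuous _).comp continuous_projIcc
  have h1 : HasDerivAt (fun s : ℝ => u k • sg lam (c * s)) (u k • c • -(lam * sg lam (c * s))) s := by
    have h := (hasDerivAt_sg lam (c * s)).scomp s ((hasDerivAt_id s).const_mul c)
    rw [mul_one] at h
    exact h.const_smul (u k)
  have h2 := h1.add (hasDerivAt_duhamel lam c hF s)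
  have hval : ∀ r ∈ Ioo 0 T, b k (projIcc 0 T hT r) = u k • sg lam (c * r) + duhamel lam c
      (fun r => (algebraMap ℂ C(Icc 0 T, A) (f k) - nl b b k) (projIcc 0 T hT r)) r := by
    intro r hr
    have hp : ((projIcc 0 T hT r : Icc 0 T) : ℝ) = r := by
      rw [projIcc_of_mem hT (Ioo_subset_Icc_self hr)]
    rw [hfix k]
    change u k • sg lam (c * _) + duhamel lam c _ _ = _
    rw [hp]
  refine (h2.congr_of_eventuallyEq (Filter.mem_of_superset (Ioo_mem_nhds hs.1 hs.2) hval)).congr_deriv ?_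
  rw [hval s hs, mul_add, smul_add, mul_smul_comm, smul_comm c (u k), smul_neg, smul_neg]
  change _ + (lam * (algebraMap ℂ A (f k) - _) - _) = _
  abel

variable (φ : A →ₐ[ℂ] ℂ) (hφ : ∀ y, ‖φ y‖ ≤ ‖y‖)
include hφ

/-- A character sending `λ` to a real `r > 0` turns the algebra-valued solution into an ordinary one
run at speed `r`, and uniqueness identifies it with the given solution. -/
theorem mild_eq_of_character {a : ℝ → Amp} (hs : SeqSol f a) {t₀ r : ℝ} (hua : ∀ k, u k = a t₀ k)
    (hr : 0 < r) (hφl : φ lam = r) {s : ℝ} (hsT : s ∈ Icc 0 T) (k : Fin 2 → ℤ) :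
    φ (b k (projIcc 0 T hT s)) = a (t₀ + r * s) k := by
  have hn : ∀ k, 0 ≤ ‖b k‖ := fun k => norm_nonneg _
  obtain ⟨E, hE⟩ := mild_majorant hl hT hf0 hf hu hb hfix
  have hb0 := mild_zero hl hT hf0 hf hu hb hfix
  have hb2 : L2Bd (fun k => ‖b k‖) (∑' k, ‖b k‖) := .of_l1 hn hb le_rfl
  have hE1 : L2Bd (fun k => wlen k ^ (0 + 1) * ‖b k‖) E :=
    L2Bd.of_wlen_succ (by rw [hb0, norm_zero]) hn hE
  have hN := wlen_pow_mul_norm_nl_le hb le_rfl hE1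
  simp only [pow_zero, one_mul] at hN
  let L : A →L[ℂ] ℂ := φ.toLinearMap.mkContinuous 1 fun y => by simpa using hφ y
  have hL : ∀ y, L y = φ y := fun y => rfl
  have hφc : Continuous φ := L.continuous
  have hbd : ∀ s k, ‖φ (b k (projIcc 0 T hT s))‖ ≤ ‖b k‖ := fun s k =>
    (hφ _).trans ((b k).norm_coe_le_norm _)
  have hwl : ∀ s, L2Bd (fun k => ‖φ (b k (projIcc 0 T hT s))‖) (∑' k, ‖b k‖) := fun s =>
    hb2.mono fun k => by rw [abs_of_nonneg (norm_nonneg _)]; exact hbd s k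
  set w : ℝ → Amp := fun s => (hwl s).toAmp with hw
  have hwk : ∀ s k, w s k = φ (b k (projIcc 0 T hT s)) := fun s k => rfl
  have hwreg : ∀ s, Regular (w s) := fun s =>
    ⟨by rw [hwk, hb0]; simp, (hE.mono fun k => by
      rw [abs_of_nonneg (mul_nonneg (sq_nonneg _) (norm_nonneg _))]
      exact mul_le_mul_of_nonneg_left (hbd s k) (sq_nonneg _)).summable⟩
  have hnl : ∀ s k, φ (nl b b k (projIcc 0 T hT s)) = nl (w s) (w s) k := by
    intro s k
    let ψ : C(Icc 0 T, A) →ₐ[ℂ] ℂ := φ.comp (ContinuousMap.evalAlgHom ℂ A (projIcc 0 T hT s))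
    exact map_nl ψ (hφc.comp (ContinuousEvalConst.continuous_eval_const _))
      (summable_conv_term hn hn hb hb k)
  set y : ℝ → (Fin 2 → ℤ) → ℂ := fun s k =>
    f k - (wlen k ^ 2 : ℝ) * w s k - nl (w s) (w s) k with hy
  have hder : ∀ s ∈ Ioo 0 T, ∀ k, HasDerivAt (fun s => w s k) (r * y s k) s := by
    intro s hs k
    have h1 := (L.restrictScalars ℝ).hasFDerivAt.comp_hasDerivAt s
      (mild_hasDerivAt (lam := lam) hT hfix k hs)
    refine h1.congr_deriv ?_
    rw [ContinuousLinearMap.coe_restrictScalars', hL]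
    simp only [map_sub, map_mul, hφl, hnl, AlgHom.commutes, Algebra.algebraMap_self_apply, hy, hwk]
    have e : φ ((wlen k ^ 2) • (lam * b k (projIcc 0 T hT s)))
        = (wlen k ^ 2 : ℝ) * (r * φ (b k (projIcc 0 T hT s))) := by
      rw [← Complex.coe_smul, map_smul, map_mul, hφl, smul_eq_mul]
    rw [e]
    ring
  have hyb : ∀ s k, ‖r * y s k‖ ≤ r * (‖f k‖ + wlen k ^ 2 * ‖b k‖ + ‖nl b b k‖) := by
    intro s k
    rw [norm_mul, Complex.norm_real, Real.norm_eq_abs, abs_of_pos hr]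
    refine mul_le_mul_of_nonneg_left ?_ hr.le
    refine (norm_sub_le _ _).trans (add_le_add ((norm_sub_le _ _).trans (add_le_add le_rfl ?_)) ?_)
    · rw [norm_mul, Complex.norm_real, Real.norm_eq_abs, abs_of_nonneg (sq_nonneg _)]
      exact mul_le_mul_of_nonneg_left (hbd s k) (sq_nonneg _)
    · rw [← hnl]
      exact (hφ _).trans (ContinuousMap.norm_coe_le_norm _ _)
  have hyL : L2Bd (fun k => r * (‖f k‖ + wlen k ^ 2 * ‖b k‖ + ‖nl b b k‖)) _ :=
    ((hf.add hE).add hN).const_mul hr.le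
  have hyA : ∀ s, L2Bd (fun k => ‖r * y s k‖) _ := fun s =>
    hyL.mono fun k => by rw [abs_of_nonneg (norm_nonneg _)]; exact hyb s k
  have hc : ContinuousOn w (Icc 0 T) := by
    intro s _
    refine Amp.tendsto_of_dominated (hb2.const_mul zero_le_two) (fun k => ?_)
      (Eventually.of_forall fun r k => ?_)
    · have : Continuous fun s => w s k :=
        hφc.comp ((b k).continuous.comp continuous_projIcc)
      exact this.continuousAt.continuousWithinAt
    · rw [two_mul]
      exact (norm_sub_le _ _).trans (add_le_add (hbd r k) (hbd s k))
  have h0 : w 0 = a t₀ := by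
    ext k
    rw [hwk, ← hua, projIcc_left, hfix k]
    have e1 : duhamelC lam hT (wlen k ^ 2) (algebraMap ℂ _ (f k) - nl b b k) ⟨0, ⟨le_rfl, hT⟩⟩ = 0 := by
      change duhamel _ _ _ 0 = 0
      rw [duhamel, intervalIntegral.integral_same, mul_zero]
    rw [ContinuousMap.add_apply, e1, add_zero]
    change φ (u k • sg lam (wlen k ^ 2 * 0)) = u k
    rw [mul_zero, sg_zero, map_smul, map_one, smul_eq_mul, mul_one]
  have := hs.eq_of_regular hT hr hc h0 (fun s hs => ⟨y s, (hyA s).toAmp, fun k => rfl, fun k => rfl,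
    Amp.hasDerivAt_of_dominated hyL hs hder (fun s _ => hyb s) fun k => rfl⟩)
    (fun s _ => hwreg s) (fun s _ => (hwreg s).summable.tsum_le_tsum (hbd s) hb) hsT
  rw [← this, hwk]

end Mild

end NSE2D

namespace NSE2D

open Set Filter Topology ComplexConjugate

/-! ### The algebra of holomorphic functions on a disc of time directions -/

/-- The closed disc of complexified time directions. -/
abbrev DirDisc : Type := Metric.closedBall (1 : ℂ) (1 / 2)

/-- The coordinate function. -/
def dirCoord : C(DirDisc, ℂ) := ⟨Subtype.val, continuous_subtype_val⟩

/-- The closed algebra generated by the coordinate function. -/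
abbrev DirAlg : Type := Algebra.elemental ℂ dirCoord

/-- The coordinate function as an element of the algebra it generates. -/
def dirElt : DirAlg := ⟨dirCoord, Algebra.elemental.self_mem ℂ dirCoord⟩

/-- Evaluation at a time direction. -/
noncomputable def dirEval (x : DirDisc) : DirAlg →ₐ[ℂ] ℂ :=
  (ContinuousMap.evalAlgHom ℂ ℂ x).comp (Algebra.elemental ℂ dirCoord).val

theorem norm_dirEval_le (x : DirDisc) (y : DirAlg) : ‖dirEval x y‖ ≤ ‖y‖ :=
  (y : C(DirDisc, ℂ)).norm_coe_le_norm x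

theorem DirAlg.norm_le {y : DirAlg} {C : ℝ} (hC : 0 ≤ C) (h : ∀ x, ‖dirEval x y‖ ≤ C) : ‖y‖ ≤ C :=
  (ContinuousMap.norm_le _ hC).2 h

theorem continuous_dirEval (x : DirDisc) : Continuous (dirEval x) :=
  (ContinuousEvalConst.continuous_eval_const x).comp continuous_subtype_val

theorem dirEval_sg (x : DirDisc) (s : ℝ) :
    dirEval x (sg dirElt s) = Complex.exp (-(s * (x : ℂ))) := by
  let _ : NormedAlgebra ℚ DirAlg := NormedAlgebra.restrictScalars ℚ ℝ DirAlg
  rw [sg, NormedSpace.map_exp _ (continuous_dirEval x), ← Complex.exp_eq_exp_ℂ, ← Complex.coe_smul, map_smul, smul_eq_mul]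
  congr 1
  have : dirEval x dirElt = (x : ℂ) := rfl
  rw [this]
  push_cast
  ring

theorem isDamping_dirElt : IsDamping dirElt where
  norm_le := DirAlg.norm_le (by norm_num) fun x => by
    have h := mem_closedBall_iff_norm.1 x.2
    calc ‖(x : ℂ)‖ = ‖((x : ℂ) - 1) + 1‖ := by rw [sub_add_cancel]
      _ ≤ 1 / 2 + ‖(1 : ℂ)‖ := (norm_add_le _ _).trans (by gcongr)
      _ = 3 / 2 := by norm_num
  norm_sg_le s hs := DirAlg.norm_le (Real.exp_pos _).le fun x => by
    rw [dirEval_sg, Complex.norm_exp]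
    refine Real.exp_le_exp.2 ?_
    have h := (Complex.abs_re_le_norm _).trans (mem_closedBall_iff_norm.1 x.2)
    rw [Complex.sub_re, Complex.one_re] at h
    have h2 : 1 / 2 ≤ (x : ℂ).re := by linarith [(abs_le.1 h).1]
    rw [Complex.neg_re, Complex.re_ofReal_mul]
    nlinarith

theorem isDamping_one : IsDamping (1 : ℂ) where
  norm_le := by norm_num
  norm_sg_le s hs := by
    rw [sg, ← Complex.exp_eq_exp_ℂ, Complex.norm_exp]
    refine Real.exp_le_exp.2 ?_
    simp only [neg_smul, Complex.real_smul, mul_one, Complex.neg_re, Complex.ofReal_re]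
    linarith

/-- The values of an element of the algebra, as a function on the plane. -/
noncomputable def dirExt (y : C(DirDisc, ℂ)) (x : ℂ) : ℂ :=
  open Classical in if h : x ∈ Metric.closedBall (1 : ℂ) (1 / 2) then y ⟨x, h⟩ else 0

theorem dirExt_of_mem (y : C(DirDisc, ℂ)) {x : ℂ} (h : x ∈ Metric.closedBall (1 : ℂ) (1 / 2)) :
    dirExt y x = y ⟨x, h⟩ := dif_pos h

/-- The continuous functions that are holomorphic in the interior. -/
noncomputable def holoSubalgebra : Subalgebra ℂ C(DirDisc, ℂ) where
  carrier := {y | DifferentiableOn ℂ (dirExt y) (Metric.ball 1 (1 / 2))}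
  mul_mem' {y z} hy hz := by
    refine (DifferentiableOn.mul hy hz).congr fun x hx => ?_
    have hx' := Metric.ball_subset_closedBall hx
    simp only [Pi.mul_apply, dirExt_of_mem _ hx', ContinuousMap.mul_apply]
  add_mem' {y z} hy hz := by
    refine (DifferentiableOn.add hy hz).congr fun x hx => ?_
    have hx' := Metric.ball_subset_closedBall hx
    simp only [Pi.add_apply, dirExt_of_mem _ hx', ContinuousMap.add_apply]
  algebraMap_mem' c := by
    refine (differentiableOn_const c).congr fun x hx => ?_
    rw [dirExt_of_mem _ (Metric.ball_subset_closedBall hx)]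
    rfl

theorem isClosed_holoSubalgebra : IsClosed (holoSubalgebra : Set C(DirDisc, ℂ)) := by
  refine IsSeqClosed.isClosed fun y z hy hyz => ?_
  refine TendstoLocallyUniformlyOn.differentiableOn (F := fun n => dirExt (y n)) (φ := atTop)
    (TendstoUniformlyOn.tendstoLocallyUniformlyOn ?_) (Eventually.of_forall hy) Metric.isOpen_ball
  rw [Metric.tendstoUniformlyOn_iff]
  intro ε hε
  filter_upwards [Metric.tendsto_nhds.1 hyz ε hε] with n hn x hx
  have hx' := Metric.ball_subset_closedBall hx
  rw [dirExt_of_mem _ hx', dirExt_of_mem _ hx', dist_comm]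
  exact (ContinuousMap.dist_apply_le_dist _).trans_lt hn

/-- The functions holomorphic inside the disc form a closed subalgebra containing the coordinate.
Hence everything constructed inside `DirAlg`, by integrals, series or fixed points, is holomorphic
in the direction without further proof. -/
theorem differentiableOn_dirExt (y : DirAlg) :
    DifferentiableOn ℂ (dirExt y) (Metric.ball 1 (1 / 2)) := by
  have h : dirCoord ∈ holoSubalgebra :=
    differentiableOn_id.congr fun x hx => dirExt_of_mem _ (Metric.ball_subset_closedBall hx)
  exact Algebra.elemental.le_of_mem isClosed_holoSubalgebra h y.2

/-! ### Consequences of local existence for global solutions -/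

namespace SeqSol

variable {f : (Fin 2 → ℤ) → ℂ} {a : ℝ → Amp} (hs : SeqSol f a) {Γ : ℝ} (hf0 : f 0 = 0)
  (hf : L2Bd (fun k => ‖f k‖) Γ)
include hs hf0 hf

/-- Near every time, on the right, the solution has a majorant in the domain of the Stokes
operator. -/
theorem exists_majorant (t₀ : ℝ) : ∃ T > 0, ∃ (M : (Fin 2 → ℤ) → ℝ) (E : ℝ),
    L2Bd (fun k => wlen k * M k) E ∧ ∀ s ∈ Icc 0 T, ∀ k, ‖a (t₀ + s) k‖ ≤ M k := by
  have hu := hs.regular t₀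
  obtain ⟨hfs, -⟩ := summable_div_wlen_sq (fun k => norm_nonneg (f k)) hf
  set ρ := ∑' k, ‖a t₀ k‖ + 3 * ∑' k, ‖f k‖ / wlen k ^ 2
  have hρ : 0 ≤ ρ := add_nonneg (tsum_nonneg fun _ => norm_nonneg _)
    (mul_nonneg zero_le_three (tsum_nonneg fun _ => by positivity))
  set T := ((24 * ρ + 1) ^ 2)⁻¹ with hTdef
  have hT : 0 < T := by positivity
  have hsmall : 24 * ρ * Real.sqrt T ≤ 1 := by
    rw [hTdef, Real.sqrt_inv, Real.sqrt_sq (by positivity), ← div_eq_mul_inv, div_le_one (by positivity)]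
    linarith
  obtain ⟨b, hb, -, hfix⟩ := exists_mild_solution isDamping_one hT.le hf0 hu.summable hfs le_rfl hsmall
  obtain ⟨E, hE⟩ := mild_majorant isDamping_one hT.le hf0 hf hu hb hfix
  have hb0 := mild_zero isDamping_one hT.le hf0 hf hu hb hfix
  refine ⟨T, hT, fun k => ‖b k‖, E, ?_, fun s hsT k => ?_⟩
  · have := L2Bd.of_wlen_succ (s := 1) (by rw [hb0, norm_zero]) (fun k => norm_nonneg (b k)) hE
    simpa using this
  · have := mild_eq_of_character isDamping_one hT.le hf0 hf hu hb hfix (AlgHom.id ℂ ℂ)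
      (fun y => le_rfl) hs (t₀ := t₀) (r := 1) (fun k => rfl) one_pos (by simp) hsT k
    rw [one_mul] at this
    rw [← this]
    exact (b k).norm_coe_le_norm _

/-- Evaluate the algebra-valued solution at `s = T` and read it as a function of `ζ = t₀ + λT`: the
disc of directions becomes the disc of radius `T/2` about `t₀ + T`. -/
theorem exists_holomorphic {t₀ T ρ : ℝ} (hT : 0 < T)
    (hρ : ∑' k, ‖a t₀ k‖ + 3 * ∑' k, ‖f k‖ / wlen k ^ 2 ≤ ρ) (hsmall : 24 * ρ * Real.sqrt T ≤ 1) :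
    ∃ h : ℂ → (Fin 2 → ℤ) → ℂ,
      (∀ k, DifferentiableOn ℂ (fun ζ => h ζ k) (Metric.ball ((t₀ + T : ℝ) : ℂ) (T / 2))) ∧
      (∀ k, DifferentiableOn ℂ (fun ζ => nl (h ζ) (h ζ) k)
        (Metric.ball ((t₀ + T : ℝ) : ℂ) (T / 2))) ∧
      (∀ ζ ∈ Metric.ball ((t₀ + T : ℝ) : ℂ) (T / 2),
        Summable (fun k => ‖h ζ k‖) ∧ ∑' k, ‖h ζ k‖ ≤ 2 * ρ) ∧
      ∀ t : ℝ, (t : ℂ) ∈ Metric.ball ((t₀ + T : ℝ) : ℂ) (T / 2) → ∀ k, h t k = a t k := by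
  have hu := hs.regular t₀
  obtain ⟨hfs, -⟩ := summable_div_wlen_sq (fun k => norm_nonneg (f k)) hf
  obtain ⟨b, hb, hbρ, hfix⟩ :=
    exists_mild_solution isDamping_dirElt hT.le hf0 hu.summable hfs hρ hsmall
  have hn : ∀ k, 0 ≤ ‖b k‖ := fun k => norm_nonneg _
  set e : Icc 0 T := projIcc 0 T hT.le T with he
  set x : ℂ → ℂ := fun ζ => (ζ - t₀) / T with hx
  have hT' : (T : ℂ) ≠ 0 := Complex.ofReal_ne_zero.2 hT.ne'
  have hxm : MapsTo x (Metric.ball ((t₀ + T : ℝ) : ℂ) (T / 2)) (Metric.ball 1 (1 / 2)) := by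
    intro ζ hζ
    rw [mem_ball_iff_norm] at hζ ⊢
    have : x ζ - 1 = (ζ - (t₀ + T : ℝ)) / T := by
      rw [hx]; push_cast; field_simp; ring
    rw [this, norm_div, Complex.norm_real, Real.norm_eq_abs, abs_of_pos hT, div_lt_iff₀ hT]
    linarith
  have hxd : DifferentiableOn ℂ x (Metric.ball ((t₀ + T : ℝ) : ℂ) (T / 2)) := by
    rw [hx]; fun_prop
  have key : ∀ y : DirAlg, DifferentiableOn ℂ (fun ζ => dirExt y (x ζ))
      (Metric.ball ((t₀ + T : ℝ) : ℂ) (T / 2)) := fun y =>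
    (differentiableOn_dirExt y).comp hxd hxm
  have hev : ∀ ζ (hζ : ζ ∈ Metric.ball ((t₀ + T : ℝ) : ℂ) (T / 2)) (y : DirAlg),
      dirExt y (x ζ) = dirEval ⟨x ζ, Metric.ball_subset_closedBall (hxm hζ)⟩ y :=
    fun ζ hζ y => dirExt_of_mem _ _
  refine ⟨fun ζ k => dirExt (b k e : DirAlg) (x ζ), fun k => key (b k e), fun k => ?_,
    fun ζ hζ => ?_, fun t ht k => ?_⟩
  · refine (key (nl b b k e)).congr fun ζ hζ => ?_
    simp only [hev ζ hζ]
    let ψ : C(Icc 0 T, DirAlg) →ₐ[ℂ] ℂ :=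
      (dirEval ⟨x ζ, Metric.ball_subset_closedBall (hxm hζ)⟩).comp
        (ContinuousMap.evalAlgHom ℂ DirAlg e)
    have hψ : Continuous ψ := (continuous_dirEval _).comp
      (ContinuousEvalConst.continuous_eval_const e)
    exact (map_nl ψ hψ (summable_conv_term hn hn hb hb k)).symm
  · have h1 : ∀ k, ‖dirExt (b k e : DirAlg) (x ζ)‖ ≤ ‖b k‖ := fun k => by
      rw [hev ζ hζ]
      exact (norm_dirEval_le _ _).trans ((b k).norm_coe_le_norm _)
    have h2 : Summable fun k => ‖dirExt (b k e : DirAlg) (x ζ)‖ :=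
      .of_nonneg_of_le (fun _ => norm_nonneg _) h1 hb
    exact ⟨h2, (h2.tsum_le_tsum h1 hb).trans hbρ⟩
  · have hxt : x t = ((t - t₀) / T : ℝ) := by rw [hx]; push_cast; rfl
    have hr : 0 < (t - t₀) / T := by
      have := mem_ball_iff_norm.1 (hxm ht)
      rw [hxt] at this
      have h2 := (Complex.abs_re_le_norm _).trans this.le
      rw [Complex.sub_re, Complex.one_re, Complex.ofReal_re] at h2
      linarith [(abs_le.1 h2).1]
    have h1 := mild_eq_of_character isDamping_dirElt hT.le hf0 hf hu hb hfix
      (dirEval ⟨x t, Metric.ball_subset_closedBall (hxm ht)⟩) (norm_dirEval_le _) hs (t₀ := t₀)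
      (fun k => rfl) hr hxt (s := T) ⟨hT.le, le_rfl⟩ k
    rw [div_mul_cancel₀ _ hT.ne', add_sub_cancel] at h1
    rw [← h1]
    exact hev t ht _

end SeqSol

end NSE2D

namespace NSE2D

open Set Filter Topology ComplexConjugate

/-! ### Uniform bounds for the enstrophy -/

/-- Backward real induction on the infimum `σ` of the times from which `K ≤ ψ` holds up to `t₁`. It
replaces the integration of a differential inequality: the enstrophy is not known to be
differentiable, only right-continuous with a one-sided estimate from the left. -/
theorem le_of_backward_step {ψ : ℝ → ℝ} {K t₀ t₁ : ℝ} (h01 : t₀ ≤ t₁)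
    (hright : ∀ t, Tendsto ψ (𝓝[>] t) (𝓝 (ψ t)))
    (hleft : ∀ t ∈ Ioc t₀ t₁, K ≤ ψ t → ∀ᶠ s in 𝓝[<] t, K ≤ ψ s) (h1 : K ≤ ψ t₁) : K ≤ ψ t₀ := by
  set S : Set ℝ := {t | t ∈ Icc t₀ t₁ ∧ ∀ s ∈ Icc t t₁, K ≤ ψ s} with hS
  have ht1 : t₁ ∈ S := ⟨⟨h01, le_rfl⟩, fun s hs => by rwa [le_antisymm hs.2 hs.1]⟩
  have hbdd : BddBelow S := ⟨t₀, fun t ht => ht.1.1⟩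
  set σ := sInf S with hσ
  have hσ0 : t₀ ≤ σ := le_csInf ⟨t₁, ht1⟩ fun t ht => ht.1.1
  have hσ1 : σ ≤ t₁ := csInf_le hbdd ht1
  have habove : ∀ s ∈ Ioc σ t₁, K ≤ ψ s := by
    intro s hs
    obtain ⟨t, ht, hts⟩ := exists_lt_of_csInf_lt ⟨t₁, ht1⟩ hs.1
    exact ht.2 s ⟨hts.le, hs.2⟩
  have hat : K ≤ ψ σ := by
    rcases hσ1.eq_or_lt with h | h
    · rwa [h]
    · refine ge_of_tendsto (hright σ) ?_
      filter_upwards [Ioc_mem_nhdsGT h] with s hs using habove s hs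
  rcases hσ0.eq_or_lt with h | h
  · rwa [h]
  · exfalso
    have hev := (hleft σ ⟨h, hσ1⟩ hat)
    rw [eventually_iff, mem_nhdsLT_iff_exists_Ioo_subset' h] at hev
    obtain ⟨l, hl, hsub⟩ := hev
    have hl' : l < σ := hl
    have hmem : max t₀ ((l + σ) / 2) ∈ S := by
      refine ⟨⟨le_max_left _ _, max_le (hσ0.trans hσ1) (by linarith)⟩, fun s hs => ?_⟩
      rcases lt_trichotomy s σ with h2 | h2 | h2
      · exact hsub ⟨by linarith [(le_max_right t₀ ((l + σ) / 2)).trans hs.1], h2⟩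
      · rwa [h2]
      · exact habove s ⟨h2, hs.2⟩
    exact absurd (csInf_le hbdd hmem) (not_le.2 (max_lt h (by linarith)))

namespace SeqSol

variable {f : (Fin 2 → ℤ) → ℂ} {a : ℝ → Amp} (hs : SeqSol f a)
include hs

theorem continuous : Continuous a := continuous_iff_continuousAt.2 fun t =>
  (hs.deriv t).choose_spec.2.continuousAt

theorem continuous_apply (k : Fin 2 → ℤ) : Continuous fun t => a t k :=
  ((lp.lipschitzWith_one_eval (E := fun _ : Fin 2 → ℤ => ℂ) 2 k).continuous).comp hs.continuous

variable {Γ : ℝ} (hf : L2Bd (fun k => ‖f k‖) Γ)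

theorem tendsto_enst_right (hf0 : f 0 = 0) (hf : L2Bd (fun k => ‖f k‖) Γ) (t₀ : ℝ) :
    Tendsto (fun t => enst (a t)) (𝓝[>] t₀) (𝓝 (enst (a t₀))) := by
  obtain ⟨T, hT, M, E, hM, hb⟩ := hs.exists_majorant hf0 hf t₀
  refine tendsto_tsum_of_dominated_convergence hM.summable (fun k => ?_) ?_
  · have : Continuous fun t => (wlen k * ‖a t k‖) ^ 2 :=
      ((continuous_const.mul (hs.continuous_apply k).norm).pow 2)
    exact (this.tendsto t₀).mono_left nhdsWithin_le_nhds
  · filter_upwards [Ioc_mem_nhdsGT (lt_add_of_pos_right t₀ hT)] with t ht k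
    have h1 := hb (t - t₀) ⟨by linarith [ht.1], by linarith [ht.2]⟩ k
    rw [add_sub_cancel] at h1
    rw [Real.norm_eq_abs, abs_of_nonneg (sq_nonneg _)]
    have := wlen_nonneg k
    gcongr

-- By convexity of the squared norm, `enst (a t) - enst (a s)` is at most `2 Re (a t - a s, A (a
-- t))`. Since `A (a t)` is a fixed element of `ℓ²`, differentiability of `a` in `ℓ²` suffices.
include hf in
theorem eventually_enst_left {t c : ℝ} (hc : Γ * Real.sqrt (palin (a t)) - palin (a t) < c) :
    ∀ᶠ s in 𝓝[<] t, enst (a t) - 2 * c * (t - s) ≤ enst (a s) := by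
  obtain ⟨a', ha', had⟩ := hs.deriv t
  have ht := hs.regular t
  have hv : L2Bd (fun k => ‖((wlen k ^ 2 : ℝ) : ℂ) * a t k‖) (Real.sqrt (palin (a t))) := by
    simpa [abs_of_nonneg, wlen_nonneg] using ht.l2Bd_two
  set v : Amp := hv.toAmp with hvdef
  have hvk : ∀ k, v k = ((wlen k ^ 2 : ℝ) : ℂ) * a t k := fun k => rfl
  have hin : ∀ x : Amp, inner ℂ v x = ∑' k, x k * conj (((wlen k ^ 2 : ℝ) : ℂ) * a t k) := by
    intro x
    rw [lp.inner_eq_tsum]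
    exact tsum_congr fun k => by rw [RCLike.inner_apply, hvk]
  have hder : HasDerivAt (fun s => (inner ℂ v (a s)).re) (inner ℂ v a').re t := by
    have h1 := (hasDerivAt_const t v).inner ℂ had
    rw [inner_zero_left, add_zero] at h1
    exact Complex.reCLM.hasFDerivAt.comp_hasDerivAt t h1
  have hlt : (inner ℂ v a').re < c := by
    rw [hin]
    exact (ht.re_enstrophy_le (hs.real t) hf ha').trans_lt hc
  have hsl := (hasDerivAt_iff_tendsto_slope.1 hder).eventually (gt_mem_nhds hlt)
  have hmono : 𝓝[<] t ≤ 𝓝[≠] t := nhdsWithin_mono t fun s hs => ne_of_lt hs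
  filter_upwards [hmono hsl, self_mem_nhdsWithin] with s hs1 hs2
  have hst : s < t := hs2
  rw [slope_def_field, div_lt_iff_of_neg (by linarith)] at hs1
  have rs := hs.regular s
  have hconv : ∀ k, (wlen k * ‖a t k‖) ^ 2 - (wlen k * ‖a s k‖) ^ 2
      ≤ 2 * ((a t - a s : Amp) k * conj (((wlen k ^ 2 : ℝ) : ℂ) * a t k)).re := by
    intro k
    have e1 : (a t - a s : Amp) k = a t k - a s k := rfl
    rw [e1, map_mul, Complex.conj_ofReal]
    have e2 : ((a t k - a s k) * (((wlen k ^ 2 : ℝ) : ℂ) * conj (a t k))).re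
        = wlen k ^ 2 * ((a t k - a s k) * conj (a t k)).re := by
      rw [← Complex.re_ofReal_mul]; congr 1; ring
    rw [e2, mul_pow, mul_pow, ← mul_sub, mul_left_comm]
    refine mul_le_mul_of_nonneg_left ?_ (sq_nonneg _)
    rw [Complex.sq_norm, Complex.sq_norm, Complex.normSq_apply, Complex.normSq_apply]
    simp only [Complex.mul_re, Complex.sub_re, Complex.sub_im, Complex.conj_re, Complex.conj_im]
    nlinarith [sq_nonneg ((a t k).re - (a s k).re), sq_nonneg ((a t k).im - (a s k).im)]
  have hsum := summable_mul_conj (a t - a s).l2Bd hv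
  have hsum2 := (Complex.hasSum_re hsum.hasSum).mul_left 2
  have hle := hasSum_le hconv (ht.l2Bd_one.summable.hasSum.sub rs.l2Bd_one.summable.hasSum) hsum2
  rw [← hin, inner_sub_right, Complex.sub_re] at hle
  change enst (a t) - enst (a s) ≤ _ at hle
  linarith

theorem enst_le_palin (t : ℝ) : enst (a t) ≤ palin (a t) := by
  have := (hs.regular t).l2Bd_one'.tsum_le
  rwa [Real.sq_sqrt (palin_nonneg _)] at this

variable (hf0 : f 0 = 0) (hM : ∀ t, ‖a t‖ ≤ Γ)
include hf hf0 hM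

/-- Where the enstrophy is at least `2Γ² + 1`, `A a` has norm above `Γ` and the enstrophy cannot
drop going backwards; but it was at most `2Γ²` within the preceding unit of time. -/
theorem enst_lt (t : ℝ) : enst (a t) < 2 * Γ ^ 2 + 1 := by
  by_contra! hlt
  obtain ⟨t₀, ht₀, hle⟩ := hs.exists_enst_le hf hM t
  have := le_of_backward_step (ψ := fun t => enst (a t)) ht₀.2.le
    (hs.tendsto_enst_right hf0 hf) (fun s hsI hK => ?_) hlt
  · linarith
  · have h1 := hK.trans (hs.enst_le_palin s)
    have h2 := Real.sq_sqrt (palin_nonneg (a s))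
    have h3 : Γ < Real.sqrt (palin (a s)) := Real.lt_sqrt_of_sq_lt (by nlinarith [sq_nonneg Γ])
    filter_upwards [hs.eventually_enst_left hf (t := s) (c := 0) (by nlinarith [hf.1])] with r hr
    linarith

/-- Otherwise `2(Γ√P - P) ≤ Γ² - P < -Q` on the whole window, with `P` the squared norm of `A a`,
and going back by `τ` would raise the enstrophy to at least `Qτ = 2Γ² + 1`. -/
theorem exists_palin_le (t : ℝ) {τ : ℝ} (hτ : 0 < τ) :
    ∃ s ∈ Icc (t - τ) t, palin (a s) ≤ Γ ^ 2 + (2 * Γ ^ 2 + 1) / τ := by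
  by_contra! hlt
  set Q := (2 * Γ ^ 2 + 1) / τ with hQ
  have hcont : Continuous fun s : ℝ => Q * (s - t) := by fun_prop
  have := le_of_backward_step (ψ := fun s => enst (a s) + Q * (s - t)) (K := 0)
    (sub_le_self t hτ.le)
    (fun s => (hs.tendsto_enst_right hf0 hf s).add
      ((hcont.tendsto s).mono_left nhdsWithin_le_nhds)) (fun s hsI hK => ?_) ?_
  · have h1 := hs.enst_lt hf hf0 hM (t - τ)
    have h2 : Q * τ = 2 * Γ ^ 2 + 1 := div_mul_cancel₀ _ hτ.ne'
    simp only at this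
    nlinarith
  · have h1 := hlt s ⟨hsI.1.le, hsI.2⟩
    have h2 := Real.sq_sqrt (palin_nonneg (a s))
    filter_upwards [hs.eventually_enst_left hf (t := s) (c := -Q / 2)
      (by nlinarith [sq_nonneg (Γ - Real.sqrt (palin (a s)))])] with r hr
    linarith
  · have := enst_nonneg (a t)
    simpa using this

end SeqSol

/-! ### Holomorphic extension to a strip -/

/-- The waiting window `T/4` makes the bound for `A a` blow up, but it enters the `ℓ¹` norm as
`T^{-1/4}`, which `√T` beats. -/
theorem exists_time_small (Γ : ℝ) : ∃ T > 0,
    24 * (latticeConst * Real.sqrt (Real.sqrt (2 * Γ ^ 2 + 1) *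
      Real.sqrt (Γ ^ 2 + (2 * Γ ^ 2 + 1) / (T / 4))) + 3 * (latticeConst * Γ)) * Real.sqrt T ≤ 1 := by
  have hc : Continuous fun T : ℝ => 24 * (latticeConst * Real.sqrt (Real.sqrt (2 * Γ ^ 2 + 1) *
      Real.sqrt (Γ ^ 2 * T ^ 2 + 4 * (2 * Γ ^ 2 + 1) * T)) + 3 * (latticeConst * Γ) * Real.sqrt T) := by
    fun_prop
  have h0 := (hc.tendsto 0).mono_left (nhdsWithin_le_nhds (s := Ioi 0))
  simp only [ne_eq, OfNat.ofNat_ne_zero, not_false_eq_true, zero_pow, mul_zero, add_zero,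
    Real.sqrt_zero] at h0
  obtain ⟨T, hT1, hT2⟩ := ((h0.eventually (gt_mem_nhds one_pos)).and self_mem_nhdsWithin).exists
  have hT : 0 < T := hT2
  refine ⟨T, hT, le_trans (le_of_eq ?_) hT1.le⟩
  have e1 : Γ ^ 2 * T ^ 2 + 4 * (2 * Γ ^ 2 + 1) * T
      = (Γ ^ 2 + (2 * Γ ^ 2 + 1) / (T / 4)) * T ^ 2 := by
    field_simp
  have e2 : ∀ x y : ℝ, 0 ≤ x → 0 ≤ y →
      Real.sqrt (x * Real.sqrt (y * T ^ 2)) = Real.sqrt (x * Real.sqrt y) * Real.sqrt T := by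
    intro x y hx hy
    rw [Real.sqrt_mul hy, Real.sqrt_sq hT.le, ← mul_assoc, Real.sqrt_mul (by positivity)]
  rw [e1, e2 _ _ (Real.sqrt_nonneg _) (by positivity)]
  ring

theorem SeqSol.exists_holomorphic_ball (Γ : ℝ) : ∃ δ > 0, ∃ K : ℝ,
    ∀ (f : (Fin 2 → ℤ) → ℂ) (a : ℝ → Amp), SeqSol f a → f 0 = 0 → L2Bd (fun k => ‖f k‖) Γ →
      (∀ t, ‖a t‖ ≤ Γ) → ∀ t : ℝ, ∃ h : ℂ → (Fin 2 → ℤ) → ℂ,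
      (∀ k, DifferentiableOn ℂ (fun ζ => h ζ k) (Metric.ball (t : ℂ) δ)) ∧
      (∀ k, DifferentiableOn ℂ (fun ζ => nl (h ζ) (h ζ) k) (Metric.ball (t : ℂ) δ)) ∧
      (∀ ζ ∈ Metric.ball (t : ℂ) δ, Summable (fun k => ‖h ζ k‖) ∧ ∑' k, ‖h ζ k‖ ≤ K) ∧
      ∀ s : ℝ, (s : ℂ) ∈ Metric.ball (t : ℂ) δ → ∀ k, h s k = a s k := by
  obtain ⟨T, hT, hsmall⟩ := exists_time_small Γ
  set ρ := latticeConst * Real.sqrt (Real.sqrt (2 * Γ ^ 2 + 1) *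
      Real.sqrt (Γ ^ 2 + (2 * Γ ^ 2 + 1) / (T / 4))) + 3 * (latticeConst * Γ) with hρ
  refine ⟨T / 4, by positivity, 2 * ρ, fun f a hs hf0 hf hM t => ?_⟩
  -- With `t₀ ∈ [t - 5T/4, t - T]` the centre `t₀ + T` is within `T/4` of `t`, so the disc of radius
  -- `T/4` about `t` lies in the one of radius `T/2` about `t₀ + T`.
  obtain ⟨t₀, ht₀, hP⟩ := hs.exists_palin_le hf hf0 hM (t - T) (by positivity : 0 < T / 4)
  have hl1 : ∑' k, ‖a t₀ k‖ + 3 * ∑' k, ‖f k‖ / wlen k ^ 2 ≤ ρ := by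
    refine add_le_add ((hs.regular t₀).tsum_le.trans ?_) (mul_le_mul_of_nonneg_left
      (summable_div_wlen_sq (fun k => norm_nonneg (f k)) hf).2 zero_le_three)
    refine mul_le_mul_of_nonneg_left (Real.sqrt_le_sqrt ?_) latticeConst_nonneg
    exact mul_le_mul (Real.sqrt_le_sqrt (hs.enst_lt hf hf0 hM t₀).le) (Real.sqrt_le_sqrt hP)
      (Real.sqrt_nonneg _) (Real.sqrt_nonneg _)
  obtain ⟨h, h1, h2, h3, h4⟩ := hs.exists_holomorphic hf0 hf hT hl1 hsmall
  have hsub : Metric.ball (t : ℂ) (T / 4) ⊆ Metric.ball ((t₀ + T : ℝ) : ℂ) (T / 2) := by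
    refine Metric.ball_subset_ball' ?_
    rw [dist_eq_norm, ← Complex.ofReal_sub, Complex.norm_real, Real.norm_eq_abs]
    have : |t - (t₀ + T)| ≤ T / 4 := abs_le.2 ⟨by linarith [ht₀.2], by linarith [ht₀.1]⟩
    linarith
  exact ⟨h, fun k => (h1 k).mono hsub, fun k => (h2 k).mono hsub, fun ζ hζ => h3 ζ (hsub hζ),
    fun s hs' => h4 s (hsub hs')⟩

theorem eqOn_of_eq_on_reals {V : Set ℂ} (hV : IsOpen V) (hVc : IsPreconnected V) {x : ℝ}
    (hx : (x : ℂ) ∈ V) {F G : ℂ → ℂ} (hF : DifferentiableOn ℂ F V) (hG : DifferentiableOn ℂ G V)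
    (h : ∀ t : ℝ, (t : ℂ) ∈ V → F t = G t) : EqOn F G V := by
  refine (hF.analyticOnNhd hV).eqOn_of_preconnected_of_frequently_eq (hG.analyticOnNhd hV) hVc hx ?_
  have h1 : Tendsto (fun t : ℝ => (t : ℂ)) (𝓝[≠] x) (𝓝[≠] (x : ℂ)) := by
    refine tendsto_nhdsWithin_iff.2 ⟨(Complex.continuous_ofReal.tendsto x).mono_left
      nhdsWithin_le_nhds, ?_⟩
    filter_upwards [self_mem_nhdsWithin] with t ht
    exact fun hc => ht (Complex.ofReal_injective hc)
  refine h1.frequently (Eventually.frequently ?_)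
  have h2 : ∀ᶠ t : ℝ in 𝓝 x, (t : ℂ) ∈ V :=
    Complex.continuous_ofReal.continuousAt.eventually_mem (hV.mem_nhds hx)
  filter_upwards [nhdsWithin_le_nhds h2] with t ht using h t ht

theorem isOpen_strip (δ : ℝ) : IsOpen (strip δ) :=
  isOpen_lt (Complex.continuous_im.abs) continuous_const

theorem ofReal_mem_strip {δ : ℝ} (hδ : 0 < δ) (t : ℝ) : (t : ℂ) ∈ strip δ := by
  simpa [strip] using hδ

theorem mem_ball_re {δ : ℝ} {ζ : ℂ} (h : ζ ∈ strip δ) : ζ ∈ Metric.ball (ζ.re : ℂ) δ := by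
  have e : ζ - ζ.re = (ζ.im : ℂ) * Complex.I := by
    rw [sub_eq_iff_eq_add', Complex.re_add_im]
  rw [mem_ball_iff_norm, e, norm_mul, Complex.norm_I, mul_one, Complex.norm_real]
  exact h

/-- Overlaps of the discs used for gluing are convex and contain real points, so the local
extensions agree by the identity theorem. The same theorem propagates the equation from real to
complex times. -/
theorem SeqSol.exists_extension (Γ : ℝ) : ∃ δ > 0, ∃ K : ℝ,
    ∀ (f : (Fin 2 → ℤ) → ℂ) (a : ℝ → Amp), SeqSol f a → f 0 = 0 → L2Bd (fun k => ‖f k‖) Γ →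
      (∀ t, ‖a t‖ ≤ Γ) → ∃ U : ℂ → (Fin 2 → ℤ) → ℂ, (∀ (t : ℝ) k, U t k = a t k) ∧
      ∀ ζ ∈ strip δ, Summable (fun k => ‖U ζ k‖) ∧ ∑' k, ‖U ζ k‖ ≤ K ∧ U ζ 0 = 0 ∧
        ∀ k, HasDerivAt (fun z => U z k)
          (f k - (wlen k ^ 2 : ℝ) * U ζ k - nl (U ζ) (U ζ) k) ζ := by
  obtain ⟨δ, hδ, K, hK⟩ := SeqSol.exists_holomorphic_ball Γ
  refine ⟨δ, hδ, K, fun f a hs hf0 hf hM => ?_⟩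
  choose h h1 h2 h3 h4 using hK f a hs hf0 hf hM
  have hglue : ∀ (t : ℝ), ∀ ζ ∈ Metric.ball (t : ℂ) δ, h ζ.re ζ = h t ζ := by
    intro t ζ hζ
    have hζs : ζ ∈ strip δ := by
      have := (Complex.abs_im_le_norm _).trans_lt (mem_ball_iff_norm.1 hζ)
      simpa [strip] using this
    have hre : (ζ.re : ℂ) ∈ Metric.ball (t : ℂ) δ := by
      have := (Complex.abs_re_le_norm _).trans_lt (mem_ball_iff_norm.1 hζ)
      rw [Complex.sub_re, Complex.ofReal_re] at this
      rwa [mem_ball_iff_norm, ← Complex.ofReal_sub, Complex.norm_real, Real.norm_eq_abs]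
    funext k
    refine eqOn_of_eq_on_reals (V := Metric.ball (ζ.re : ℂ) δ ∩ Metric.ball (t : ℂ) δ)
      (Metric.isOpen_ball.inter Metric.isOpen_ball)
      ((convex_ball _ _).inter (convex_ball _ _)).isPreconnected
      ⟨Metric.mem_ball_self hδ, hre⟩ ((h1 ζ.re k).mono inter_subset_left)
      ((h1 t k).mono inter_subset_right) (fun s hs' => ?_) ⟨mem_ball_re hζs, hζ⟩
    rw [h4 _ s hs'.1, h4 _ s hs'.2]
  refine ⟨fun ζ => h ζ.re ζ, fun t k => ?_, fun ζ hζ => ?_⟩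
  · exact h4 _ t (by rw [Complex.ofReal_re]; exact Metric.mem_ball_self hδ) k
  have hζb := mem_ball_re hζ
  refine ⟨(h3 _ ζ hζb).1, (h3 _ ζ hζb).2, ?_, fun k => ?_⟩
  · refine eqOn_of_eq_on_reals (G := fun _ => 0) Metric.isOpen_ball (convex_ball _ _).isPreconnected
      (Metric.mem_ball_self hδ) (h1 ζ.re 0) (differentiableOn_const 0) (fun s hs' => ?_) hζb
    rw [h4 _ s hs', hs.zero]
  · have hd : ∀ z ∈ Metric.ball (ζ.re : ℂ) δ,
        HasDerivAt (fun z => h ζ.re z k) (_root_.deriv (fun z => h ζ.re z k) z) z := fun z hz =>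
      ((h1 ζ.re k).differentiableAt (Metric.isOpen_ball.mem_nhds hz)).hasDerivAt
    have heq : _root_.deriv (fun z => h ζ.re z k) ζ
        = f k - (wlen k ^ 2 : ℝ) * h ζ.re ζ k - nl (h ζ.re ζ) (h ζ.re ζ) k := by
      refine eqOn_of_eq_on_reals (F := _root_.deriv fun z => h ζ.re z k)
        (G := fun z => f k - (wlen k ^ 2 : ℝ) * h ζ.re z k - nl (h ζ.re z) (h ζ.re z) k)
        Metric.isOpen_ball (convex_ball _ _).isPreconnected
        (Metric.mem_ball_self hδ) ((h1 ζ.re k).deriv Metric.isOpen_ball)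
        (((h1 ζ.re k).const_mul _).const_sub _ |>.sub (h2 ζ.re k)) (fun s hs' => ?_) hζb
      obtain ⟨a', ha', had⟩ := hs.deriv s
      have e1 := (hd s hs').comp_ofReal
      have e2 : HasDerivAt (fun r : ℝ => h ζ.re r k) (a' k) s := by
        refine (Amp.hasDerivAt_apply had k).congr_of_eventuallyEq ?_
        filter_upwards [Complex.continuous_ofReal.continuousAt.eventually_mem
          (Metric.isOpen_ball.mem_nhds hs')] with r hr using h4 _ r hr k
      have e3 : h ζ.re s = a s := funext fun k => h4 _ s hs' k
      simp only [e3]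
      rw [e1.unique e2, ha' k]
    have := hd ζ hζb
    rw [heq] at this
    refine this.congr_of_eventuallyEq ?_
    filter_upwards [Metric.isOpen_ball.mem_nhds hζb] with z hz
    rw [hglue _ z hz]

end NSE2D

namespace NSE2D

open Set Filter Topology ComplexConjugate

/-! ### Higher norms -/

/-- Cauchy's estimate for weighted `ℓ²` norms. -/
theorem L2Bd.deriv_of_strip {ι : Type*} {U U' : ℂ → ι → ℂ} {δ δ' R : ℝ} (hδ : δ' < δ)
    {w : ι → ℝ} (hR : ∀ ζ ∈ strip δ, L2Bd (fun k => w k * ‖U ζ k‖) R)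
    (hd : ∀ ζ ∈ strip δ, ∀ k, HasDerivAt (fun z => U z k) (U' ζ k) ζ) {ζ : ℂ} (hζ : ζ ∈ strip δ') :
    L2Bd (fun k => w k * ‖U' ζ k‖) (R / (δ - δ')) := by
  have hr : 0 < δ - δ' := sub_pos.2 hδ
  have hsub : Metric.closedBall ζ (δ - δ') ⊆ strip δ := by
    intro z hz
    have h1 := (Complex.abs_im_le_norm _).trans (mem_closedBall_iff_norm.1 hz)
    rw [Complex.sub_im] at h1
    have h2 : |ζ.im| < δ' := hζ
    have h3 := abs_add_le (z.im - ζ.im) ζ.im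
    rw [sub_add_cancel] at h3
    change |z.im| < δ
    linarith
  have hζ' : ζ ∈ strip δ := hsub (Metric.mem_closedBall_self hr.le)
  refine ⟨div_nonneg (hR ζ hζ').1 hr.le, fun s => ?_⟩
  -- Cauchy's estimate is applied to a finite section as a vector in Euclidean space, so the `ℓ²`
  -- constant does not depend on the number of modes.
  let F : ℂ → EuclideanSpace ℂ s := fun z => (EuclideanSpace.equiv s ℂ).symm fun k => (w k : ℂ) * U z k
  have hF : ∀ z ∈ strip δ, HasDerivAt F
      ((EuclideanSpace.equiv s ℂ).symm fun k => (w k : ℂ) * U' z k) z := by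
    intro z hz
    have h1 : HasDerivAt (fun z => fun k : s => (w k : ℂ) * U z k) (fun k => (w k : ℂ) * U' z k) z :=
      hasDerivAt_pi.2 fun k => (hd z hz k).const_mul _
    exact ((EuclideanSpace.equiv s ℂ).symm.hasFDerivAt).comp_hasDerivAt z h1
  have hnorm : ∀ V : ℂ → ι → ℂ, ∀ z,
      ‖((EuclideanSpace.equiv s ℂ).symm fun k => (w k : ℂ) * V z k)‖ ^ 2
        = ∑ k ∈ s, (w k * ‖V z k‖) ^ 2 := by
    intro V z
    rw [EuclideanSpace.norm_sq_eq, ← Finset.sum_coe_sort s]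
    refine Finset.sum_congr rfl fun k _ => ?_
    change ‖(w k : ℂ) * V z k‖ ^ 2 = _
    rw [norm_mul, mul_pow, mul_pow, Complex.norm_real, Real.norm_eq_abs, sq_abs]
  have hcauchy := Complex.norm_deriv_le_of_forall_mem_sphere_norm_le (f := F) (C := R) hr
    (DifferentiableOn.diffContOnCl_ball (U := strip δ)
      (fun z hz => (hF z hz).differentiableAt.differentiableWithinAt) hsub) fun z hz => by
      refine le_of_sq_le_sq ?_ (hR ζ hζ').1
      rw [hnorm]
      exact (hR z (hsub (Metric.sphere_subset_closedBall hz))).2 s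
  rw [(hF ζ hζ').deriv] at hcauchy
  rw [← hnorm]
  exact pow_le_pow_left₀ (norm_nonneg _) hcauchy 2

/-- One step of elliptic regularity. -/
theorem l2Bd_wlen_succ {f x x' : (Fin 2 → ℤ) → ℂ} {K D P P' : ℝ} (s : ℕ) (hx0 : x 0 = 0)
    (hf0 : f 0 = 0) (hx' : IsField f x x') (hx : Summable fun k => ‖x k‖) (hK : ∑' k, ‖x k‖ ≤ K)
    (hD : L2Bd (fun k => wlen k ^ s * ‖x k‖) D) (hf : L2Bd (fun k => wlen k ^ s * ‖f k‖) P)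
    (hP : L2Bd (fun k => wlen k ^ s * ‖x' k‖) P') :
    L2Bd (fun k => wlen k ^ (s + 1) * ‖x k‖) (P + P' + 2 ^ s * (K * D)) := by
  have hn : ∀ k, 0 ≤ ‖x k‖ := fun k => norm_nonneg _
  have hx'0 : x' 0 = 0 := by rw [hx' 0, hf0, hx0, nl_zero_mode]; simp
  have hpt : ∀ k, wlen k ^ 2 * ‖x k‖ ≤ ‖f k‖ + ‖x' k‖ + ‖nl x x k‖ := by
    intro k
    have e : ((wlen k ^ 2 : ℝ) : ℂ) * x k = f k - x' k - nl x x k := by rw [hx' k]; ring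
    have h1 := congrArg norm e
    rw [norm_mul, Complex.norm_real, Real.norm_eq_abs, abs_of_nonneg (sq_nonneg _)] at h1
    rw [h1]
    exact (norm_sub_le _ _).trans (add_le_add_left (norm_sub_le _ _) _)
  -- For `s = 0` no derivative of `x` is known yet: the divergence form of `nl` is used and one
  -- factor `|k|` divided out. For positive order the tame estimate applies, and the bounds on `f`
  -- and `x'` may be lowered by one order.
  rcases s with _ | s
  · simp only [pow_zero, one_mul] at hD hf hP ⊢
    have hc := L2Bd.conv hn hn hx hK hD
    refine ((hf.add hP).add hc).mono fun k => ?_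
    rw [zero_add, pow_one, abs_of_nonneg (mul_nonneg (wlen_nonneg k) (hn k))]
    have hcn := conv_nonneg hn hn k
    rcases eq_or_ne k 0 with rfl | hk
    · rw [wlen_zero, zero_mul]; positivity
    · have hw := wlen_pos hk
      have h1 := one_le_wlen hk
      have h3 := norm_nl_le (summable_conv_term_l2 hn hn hx hD k)
      refine le_of_mul_le_mul_left ?_ hw
      have h4 : ‖f k‖ ≤ wlen k * ‖f k‖ := le_mul_of_one_le_left (norm_nonneg _) h1
      have h5 : ‖x' k‖ ≤ wlen k * ‖x' k‖ := le_mul_of_one_le_left (norm_nonneg _) h1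
      have := hpt k
      nlinarith
  · have hN := wlen_pow_mul_norm_nl_le hx hK hD
    have hf' := L2Bd.of_wlen_succ (by rw [hf0, norm_zero]) (fun k => norm_nonneg (f k)) hf
    have hP' := L2Bd.of_wlen_succ (by rw [hx'0, norm_zero]) (fun k => norm_nonneg (x' k)) hP
    refine (((hf'.add hP').add hN).mono fun k => ?_).mono_right (le_of_eq (by ring))
    have hw := pow_nonneg (wlen_nonneg k) s
    rw [abs_of_nonneg (mul_nonneg (pow_nonneg (wlen_nonneg k) _) (hn k)), ← mul_add, ← mul_add]
    calc _ = wlen k ^ s * (wlen k ^ 2 * ‖x k‖) := by ring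
      _ ≤ _ := mul_le_mul_of_nonneg_left (hpt k) hw

/-- The bounds for the higher norms. -/
noncomputable def normBound (δ K : ℝ) : ℕ → ℝ
  | 0 => K
  -- The two equal quotients are the Cauchy bounds for the force and for the time derivative; `δ /
  -- 2^(s+2)` is the difference of consecutive strip widths.
  | s + 1 => normBound δ K s / (δ / 2 ^ (s + 2)) + normBound δ K s / (δ / 2 ^ (s + 2))
      + 2 ^ s * (K * normBound δ K s)

theorem normBound_nonneg {δ K : ℝ} (hδ : 0 < δ) (hK : 0 ≤ K) : ∀ s, 0 ≤ normBound δ K s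
  | 0 => hK
  | s + 1 => by
    have := normBound_nonneg hδ hK s
    rw [normBound]
    positivity

theorem strip_mono {δ δ' : ℝ} (h : δ' ≤ δ) : strip δ' ⊆ strip δ := fun _ hζ => lt_of_lt_of_le hζ h

/-- Solutions extend holomorphically to a strip on which all norms are bounded, provided that `0`
lies on one of the bounded solutions. -/
theorem SeqSol.exists_smooth_extension (Γ : ℝ) : ∃ δ > 0, ∃ R : ℕ → ℝ, (∀ α, 0 ≤ R α) ∧
    ∀ (f : (Fin 2 → ℤ) → ℂ) (v : ℝ → Amp), f 0 = 0 → L2Bd (fun k => ‖f k‖) Γ →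
      SeqSol f v → (∀ t, ‖v t‖ ≤ Γ) → v 0 = 0 →
      ∀ a : ℝ → Amp, SeqSol f a → (∀ t, ‖a t‖ ≤ Γ) →
      ∃ U : ℂ → (Fin 2 → ℤ) → ℂ, (∀ (t : ℝ) k, U t k = a t k) ∧ ∀ ζ ∈ strip δ, U ζ 0 = 0 ∧
        (∀ α, L2Bd (fun k => wlen k ^ α * ‖U ζ k‖) (R α)) ∧
        ∀ k, HasDerivAt (fun z => U z k)
          (f k - (wlen k ^ 2 : ℝ) * U ζ k - nl (U ζ) (U ζ) k) ζ := by
  obtain ⟨δ, hδ, K₀, hK₀⟩ := SeqSol.exists_extension Γ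
  set K := max K₀ 0
  have hK0 : 0 ≤ K := le_max_right _ _
  refine ⟨δ / 2, by positivity, normBound δ K, normBound_nonneg hδ hK0,
    fun f v hf0 hf hv hvM hv0 a ha haM => ?_⟩
  -- The induction runs over all bounded solutions at once, because the bound for the force is
  -- obtained from `v` and then used for `a`.
  have hex := fun b : {b : ℝ → Amp // SeqSol f b ∧ ∀ t, ‖b t‖ ≤ Γ} =>
    hK₀ f b.1 b.2.1 hf0 hf b.2.2
  choose U hUr hU using hex
  -- The widths start at `δ` and decrease towards `δ/2`.
  set w : ℕ → ℝ := fun s => δ * (1 / 2 + 1 / 2 ^ (s + 1)) with hw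
  have hgap : ∀ s, w s - w (s + 1) = δ / 2 ^ (s + 2) := fun s => by
    simp only [hw]; field_simp; ring
  have hgap0 : ∀ s, w (s + 1) < w s := fun s => by
    rw [← sub_pos, hgap]; positivity
  have hw1 : ∀ s, w s ≤ δ := fun s => by
    have : (1 : ℝ) / 2 ^ (s + 1) ≤ 1 / 2 := by
      rw [pow_succ]
      have : (1 : ℝ) ≤ 2 ^ s := one_le_pow₀ one_le_two
      exact one_div_le_one_div_of_le (by norm_num) (by linarith)
    have h2 := mul_le_mul_of_nonneg_left this hδ.le
    simp only [hw]
    linarith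
  have hw2 : ∀ s, δ / 2 ≤ w s := fun s => by
    have : 0 ≤ δ * (1 / 2 ^ (s + 1)) := by positivity
    simp only [hw]
    linarith
  set x' : {b : ℝ → Amp // SeqSol f b ∧ ∀ t, ‖b t‖ ≤ Γ} → ℂ → (Fin 2 → ℤ) → ℂ := fun b ζ k =>
    f k - (wlen k ^ 2 : ℝ) * U b ζ k - nl (U b ζ) (U b ζ) k
  have hmain : ∀ s b, ∀ ζ ∈ strip (w s),
      L2Bd (fun k => wlen k ^ s * ‖U b ζ k‖) (normBound δ K s) := by
    intro s
    induction s with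
    | zero =>
      intro b ζ hζ
      obtain ⟨h1, h2, -⟩ := hU b ζ (strip_mono (hw1 0) hζ)
      simp only [pow_zero, one_mul]
      exact .of_l1 (fun k => norm_nonneg _) h1 (h2.trans (le_max_left _ _))
    | succ s ih =>
      have hder : ∀ b, ∀ ζ ∈ strip (w (s + 1)),
          L2Bd (fun k => wlen k ^ s * ‖x' b ζ k‖) (normBound δ K s / (δ / 2 ^ (s + 2))) := by
        intro b ζ hζ
        rw [← hgap]
        exact L2Bd.deriv_of_strip (hgap0 s) (ih b)
          (fun z hz => (hU b z (strip_mono (hw1 s) hz)).2.2.2) hζ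
      -- At time 0 the solution `v` vanishes, so its time derivative there is the force itself,
      -- which thus inherits the regularity of time derivatives.
      have hfs : L2Bd (fun k => wlen k ^ s * ‖f k‖) (normBound δ K s / (δ / 2 ^ (s + 2))) := by
        have h0 : (0 : ℂ) ∈ strip (w (s + 1)) := by
          have := (half_pos hδ).trans_le (hw2 (s + 1))
          simpa [strip] using this
        have h1 := hder ⟨v, hv, hvM⟩ 0 h0
        have h2 : U ⟨v, hv, hvM⟩ 0 = 0 := by
          funext k
          have := hUr ⟨v, hv, hvM⟩ 0 k
          rw [Complex.ofReal_zero] at this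
          rw [this]
          change v 0 k = 0
          rw [hv0]
          rfl
        have h3 : x' ⟨v, hv, hvM⟩ 0 = f := by
          funext k
          simp [x', h2, nl]
        rwa [h3] at h1
      intro b ζ hζ
      obtain ⟨h1, h2, h3, -⟩ := hU b ζ (strip_mono (hw1 (s + 1)) hζ)
      exact l2Bd_wlen_succ s h3 hf0 (fun k => rfl) h1 (h2.trans (le_max_left _ _))
        (ih b ζ (strip_mono (hgap0 s).le hζ)) hfs (hder b ζ hζ)
  refine ⟨U ⟨a, ha, haM⟩, hUr ⟨a, ha, haM⟩, fun ζ hζ => ?_⟩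
  obtain ⟨-, -, h3, h4⟩ := hU ⟨a, ha, haM⟩ ζ (strip_mono (by linarith) hζ)
  exact ⟨h3, fun s => hmain s _ ζ (strip_mono (hw2 s) hζ), h4⟩

end NSE2D

namespace NSE2D

open Set Filter Topology ComplexConjugate

/-! ### Fourier coefficients of square-integrable fields -/

variable {L : ℝ}

theorem character_add (k l : Fin 2 → ℤ) (x : Torus L) :
    character L (k + l) x = character L k x * character L l x := by
  simp [character, fourier_apply, add_smul, AddCircle.toCircle_add, Finset.prod_mul_distrib]

theorem character_neg (k : Fin 2 → ℤ) (x : Torus L) :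
    character L (-k) x = conj (character L k x) := by
  simp [character]

theorem norm_character (k : Fin 2 → ℤ) (x : Torus L) : ‖character L k x‖ = 1 := by
  simp only [character, ContinuousMap.coe_mk, norm_prod, fourier_apply, Circle.norm_coe,
    Finset.prod_const_one]

variable [hL : Fact (0 < L)]

theorem integral_fourier (n : ℤ) :
    ∫ x : AddCircle L, fourier n x = if n = 0 then (L : ℂ) else 0 := by
  split_ifs with h
  · subst h
    simp [hL.out.le, Measure.real, AddCircle.measure_univ]
  · refine integral_eq_zero_of_add_right_eq_neg (μ := volume)
      (fourier_add_half_inv_index h hL.out)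

theorem integral_character (k : Fin 2 → ℤ) :
    ∫ x : Torus L, character L k x = if k = 0 then (L : ℂ) ^ 2 else 0 := by
  have h : ∫ x : Torus L, character L k x = ∏ i, ∫ x : AddCircle L, fourier (k i) x :=
    integral_fintype_prod_volume_eq_prod (fun i (x : AddCircle L) => (fourier (k i) x : ℂ))
  rw [h]
  split_ifs with hk
  · simp only [integral_fourier, hk]
    simp [sq]
  · obtain ⟨i, hi⟩ := Function.ne_iff.1 hk
    exact Finset.prod_eq_zero (Finset.mem_univ i) (by rw [integral_fourier]; exact if_neg hi)

theorem field_integrable (u : Field L) : Integrable (fun x => u x) (volume : Measure (Torus L)) :=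
  (Lp.memLp u).integrable (by norm_num)

theorem character_smul_integrable (k : Fin 2 → ℤ) {f : Torus L → Vec} (hf : Integrable f) :
    Integrable (fun x => conj (character L k x) • f x) := by
  refine hf.mono ?_ ?_
  · refine AEStronglyMeasurable.smul (f := fun x => conj (character L k x)) ?_ hf.1
    have h : Continuous fun x : Torus L => conj (character L k x) := by fun_prop
    exact h.aestronglyMeasurable
  · filter_upwards with x
    rw [norm_smul, RCLike.norm_conj, norm_character, one_mul]

theorem coeFn_mode (k : Fin 2 → ℤ) (a : Vec) :
    ∀ᵐ x : Torus L, mode L k a x = character L k x • a :=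
  ContinuousMap.coeFn_toLp (volume : Measure (Torus L)) _

theorem inner_mode_left (k : Fin 2 → ℤ) (a : Vec) (u : Field L) :
    inner ℂ (mode L k a) u = (L : ℂ) ^ 2 * inner ℂ a (coeff L u k) := by
  have hL0 : (L : ℂ) ≠ 0 := by exact_mod_cast hL.out.ne'
  rw [coeff, inner_smul_right, mul_inv_cancel_left₀ (pow_ne_zero 2 hL0), L2.inner_def]
  have h := ContinuousLinearMap.integral_comp_comm (innerSL ℂ a)
    (character_smul_integrable k (field_integrable u))
  simp only [innerSL_apply_apply] at h
  rw [← h]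
  refine integral_congr_ae ?_
  filter_upwards [coeFn_mode k a] with x hx
  rw [hx, inner_smul_left, inner_smul_right]

theorem mode_add (k : Fin 2 → ℤ) (a b : Vec) : mode L k (a + b) = mode L k a + mode L k b := by
  rw [mode, mode, mode, ← map_add]
  congr 1
  ext x : 1
  simp

theorem mode_smul (k : Fin 2 → ℤ) (c : ℂ) (a : Vec) : mode L k (c • a) = c • mode L k a := by
  rw [mode, mode, ← map_smul]
  congr 1
  ext x : 1
  simp [smul_comm c]

theorem mode_zero (k : Fin 2 → ℤ) : mode L k 0 = 0 := by
  have := mode_smul (L := L) k 0 0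
  simpa using this

theorem coeff_mode (k l : Fin 2 → ℤ) (a : Vec) :
    coeff L (mode L l a) k = if l = k then a else 0 := by
  have hL0 : (L : ℂ) ≠ 0 := by exact_mod_cast hL.out.ne'
  have h : ∫ x : Torus L, conj (character L k x) • mode L l a x
      = ∫ x : Torus L, character L (l - k) x • a := by
    refine integral_congr_ae ?_
    filter_upwards [coeFn_mode l a] with x hx
    rw [hx, smul_smul, ← character_neg, ← character_add, neg_add_eq_sub]
  rw [coeff, h, integral_smul_const, integral_character]
  by_cases hkl : l = k
  · simp [hkl, smul_smul, hL0]
  · simp [hkl, sub_eq_zero]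

theorem coeff_unique {u : Field L} {k : Fin 2 → ℤ} {b : Vec}
    (h : ∀ a : Vec, inner ℂ (mode L k a) u = (L : ℂ) ^ 2 * inner ℂ a b) : coeff L u k = b := by
  have hL0 : (L : ℂ) ^ 2 ≠ 0 := by exact_mod_cast (pow_pos hL.out 2).ne'
  refine ext_inner_left ℂ fun a => ?_
  have := h a
  rw [inner_mode_left] at this
  exact mul_left_cancel₀ hL0 this

theorem coeff_add (u v : Field L) (k : Fin 2 → ℤ) :
    coeff L (u + v) k = coeff L u k + coeff L v k :=
  coeff_unique fun a => by
    rw [inner_add_right, inner_mode_left, inner_mode_left, inner_add_right, mul_add]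

theorem coeff_smul (c : ℂ) (u : Field L) (k : Fin 2 → ℤ) :
    coeff L (c • u) k = c • coeff L u k :=
  coeff_unique fun a => by
    rw [inner_smul_right, inner_mode_left, inner_smul_right]; ring

theorem norm_mode (k : Fin 2 → ℤ) (a : Vec) : ‖mode L k a‖ = L * ‖a‖ := by
  have h : inner ℂ (mode L k a) (mode L k a) = (L : ℂ) ^ 2 * inner ℂ a a := by
    rw [inner_mode_left, coeff_mode, if_pos rfl]
  rw [inner_self_eq_norm_sq_to_K, inner_self_eq_norm_sq_to_K] at h
  have h' : ‖mode L k a‖ ^ 2 = (L * ‖a‖) ^ 2 := by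
    rw [mul_pow]
    apply Complex.ofReal_injective
    push_cast
    exact h
  exact (sq_eq_sq₀ (norm_nonneg _) (mul_nonneg hL.out.le (norm_nonneg _))).1 h'

/-- The isometric embeddings `a ↦ L⁻¹ exp (i κ₀ k · x) a`. -/
noncomputable def unitMode (L : ℝ) [hL : Fact (0 < L)] (k : Fin 2 → ℤ) : Vec →ₗᵢ[ℂ] Field L where
  toFun a := mode L k ((L : ℂ)⁻¹ • a)
  map_add' a b := by rw [smul_add, mode_add]
  map_smul' c a := by simp only [smul_comm _ c, RingHom.id_apply, mode_smul k c]
  norm_map' a := by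
    have h0 := hL.out
    change ‖mode L k ((L : ℂ)⁻¹ • a)‖ = ‖a‖
    rw [norm_mode, norm_smul, norm_inv, Complex.norm_real, Real.norm_of_nonneg h0.le,
      mul_inv_cancel_left₀ h0.ne']

theorem mode_eq_unitMode (k : Fin 2 → ℤ) (a : Vec) :
    mode L k a = unitMode L k ((L : ℂ) • a) := by
  have hL0 : (L : ℂ) ≠ 0 := by exact_mod_cast hL.out.ne'
  change _ = mode L k ((L : ℂ)⁻¹ • (L : ℂ) • a)
  rw [inv_smul_smul₀ hL0]

theorem orthogonalFamily_unitMode :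
    OrthogonalFamily ℂ (fun _ : Fin 2 → ℤ => Vec) (unitMode L) := by
  intro k l hkl a b
  change inner ℂ (mode L k _) (mode L l _) = 0
  rw [inner_mode_left, coeff_mode, if_neg hkl.symm, inner_zero_right, mul_zero]

theorem norm_sum_mode_sq (s : Finset (Fin 2 → ℤ)) (c : (Fin 2 → ℤ) → Vec) :
    ‖∑ k ∈ s, mode L k (c k)‖ ^ 2 = L ^ 2 * ∑ k ∈ s, ‖c k‖ ^ 2 := by
  simp only [mode_eq_unitMode]
  rw [orthogonalFamily_unitMode.norm_sum (fun k => (L : ℂ) • c k) s, Finset.mul_sum]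
  refine Finset.sum_congr rfl fun k _ => ?_
  rw [norm_smul, mul_pow, Complex.norm_real, Real.norm_eq_abs, sq_abs]

theorem summable_mode_iff (c : (Fin 2 → ℤ) → Vec) :
    Summable (fun k => mode L k (c k)) ↔ Summable fun k => ‖c k‖ ^ 2 := by
  simp only [mode_eq_unitMode]
  rw [orthogonalFamily_unitMode.summable_iff_norm_sq_summable (fun k => (L : ℂ) • c k)]
  have : (fun k => ‖(L : ℂ) • c k‖ ^ 2) = fun k => L ^ 2 * ‖c k‖ ^ 2 := by
    ext k
    rw [norm_smul, mul_pow, Complex.norm_real, Real.norm_eq_abs, sq_abs]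
  rw [this, summable_mul_left_iff (pow_pos hL.out 2).ne']

theorem norm_tsum_mode_le {c : (Fin 2 → ℤ) → Vec} {C : ℝ} (h : L2Bd (fun k => ‖c k‖) C) :
    ‖∑' k, mode L k (c k)‖ ≤ L * C := by
  have hs := ((summable_mode_iff (L := L) c).2 h.summable).hasSum
  refine le_of_tendsto hs.norm (Eventually.of_forall fun s => ?_)
  refine abs_le_of_sq_le_sq' ?_ (mul_nonneg hL.out.le h.1) |>.2
  rw [norm_sum_mode_sq, mul_pow]
  exact mul_le_mul_of_nonneg_left (h.2 s) (sq_nonneg _)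

theorem coeff_zero_field (k : Fin 2 → ℤ) : coeff L (0 : Field L) k = 0 := by
  simpa using coeff_smul (L := L) 0 0 k

theorem coeff_sum {ι : Type*} (s : Finset ι) (f : ι → Field L) (k : Fin 2 → ℤ) :
    coeff L (∑ i ∈ s, f i) k = ∑ i ∈ s, coeff L (f i) k := by
  classical
  induction s using Finset.induction_on with
  | empty => simp [coeff_zero_field]
  | insert i s hi ih => rw [Finset.sum_insert hi, Finset.sum_insert hi, coeff_add, ih]

/-- Bessel's inequality: the partial sum `p` satisfies `(p, u) = ‖p‖²`, hence `‖p‖ ≤ ‖u‖`. -/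
theorem l2Bd_coeff (u : Field L) : L2Bd (fun k => ‖coeff L u k‖) (‖u‖ / L) := by
  have h0 := hL.out
  refine ⟨by positivity, fun s => ?_⟩
  set p : Field L := ∑ k ∈ s, mode L k (coeff L u k) with hp
  have h1 : inner ℂ p u = ((L ^ 2 * ∑ k ∈ s, ‖coeff L u k‖ ^ 2 : ℝ) : ℂ) := by
    rw [hp, sum_inner]
    push_cast
    rw [Finset.mul_sum]
    refine Finset.sum_congr rfl fun k _ => ?_
    rw [inner_mode_left, inner_self_eq_norm_sq_to_K]
    rfl
  have h2 := norm_sum_mode_sq (L := L) s (coeff L u)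
  have h3 := norm_inner_le_norm (𝕜 := ℂ) p u
  have hnn : 0 ≤ L ^ 2 * ∑ k ∈ s, ‖coeff L u k‖ ^ 2 := by positivity
  rw [h1, Complex.norm_real, Real.norm_of_nonneg hnn] at h3
  rw [← hp] at h2
  rw [← h2] at h3
  have h4 : ‖p‖ ≤ ‖u‖ := by
    rcases (norm_nonneg p).eq_or_lt with h | h
    · rw [← h]; exact norm_nonneg u
    · rw [sq] at h3; exact le_of_mul_le_mul_left h3 h
  rw [div_pow, le_div_iff₀ (by positivity), mul_comm, ← h2]
  exact pow_le_pow_left₀ (norm_nonneg _) h4 2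

/-- The Fourier coefficient as a continuous linear map. -/
noncomputable def coeffCLM (L : ℝ) [Fact (0 < L)] (k : Fin 2 → ℤ) : Field L →L[ℂ] Vec :=
  LinearMap.mkContinuous
    { toFun := fun u => coeff L u k
      map_add' := fun u v => coeff_add u v k
      map_smul' := fun c u => coeff_smul c u k } L⁻¹ fun u => by
    have := (l2Bd_coeff u).abs_le k
    rw [abs_norm] at this
    rwa [mul_comm, ← div_eq_mul_inv]

theorem coeffCLM_apply (k : Fin 2 → ℤ) (u : Field L) : coeffCLM L k u = coeff L u k := rfl

theorem coeff_tsum_mode {c : (Fin 2 → ℤ) → Vec} (h : Summable fun k => ‖c k‖ ^ 2)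
    (k : Fin 2 → ℤ) : coeff L (∑' l, mode L l (c l)) k = c k := by
  have hs := (summable_mode_iff (L := L) c).2 h
  rw [← coeffCLM_apply, (coeffCLM L k).map_tsum hs, tsum_eq_single k]
  · rw [coeffCLM_apply, coeff_mode, if_pos rfl]
  · intro l hl
    rw [coeffCLM_apply, coeff_mode, if_neg hl]

end NSE2D

namespace NSE2D

open Set Filter Topology ComplexConjugate

/-! ### Divergence-free fields and their amplitudes -/

/-- The unit vector spanning the divergence-free amplitudes with wave vector `k ≠ 0`; it is zero
for `k = 0`. -/
noncomputable def evec (k : Fin 2 → ℤ) : Vec :=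
  !₂[-(Complex.I * (k 1 : ℂ) / (wlen k : ℂ)), Complex.I * (k 0 : ℂ) / (wlen k : ℂ)]

theorem evec_apply_zero (k : Fin 2 → ℤ) :
    evec k 0 = -(Complex.I * (k 1 : ℂ) / (wlen k : ℂ)) := rfl

theorem evec_apply_one (k : Fin 2 → ℤ) :
    evec k 1 = Complex.I * (k 0 : ℂ) / (wlen k : ℂ) := rfl

theorem evec_zero : evec 0 = 0 := by
  ext i
  fin_cases i <;> simp [evec]

/-- The factor `i` in `evec` compensates the sign change of `k`, so real fields have amplitudes with
`a(-k) = conj (a k)`. -/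
theorem evec_neg_apply (k : Fin 2 → ℤ) (i : Fin 2) : conj (evec k i) = evec (-k) i := by
  fin_cases i <;> simp [evec, wlen_neg, neg_div]

theorem dot_evec (k : Fin 2 → ℤ) : ∑ i, (k i : ℂ) * evec k i = 0 := by
  rw [Fin.sum_univ_two, evec_apply_zero, evec_apply_one]
  ring

theorem inner_vec (a b : Vec) : inner ℂ a b = conj (a 0) * b 0 + conj (a 1) * b 1 := by
  rw [PiLp.inner_apply, Fin.sum_univ_two]
  simp [mul_comm]

theorem inner_evec_evec (k m : Fin 2 → ℤ) :
    inner ℂ (evec k) (evec m) = ((wdot k m / (wlen k * wlen m) : ℝ) : ℂ) := by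
  rw [inner_vec]
  simp only [evec_apply_zero, evec_apply_one, wdot, map_neg, map_div₀, map_mul, Complex.conj_I,
    Complex.conj_ofReal, map_intCast, Complex.ofReal_div, Complex.ofReal_mul,
    Complex.ofReal_add, Complex.ofReal_intCast]
  simp only [div_eq_mul_inv, mul_inv]
  linear_combination (-((k 0 : ℂ) * m 0 + k 1 * m 1) * (wlen k : ℂ)⁻¹ * (wlen m : ℂ)⁻¹)
    * Complex.I_mul_I

theorem evec_dot (l m : Fin 2 → ℤ) :
    ∑ j, evec l j * (Complex.I * (m j : ℂ)) = ((-(cross l m) / wlen l : ℝ) : ℂ) := by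
  rw [Fin.sum_univ_two, evec_apply_zero, evec_apply_one]
  simp only [cross, Complex.ofReal_div, Complex.ofReal_neg, Complex.ofReal_sub, Complex.ofReal_mul,
    Complex.ofReal_intCast]
  simp only [div_eq_mul_inv]
  linear_combination ((l 0 : ℂ) * m 1 - l 1 * m 0) * (wlen l : ℂ)⁻¹ * Complex.I_mul_I

theorem norm_evec {k : Fin 2 → ℤ} (hk : k ≠ 0) : ‖evec k‖ = 1 := by
  have h := inner_evec_evec k k
  rw [inner_self_eq_norm_sq_to_K] at h
  have hw := wlen_pos hk
  have h1 : wdot k k = wlen k * wlen k := by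
    rw [← sq, wlen_sq, wdot]; ring
  rw [h1, div_self (mul_pos hw hw).ne'] at h
  have h' : ‖evec k‖ ^ 2 = 1 := by
    apply Complex.ofReal_injective
    push_cast
    simpa using h
  exact (pow_eq_one_iff_of_nonneg (norm_nonneg _) two_ne_zero).1 h'

theorem norm_evec_le (k : Fin 2 → ℤ) : ‖evec k‖ ≤ 1 := by
  by_cases hk : k = 0
  · rw [hk, evec_zero, norm_zero]; exact zero_le_one
  · exact (norm_evec hk).le

theorem eq_inner_smul_evec {k : Fin 2 → ℤ} (hk : k ≠ 0) {a : Vec}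
    (h : ∑ i, (k i : ℂ) * a i = 0) : a = inner ℂ (evec k) a • evec k := by
  have hw : (wlen k : ℂ) ≠ 0 := by exact_mod_cast (wlen_pos hk).ne'
  have hsq : (wlen k : ℂ) ^ 2 = (k 0 : ℂ) ^ 2 + (k 1 : ℂ) ^ 2 := by
    exact_mod_cast wlen_sq k
  rw [Fin.sum_univ_two] at h
  have hI : Complex.I ^ 2 = -1 := Complex.I_sq
  ext i
  rw [inner_vec]
  fin_cases i
  · change a 0 = _ * evec k 0
    simp only [evec_apply_zero, evec_apply_one, map_neg, map_div₀, map_mul, Complex.conj_I,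
      Complex.conj_ofReal, map_intCast]
    field_simp
    linear_combination (a 0) * hsq + (a 0 * (k 1 : ℂ) ^ 2 - a 1 * k 1 * k 0) * hI + (k 0 : ℂ) * h
  · change a 1 = _ * evec k 1
    simp only [evec_apply_zero, evec_apply_one, map_neg, map_div₀, map_mul, Complex.conj_I,
      Complex.conj_ofReal, map_intCast]
    field_simp
    linear_combination (a 1) * hsq + (a 1 * (k 0 : ℂ) ^ 2 - a 0 * k 1 * k 0) * hI + (k 1 : ℂ) * h

variable {L : ℝ} [hL : Fact (0 < L)]

/-- The divergence-free amplitude of the Fourier coefficient of wave vector `k`. -/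
noncomputable def rho (L : ℝ) [Fact (0 < L)] (u : Field L) (k : Fin 2 → ℤ) : ℂ :=
  inner ℂ (evec k) (coeff L u k)

theorem rho_zero_mode (u : Field L) : rho L u 0 = 0 := by
  rw [rho, evec_zero, inner_zero_left]

theorem rho_add (u v : Field L) (k : Fin 2 → ℤ) : rho L (u + v) k = rho L u k + rho L v k := by
  rw [rho, coeff_add, inner_add_right]; rfl

theorem rho_smul (c : ℂ) (u : Field L) (k : Fin 2 → ℤ) : rho L (c • u) k = c * rho L u k := by
  rw [rho, coeff_smul, inner_smul_right]; rfl

theorem rho_sub (u v : Field L) (k : Fin 2 → ℤ) : rho L (u - v) k = rho L u k - rho L v k := by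
  rw [sub_eq_add_neg, ← neg_one_smul ℂ v, rho_add, rho_smul]; ring

theorem norm_rho_le (u : Field L) (k : Fin 2 → ℤ) : ‖rho L u k‖ ≤ ‖coeff L u k‖ := by
  refine (norm_inner_le_norm _ _).trans ?_
  exact mul_le_of_le_one_left (norm_nonneg _) (norm_evec_le k)

theorem l2Bd_rho (u : Field L) : L2Bd (fun k => ‖rho L u k‖) (‖u‖ / L) :=
  (l2Bd_coeff u).mono fun k => by rw [abs_norm]; exact norm_rho_le u k

/-- The amplitudes as a continuous linear map into `ℓ²`. -/
noncomputable def rhoCLM (L : ℝ) [Fact (0 < L)] : Field L →L[ℂ] Amp :=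
  LinearMap.mkContinuous
    { toFun := fun u => (l2Bd_rho u).toAmp
      map_add' := fun u v => by
        ext k
        exact rho_add u v k
      map_smul' := fun c u => by
        ext k
        exact rho_smul c u k } L⁻¹ fun u => by
    refine (Amp.norm_le_of_l2Bd (C := ‖u‖ / L) ?_).trans_eq (by rw [mul_comm, ← div_eq_mul_inv])
    exact l2Bd_rho u

theorem mode_pair_mem (k : Fin 2 → ℤ) (hk : k ≠ 0) (z : ℂ) :
    mode L k (z • evec k) + mode L (-k) (conj z • evec (-k)) ∈ realTrigPoly L := by
  classical
  have hkk : -k ≠ k := by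
    intro h
    refine hk (funext fun i => ?_)
    have := congrFun h i
    simp only [Pi.neg_apply] at this
    simp only [Pi.zero_apply]
    omega
  refine ⟨Finsupp.single k (z • evec k) + Finsupp.single (-k) (conj z • evec (-k)), ?_, ?_, ?_, ?_⟩
  · intro m i
    by_cases h1 : m = k
    · subst h1
      simp [hkk, hkk.symm, evec_neg_apply]
    · by_cases h2 : m = -k
      · subst h2
        simp [hkk, hkk.symm, evec_neg_apply]
      · have h3 : k ≠ -m := fun h => h2 (by rw [h, neg_neg])
        have h4 : -k ≠ -m := fun h => h1 (neg_injective h).symm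
        have h5 : k ≠ m := fun h => h1 h.symm
        have h6 : -k ≠ m := fun h => h2 h.symm
        simp [h3, h5, h6]
  · intro m
    have e (l : Fin 2 → ℤ) (w : ℂ) :
        ∑ i, (m i : ℂ) * (Finsupp.single l (w • evec l) m : Vec) i = 0 := by
      by_cases h : l = m
      · subst h
        have := dot_evec l
        rw [Fin.sum_univ_two] at this ⊢
        simp only [Finsupp.single_eq_same, PiLp.smul_apply, smul_eq_mul]
        linear_combination w * this
      · simp [h]
    have h1 := e k z
    have h2 := e (-k) (conj z)
    simp only [Finsupp.add_apply, PiLp.add_apply, mul_add, Finset.sum_add_distrib]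
    rw [h1, h2, add_zero]
  · simp [hk]
  · rw [Finsupp.sum_add_index' (fun k => mode_zero k) (fun k => mode_add k),
      Finsupp.sum_single_index (mode_zero k), Finsupp.sum_single_index (mode_zero (-k))]

/-- If `P(z)` is the real field built from the modes `±k`, then `P(1) - i P(i)` is twice the single
mode `k`. -/
theorem mode_evec_mem_HC (k : Fin 2 → ℤ) (c : ℂ) : mode L k (c • evec k) ∈ HC L := by
  by_cases hk : k = 0
  · rw [hk, evec_zero, smul_zero, mode_zero]; exact zero_mem _
  have hmem : ∀ z : ℂ, mode L k (z • evec k) + mode L (-k) (conj z • evec (-k)) ∈ HC L :=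
    fun z => Submodule.le_topologicalClosure _
      (Submodule.subset_span (subset_closure (mode_pair_mem k hk z)))
  have h1 := hmem 1
  have h2 := (HC L).smul_mem (-Complex.I) (hmem Complex.I)
  have h3 := (HC L).smul_mem (c / 2) ((HC L).add_mem h1 h2)
  convert h3 using 1
  simp only [map_one, one_smul, Complex.conj_I, mode_smul, smul_add, smul_smul]
  have e1 : c / 2 * (-Complex.I * Complex.I) = c / 2 := by
    rw [neg_mul, Complex.I_mul_I]; ring
  have e2 : c / 2 * (-Complex.I * -Complex.I) = -(c / 2) := by
    rw [neg_mul_neg, Complex.I_mul_I]; ring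
  rw [e1, e2]
  have e3 : c • mode L k (evec k) = (c / 2) • mode L k (evec k) + (c / 2) • mode L k (evec k) := by
    rw [← add_smul, add_halves]
  rw [e3, neg_smul]
  abel

theorem coeff_realTrigPoly {u : Field L} (hu : u ∈ realTrigPoly L) :
    (∀ k i, conj (coeff L u k i) = coeff L u (-k) i) ∧
      ∀ k, coeff L u k = rho L u k • evec k := by
  obtain ⟨a, h1, h2, h3, rfl⟩ := hu
  have hc : ∀ k, coeff L (a.sum fun k c => mode L k c) k = a k := by
    intro k
    rw [Finsupp.sum, coeff_sum]
    simp only [coeff_mode]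
    rw [Finset.sum_ite_eq' a.support k (fun k => a k)]
    split_ifs with h
    · rfl
    · exact (Finsupp.notMem_support_iff.1 h).symm
  refine ⟨fun k i => by rw [hc, hc, h1], fun k => ?_⟩
  rw [rho, hc]
  by_cases hk : k = 0
  · rw [hk, h3, evec_zero, smul_zero]
  · exact eq_inner_smul_evec hk (h2 k)

theorem coeff_conj_of_mem_H {u : Field L} (hu : u ∈ H L) (k : Fin 2 → ℤ) (i : Fin 2) :
    conj (coeff L u k i) = coeff L u (-k) i := by
  have hcl : IsClosed {u : Field L | conj (coeffCLM L k u i) = coeffCLM L (-k) u i} := by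
    have hi (l : Fin 2 → ℤ) : Continuous fun u : Field L => coeffCLM L l u i :=
      (EuclideanSpace.proj (𝕜 := ℂ) i).continuous.comp (coeffCLM L l).continuous
    exact isClosed_eq (Complex.continuous_conj.comp (hi k)) (hi (-k))
  exact hcl.closure_subset_iff.2 (fun v hv => (coeff_realTrigPoly hv).1 k i) hu

/-- The fields with vanishing divergence and mean. -/
noncomputable def divFree (L : ℝ) [Fact (0 < L)] : Submodule ℂ (Field L) where
  carrier := {u | ∀ k, coeff L u k = rho L u k • evec k}
  add_mem' := fun {u v} hu hv k => by rw [coeff_add, rho_add, add_smul, hu k, hv k]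
  zero_mem' := fun k => by rw [rho, coeff_zero_field, inner_zero_right, zero_smul]
  smul_mem' := fun c u hu k => by rw [coeff_smul, rho_smul, mul_smul, ← hu k]

theorem coeff_eq_rho_smul {u : Field L} (hu : u ∈ HC L) (k : Fin 2 → ℤ) :
    coeff L u k = rho L u k • evec k := by
  have hcl : IsClosed (divFree L : Set (Field L)) := by
    have : (divFree L : Set (Field L))
        = ⋂ k, {u | coeffCLM L k u = (inner ℂ (evec k) (coeffCLM L k u) : ℂ) • evec k} := by
      ext u
      simp only [mem_iInter]
      rfl
    rw [this]
    refine isClosed_iInter fun k => isClosed_eq (coeffCLM L k).continuous ?_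
    have h : Continuous fun u : Field L => (inner ℂ (evec k) (coeffCLM L k u) : ℂ) :=
      continuous_const.inner (coeffCLM L k).continuous
    exact h.smul continuous_const
  have hle : HC L ≤ divFree L := by
    refine Submodule.topologicalClosure_minimal _ (Submodule.span_le.2 ?_) hcl
    exact hcl.closure_subset_iff.2 fun v hv => (coeff_realTrigPoly hv).2
  exact hle hu k

theorem H_subset_HC : H L ⊆ HC L := fun _ hu =>
  Submodule.le_topologicalClosure _ (Submodule.subset_span hu)

theorem rho_neg_of_mem_H {u : Field L} (hu : u ∈ H L) (k : Fin 2 → ℤ) :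
    rho L u (-k) = conj (rho L u k) := by
  rw [rho, rho, inner_vec, inner_vec]
  simp only [← coeff_conj_of_mem_H hu, ← evec_neg_apply, map_add, map_mul]

theorem isClosed_HC : IsClosed (HC L : Set (Field L)) := Submodule.isClosed_topologicalClosure _

theorem tsum_mem_HC {ι : Type*} {f : ι → Field L} (h : ∀ i, f i ∈ HC L) : ∑' i, f i ∈ HC L := by
  by_cases hf : Summable f
  · exact isClosed_HC.mem_of_tendsto hf.hasSum
      (Eventually.of_forall fun s => Submodule.sum_mem _ fun i _ => h i)
  · rw [tsum_eq_zero_of_not_summable hf]; exact zero_mem _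

/-- The difference has zero Fourier coefficients, so it is orthogonal to the trigonometric
polynomials, hence to all of `HC L`, and so to itself. -/
theorem eq_of_rho_eq {u v : Field L} (hu : u ∈ HC L) (hv : v ∈ HC L)
    (h : ∀ k, rho L u k = rho L v k) : u = v := by
  rw [← sub_eq_zero]
  set d := u - v with hd
  have hdm : d ∈ HC L := (HC L).sub_mem hu hv
  have hc : ∀ k, coeff L d k = 0 := fun k => by
    rw [coeff_eq_rho_smul hdm, hd, rho_sub, h k, sub_self, zero_smul]
  have hle : HC L ≤ (Submodule.span ℂ {d})ᗮ := by
    refine Submodule.topologicalClosure_minimal _ (Submodule.span_le.2 ?_)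
      (Submodule.isClosed_orthogonal _)
    refine (Submodule.isClosed_orthogonal _).closure_subset_iff.2 ?_
    rintro w ⟨a, -, -, -, rfl⟩
    refine Submodule.sum_mem _ fun k _ => ?_
    rw [Submodule.mem_orthogonal_singleton_iff_inner_left, inner_mode_left, hc, inner_zero_right,
      mul_zero]
  have := (Submodule.mem_orthogonal_singleton_iff_inner_left).1 (hle hdm)
  exact inner_self_eq_zero.1 this

theorem rho_leray (f : Field L) (k : Fin 2 → ℤ) : rho L (leray L f) k = rho L f k := by
  have : CompleteSpace (HC L) := Submodule.topologicalClosure.completeSpace _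
  have hL0 : (L : ℂ) ^ 2 ≠ 0 := by exact_mod_cast (pow_pos hL.out 2).ne'
  have hm : mode L k (evec k) ∈ HC L := by simpa using mode_evec_mem_HC (L := L) k 1
  have h : inner ℂ (mode L k (evec k)) (leray L f) = inner ℂ (mode L k (evec k)) f := by
    rw [leray, ← Submodule.inner_starProjection_left_eq_right,
      Submodule.starProjection_eq_self_iff.2 hm]
  rw [inner_mode_left, inner_mode_left] at h
  exact mul_left_cancel₀ hL0 h

theorem leray_mem_HC (f : Field L) : leray L f ∈ HC L := by
  have : CompleteSpace (HC L) := Submodule.topologicalClosure.completeSpace _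
  exact Submodule.starProjection_apply_mem _ _

/-- The divergence-free field with amplitudes `c`. -/
noncomputable def synth (L : ℝ) [Fact (0 < L)] (c : (Fin 2 → ℤ) → ℂ) : Field L :=
  ∑' k, mode L k (c k • evec k)

theorem synth_mem_HC (c : (Fin 2 → ℤ) → ℂ) : synth L c ∈ HC L :=
  tsum_mem_HC fun k => mode_evec_mem_HC k (c k)

theorem L2Bd.smul_evec {c : (Fin 2 → ℤ) → ℂ} {C : ℝ} (h : L2Bd (fun k => ‖c k‖) C) :
    L2Bd (fun k => ‖c k • evec k‖) C :=
  h.mono fun k => by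
    rw [abs_norm, norm_smul]
    exact mul_le_of_le_one_right (norm_nonneg _) (norm_evec_le k)

theorem rho_synth {c : (Fin 2 → ℤ) → ℂ} {C : ℝ} (h : L2Bd (fun k => ‖c k‖) C) (h0 : c 0 = 0)
    (k : Fin 2 → ℤ) : rho L (synth L c) k = c k := by
  rw [rho, synth, coeff_tsum_mode h.smul_evec.summable, inner_smul_right]
  by_cases hk : k = 0
  · rw [hk, h0, zero_mul]
  · rw [inner_self_eq_norm_sq_to_K, norm_evec hk]
    simp

theorem norm_synth_le {c : (Fin 2 → ℤ) → ℂ} {C : ℝ} (h : L2Bd (fun k => ‖c k‖) C) :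
    ‖synth L c‖ ≤ L * C :=
  norm_tsum_mode_le h.smul_evec

theorem synth_rho {u : Field L} (hu : u ∈ HC L) : synth L (rho L u) = u :=
  eq_of_rho_eq (synth_mem_HC _) hu (rho_synth (l2Bd_rho u) (rho_zero_mode u))

theorem kappa_pos : 0 < kappa L := div_pos Real.two_pi_pos hL.out

theorem eigenvalue_rpow (α : ℕ) (k : Fin 2 → ℤ) :
    eigenvalue L k ^ ((α : ℝ) / 2) = kappa L ^ α * wlen k ^ α := by
  have h : eigenvalue L k = (kappa L * wlen k) ^ (2 : ℝ) := by
    rw [eigenvalue, Fin.sum_univ_two, ← wlen_sq, ← mul_pow]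
    norm_cast
  rw [h, ← Real.rpow_mul (mul_nonneg kappa_pos.le (wlen_nonneg k)),
    mul_div_cancel₀ _ two_ne_zero, Real.rpow_natCast, mul_pow]

theorem powTerm_eq {u : Field L} (hu : u ∈ HC L) (σ : ℝ) (k : Fin 2 → ℤ) :
    powTerm L σ u k = mode L k ((((eigenvalue L k ^ σ : ℝ) : ℂ) * rho L u k) • evec k) := by
  rw [powTerm, coeff_eq_rho_smul hu, smul_smul]

theorem stokesPow_eq_synth {u : Field L} (hu : u ∈ HC L) (σ : ℝ) :
    stokesPow L σ u = synth L fun k => ((eigenvalue L k ^ σ : ℝ) : ℂ) * rho L u k := by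
  rw [stokesPow, synth]
  exact tsum_congr fun k => powTerm_eq hu σ k

theorem mem_stokesDom_iff {u : Field L} (hu : u ∈ HC L) (σ : ℝ) :
    u ∈ stokesDom L σ ↔ ∃ C, L2Bd (fun k => ‖((eigenvalue L k ^ σ : ℝ) : ℂ) * rho L u k‖) C := by
  have h1 : u ∈ stokesDom L σ ↔ Summable (powTerm L σ u) := ⟨fun h => h.2, fun h => ⟨hu, h⟩⟩
  have h2 : powTerm L σ u
      = fun k => mode L k ((((eigenvalue L k ^ σ : ℝ) : ℂ) * rho L u k) • evec k) :=
    funext (powTerm_eq hu σ)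
  have h3 (k : Fin 2 → ℤ) : ‖(((eigenvalue L k ^ σ : ℝ) : ℂ) * rho L u k) • evec k‖
      = ‖((eigenvalue L k ^ σ : ℝ) : ℂ) * rho L u k‖ := by
    rw [norm_smul]
    by_cases hk : k = 0
    · rw [hk, rho_zero_mode]; simp
    · rw [norm_evec hk, mul_one]
  rw [h1, h2, summable_mode_iff]
  simp only [h3]
  exact ⟨fun h => ⟨_, L2Bd.of_summable h⟩, fun ⟨C, h⟩ => h.summable⟩

end NSE2D

namespace NSE2D

open Set Filter Topology ComplexConjugate

/-! ### The nonlinear term in terms of amplitudes -/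

variable {L : ℝ} [hL : Fact (0 < L)]

/-- The continuous field `x ↦ exp (i κ₀ k · x) a`. -/
noncomputable def contMode (L : ℝ) (k : Fin 2 → ℤ) (a : Vec) : C(Torus L, Vec) :=
  ⟨fun x => character L k x • a, by fun_prop⟩

theorem norm_contMode_le (k : Fin 2 → ℤ) (a : Vec) : ‖contMode L k a‖ ≤ ‖a‖ := by
  refine (ContinuousMap.norm_le _ (norm_nonneg a)).2 fun x => ?_
  change ‖character L k x • a‖ ≤ ‖a‖
  rw [norm_smul, norm_character, one_mul]

theorem exists_continuous_of_summable {u : Field L} (hu : u ∈ HC L)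
    (h : Summable fun k => ‖rho L u k‖) :
    ∃ S : C(Torus L, Vec), (∀ᵐ x : Torus L, u x = S x) ∧
      ∀ x, HasSum (fun k => character L k x • rho L u k • evec k) (S x) := by
  have hs : Summable fun k => contMode L k (rho L u k • evec k) := by
    refine .of_norm_bounded h fun k => (norm_contMode_le _ _).trans ?_
    rw [norm_smul]
    exact mul_le_of_le_one_right (norm_nonneg _) (norm_evec_le k)
  refine ⟨∑' k, contMode L k (rho L u k • evec k), ?_, fun x => ?_⟩
  · have h1 : u = ContinuousMap.toLp (E := Vec) 2 (volume : Measure (Torus L)) ℂ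
        (∑' k, contMode L k (rho L u k • evec k)) := by
      rw [ContinuousLinearMap.map_tsum _ hs]
      exact (synth_rho hu).symm
    have h2 := ContinuousMap.coeFn_toLp (p := 2) (𝕜 := ℂ) (volume : Measure (Torus L))
      (∑' k, contMode L k (rho L u k • evec k))
    rw [← h1] at h2
    exact h2
  · exact ContinuousMap.hasSum_apply hs.hasSum x

theorem abs_coord_le_wlen (k : Fin 2 → ℤ) (j : Fin 2) : |(k j : ℝ)| ≤ wlen k := by
  rw [wlen]
  exact Real.abs_le_sqrt (Finset.single_le_sum (f := fun i => (k i : ℝ) ^ 2)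
    (fun i _ => sq_nonneg _) (Finset.mem_univ j))

theorem coeff_pderiv {v : Field L} (hv : v ∈ HC L) {C : ℝ}
    (h : L2Bd (fun k => wlen k * ‖rho L v k‖) C) (j : Fin 2) (k : Fin 2 → ℤ) :
    coeff L (pderiv L j v) k
      = (Complex.I * (kappa L : ℂ) * (k j : ℂ)) • rho L v k • evec k := by
  rw [pderiv, coeff_tsum_mode, coeff_eq_rho_smul hv]
  refine ((h.const_mul (kappa_pos (L := L)).le).mono fun k => ?_).summable
  rw [abs_norm, norm_smul, norm_mul, norm_mul, Complex.norm_I, one_mul, Complex.norm_real,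
    Real.norm_of_nonneg kappa_pos.le, mul_assoc, Complex.norm_intCast, coeff_eq_rho_smul hv,
    norm_smul]
  have h1 := abs_coord_le_wlen k j
  have h2 : ‖rho L v k‖ * ‖evec k‖ ≤ ‖rho L v k‖ :=
    mul_le_of_le_one_right (norm_nonneg _) (norm_evec_le k)
  exact mul_le_mul_of_nonneg_left
    (mul_le_mul h1 h2 (mul_nonneg (norm_nonneg _) (norm_nonneg _)) (wlen_nonneg k))
    kappa_pos.le

theorem memLp_component_smul {u : Field L} {S : C(Torus L, Vec)} (hS : ∀ᵐ x : Torus L, u x = S x)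
    (j : Fin 2) (P : Field L) :
    MemLp (fun x => u x j • P x) 2 (volume : Measure (Torus L)) := by
  refine MemLp.of_le_mul (c := ‖S‖) (Lp.memLp P) ?_ ?_
  · have h1 : AEStronglyMeasurable (fun x => u x j) (volume : Measure (Torus L)) :=
      (EuclideanSpace.proj (𝕜 := ℂ) j).continuous.comp_aestronglyMeasurable
        (Lp.aestronglyMeasurable u)
    exact h1.smul (Lp.aestronglyMeasurable P)
  · filter_upwards [hS] with x hx
    rw [norm_smul, hx]
    exact mul_le_mul_of_nonneg_right ((PiLp.norm_apply_le _ j).trans (S.norm_coe_le_norm x))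
      (norm_nonneg _)

/-- The convolution theorem for a product of a bounded field and one in `L²`: only `u`, whose series
converges absolutely, is expanded. -/
theorem hasSum_integral_component {u : Field L} (hu : Summable fun k => ‖rho L u k‖)
    {S : C(Torus L, Vec)} (hS : ∀ᵐ x : Torus L, u x = S x)
    (hSum : ∀ x, HasSum (fun k => character L k x • rho L u k • evec k) (S x))
    (j : Fin 2) (P : Field L) (k : Fin 2 → ℤ) :
    HasSum (fun l => (rho L u l * evec l j) • ((L : ℂ) ^ 2 • coeff L P (k - l)))
      (∫ x : Torus L, conj (character L k x) • (u x j • P x)) := by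
  have hL0 : (L : ℂ) ^ 2 ≠ 0 := by exact_mod_cast (pow_pos hL.out 2).ne'
  set F : (Fin 2 → ℤ) → Torus L → Vec :=
    fun l x => (rho L u l * evec l j) • (conj (character L (k - l) x) • P x) with hF
  have hint (l : Fin 2 → ℤ) : Integrable (F l) :=
    (character_smul_integrable (k - l) (field_integrable P)).fun_smul (rho L u l * evec l j)
  have hsum : Summable fun l => ∫ x, ‖F l x‖ := by
    have e (l : Fin 2 → ℤ) : ∫ x, ‖F l x‖ = ‖rho L u l * evec l j‖ * ∫ x, ‖P x‖ := by
      rw [← integral_const_mul]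
      refine integral_congr_ae (Eventually.of_forall fun x => ?_)
      simp only [hF, norm_smul, RCLike.norm_conj, norm_character, one_mul]
    simp only [e]
    refine Summable.mul_right _ (.of_nonneg_of_le (fun _ => norm_nonneg _) (fun l => ?_) hu)
    rw [norm_mul]
    exact mul_le_of_le_one_right (norm_nonneg _)
      ((PiLp.norm_apply_le _ j).trans (norm_evec_le l))
  have h := hasSum_integral_of_summable_integral_norm hint hsum
  have e1 : ∫ x, ∑' l, F l x = ∫ x : Torus L, conj (character L k x) • (u x j • P x) := by
    refine integral_congr_ae ?_
    filter_upwards [hS] with x hx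
    have h1 := (EuclideanSpace.proj (𝕜 := ℂ) j : Vec →L[ℂ] ℂ).hasSum (hSum x)
    have h2 := (h1.mul_left (conj (character L k x))).smul_const (P x)
    rw [hx, smul_smul]
    have h3 (l : Fin 2 → ℤ) : F l x = (conj (character L k x)
        * EuclideanSpace.proj (𝕜 := ℂ) j (character L l x • rho L u l • evec l)) • P x := by
      simp only [hF]
      rw [smul_smul]
      congr 1
      rw [sub_eq_add_neg, character_add, map_mul, character_neg, Complex.conj_conj]
      simp only [PiLp.proj_apply, PiLp.smul_apply, smul_eq_mul]
      ring
    rw [tsum_congr h3, h2.tsum_eq]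
    rfl
  have e2 (l : Fin 2 → ℤ) :
      (rho L u l * evec l j) • ((L : ℂ) ^ 2 • coeff L P (k - l)) = ∫ x, F l x := by
    rw [coeff, smul_inv_smul₀ hL0, ← integral_smul]
  simp only [e2]
  rwa [e1] at h

theorem memLp_advection {u v : Field L} {S : C(Torus L, Vec)} (hS : ∀ᵐ x : Torus L, u x = S x) :
    MemLp (advection L u v) 2 (volume : Measure (Torus L)) := by
  have := memLp_finsetSum Finset.univ fun j _ => memLp_component_smul hS j (pderiv L j v)
  exact this

/-- The coefficient `coef l m` is the product of `evec l · i m`, from the advecting derivative, and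
of the inner product of `evec k` and `evec m`, from the projection. -/
theorem B_self_spec {u : Field L} (hu : u ∈ HC L) {C : ℝ}
    (h : L2Bd (fun k => wlen k ^ 2 * ‖rho L u k‖) C) :
    B L u u ∈ HC L ∧ ∀ k, rho L (B L u u) k = (kappa L : ℂ) * nl (rho L u) (rho L u) k := by
  have hL0 : (L : ℂ) ^ 2 ≠ 0 := by exact_mod_cast (pow_pos hL.out 2).ne'
  have h1 : L2Bd (fun k => wlen k * ‖rho L u k‖) C := by
    refine h.mono fun k => ?_
    by_cases hk : k = 0
    · simp [hk, rho_zero_mode]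
    · rw [abs_of_nonneg (mul_nonneg (wlen_nonneg k) (norm_nonneg _))]
      have := one_le_wlen hk
      exact mul_le_mul_of_nonneg_right (by nlinarith) (norm_nonneg _)
  have hsum : Summable fun k => ‖rho L u k‖ :=
    (summable_of_l2Bd_wlen (by rw [rho_zero_mode, norm_zero]) (fun _ => norm_nonneg _) h1 h).1
  obtain ⟨S, hS, hSum⟩ := exists_continuous_of_summable hu hsum
  have hmem := memLp_advection (v := u) hS
  have hB : B L u u = leray L (hmem.toLp _) := dif_pos hmem
  refine ⟨by rw [hB]; exact leray_mem_HC _, fun k => ?_⟩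
  rw [hB, rho_leray, rho, coeff]
  have e1 : ∫ x : Torus L, conj (character L k x) • (hmem.toLp (advection L u u)) x
      = ∑ j, ∫ x : Torus L, conj (character L k x) • (u x j • pderiv L j u x) := by
    rw [← integral_finsetSum]
    · refine integral_congr_ae ?_
      filter_upwards [hmem.coeFn_toLp] with x hx
      rw [hx, advection, Finset.smul_sum]
    · intro j _
      exact character_smul_integrable k
        ((memLp_component_smul hS j (pderiv L j u)).integrable (by norm_num))
  rw [e1, inner_smul_right]
  have h2 := hasSum_sum (s := Finset.univ) fun j _ =>
    hasSum_integral_component hsum hS hSum j (pderiv L j u) k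
  have h3 := ((innerSL ℂ (evec k)).hasSum h2).mul_left ((L : ℂ) ^ 2)⁻¹
  simp only [innerSL_apply_apply] at h3
  rw [← h3.tsum_eq, nl, ← tsum_mul_left]
  refine tsum_congr fun l => ?_
  simp only [coeff_pderiv hu h1, inner_sum, inner_smul_right, inner_evec_evec]
  have h4 := evec_dot l (k - l)
  rw [Fin.sum_univ_two] at h4 ⊢
  have h5 : coef l (k - l) = -(cross l (k - l)) / wlen l
      * (wdot k (k - l) / (wlen k * wlen (k - l))) := by
    rw [coef, add_sub_cancel, wdot_comm (k - l) k]
    simp only [div_eq_mul_inv, mul_inv]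
    ring
  rw [h5, Complex.ofReal_mul, ← h4, smul_eq_mul]
  have hinv := inv_mul_cancel₀ hL0
  linear_combination ((kappa L : ℂ) * ((evec l 0 * (Complex.I * ((k - l) 0 : ℤ))
    + evec l 1 * (Complex.I * ((k - l) 1 : ℤ)))
    * ((wdot k (k - l) / (wlen k * wlen (k - l)) : ℝ) : ℂ)) * (rho L u l * rho L u (k - l))) * hinv

end NSE2D

namespace NSE2D

open Set Filter Topology ComplexConjugate

/-! ### Passage between fields and amplitudes -/

variable {L : ℝ} [hL : Fact (0 < L)]

theorem nl_smul_smul (c : ℂ) (a : (Fin 2 → ℤ) → ℂ) (k : Fin 2 → ℤ) :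
    nl (fun l => c * a l) (fun l => c * a l) k = c ^ 2 * nl a a k := by
  rw [nl, nl, ← tsum_mul_left]
  refine tsum_congr fun l => ?_
  simp only [smul_eq_mul]
  ring

theorem eigenvalue_rpow_one (k : Fin 2 → ℤ) :
    eigenvalue L k ^ (1 : ℝ) = kappa L ^ 2 * wlen k ^ 2 := by
  rw [← eigenvalue_rpow 2 k]
  norm_num

theorem l2Bd_of_mem_stokesDom {u : Field L} (hu : u ∈ stokesDom L 1) :
    ∃ C, L2Bd (fun k => wlen k ^ 2 * ‖rho L u k‖) C := by
  obtain ⟨C, hC⟩ := (mem_stokesDom_iff hu.1 1).1 hu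
  have hκ := kappa_pos (L := L)
  refine ⟨(kappa L ^ 2)⁻¹ * C, (hC.const_mul (c := (kappa L ^ 2)⁻¹) (by positivity)).mono fun k => ?_⟩
  rw [eigenvalue_rpow_one, norm_mul, Complex.norm_real,
    Real.norm_of_nonneg (mul_nonneg (sq_nonneg _) (sq_nonneg _)),
    abs_of_nonneg (mul_nonneg (sq_nonneg _) (norm_nonneg _)), mul_assoc,
    inv_mul_cancel_left₀ (pow_pos hκ 2).ne']

theorem rho_stokesPow {u : Field L} {σ : ℝ} (hu : u ∈ stokesDom L σ) (k : Fin 2 → ℤ) :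
    rho L (stokesPow L σ u) k = ((eigenvalue L k ^ σ : ℝ) : ℂ) * rho L u k := by
  obtain ⟨C, hC⟩ := (mem_stokesDom_iff hu.1 σ).1 hu
  rw [stokesPow_eq_synth hu.1, rho_synth hC (by rw [rho_zero_mode, mul_zero])]

theorem stokesPow_mem_HC {u : Field L} (hu : u ∈ HC L) (σ : ℝ) : stokesPow L σ u ∈ HC L := by
  rw [stokesPow_eq_synth hu]
  exact synth_mem_HC _

theorem rhs_mem_HC {ν : ℝ} {g u : Field L} (hg : g ∈ HC L) (hu : u ∈ stokesDom L 1) :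
    rhs ν L g u ∈ HC L := by
  obtain ⟨C, hC⟩ := l2Bd_of_mem_stokesDom hu
  exact (HC L).sub_mem ((HC L).sub_mem hg ((HC L).smul_mem _ (stokesPow_mem_HC hu.1 1)))
    (B_self_spec hu.1 hC).1

theorem rho_rhs {ν : ℝ} {g u : Field L} (hu : u ∈ stokesDom L 1) (k : Fin 2 → ℤ) :
    rho L (rhs ν L g u) k = rho L g k - (ν * kappa L ^ 2 * wlen k ^ 2 : ℝ) * rho L u k
      - (kappa L : ℂ) * nl (rho L u) (rho L u) k := by
  obtain ⟨C, hC⟩ := l2Bd_of_mem_stokesDom hu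
  rw [rhs, rho_sub, rho_sub, rho_smul, rho_stokesPow hu, (B_self_spec hu.1 hC).2,
    eigenvalue_rpow_one]
  push_cast
  ring

/-- The amplitudes of a solution in nondimensional variables. -/
noncomputable def amplitudes (ν L : ℝ) [Fact (0 < L)] (u : ℝ → Field L) (t : ℝ) : Amp :=
  ((ν * kappa L : ℝ) : ℂ)⁻¹ • rhoCLM L (u ((ν * kappa L ^ 2)⁻¹ * t))

theorem amplitudes_apply (ν : ℝ) (u : ℝ → Field L) (t : ℝ) (k : Fin 2 → ℤ) :
    amplitudes ν L u t k
      = ((ν * kappa L : ℝ) : ℂ)⁻¹ * rho L (u ((ν * kappa L ^ 2)⁻¹ * t)) k := rfl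

/-- The amplitudes of the force in nondimensional variables. -/
noncomputable def forceAmp (ν L : ℝ) [Fact (0 < L)] (g : Field L) (k : Fin 2 → ℤ) : ℂ :=
  ((ν ^ 2 * kappa L ^ 3 : ℝ) : ℂ)⁻¹ * rho L g k

theorem length_mul_kappa : L * kappa L = 2 * Real.pi := mul_div_cancel₀ _ hL.out.ne'

theorem l2Bd_forceAmp {ν : ℝ} (hν : 0 < ν) (g : Field L) :
    L2Bd (fun k => ‖forceAmp ν L g k‖) (grashof ν L g / (2 * Real.pi)) := by
  have hκ := kappa_pos (L := L)
  have h0 := hL.out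
  have h := (l2Bd_rho g).const_mul (c := (ν ^ 2 * kappa L ^ 3)⁻¹) (by positivity)
  have e : (ν ^ 2 * kappa L ^ 3)⁻¹ * (‖g‖ / L) = grashof ν L g / (2 * Real.pi) := by
    rw [grashof, ← length_mul_kappa (L := L)]
    field_simp
  rw [e] at h
  refine h.mono fun k => ?_
  rw [abs_norm, forceAmp, norm_mul, norm_inv, Complex.norm_real, Real.norm_of_nonneg (by positivity)]

/-- Velocities are measured in units of `νκ₀` and time in units of `(νκ₀²)⁻¹`, which removes all
parameters from the equation; `L κ₀ = 2π` turns the size of the force into `G / 2π`. -/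
theorem IsSolution.seqSol {ν : ℝ} (hν : 0 < ν) {g : Field L} {u : ℝ → Field L}
    (hu : IsSolution ν L g u) : SeqSol (forceAmp ν L g) (amplitudes ν L u) := by
  have hκ := kappa_pos (L := L)
  have hνκ : ((ν * kappa L : ℝ) : ℂ) ≠ 0 := by exact_mod_cast (mul_pos hν hκ).ne'
  refine ⟨fun t => ?_, fun t k => ?_, fun t => ?_, fun t => ?_⟩
  · rw [amplitudes_apply, rho_zero_mode, mul_zero]
  · rw [amplitudes_apply, amplitudes_apply, rho_neg_of_mem_H (hu _).1, map_mul, map_inv₀,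
      Complex.conj_ofReal]
  · obtain ⟨C, hC⟩ := l2Bd_of_mem_stokesDom (hu ((ν * kappa L ^ 2)⁻¹ * t)).2.1
    refine ⟨_, (hC.const_mul (c := (ν * kappa L)⁻¹) (by positivity)).mono fun k => ?_⟩
    rw [amplitudes_apply, norm_mul, norm_inv, Complex.norm_real,
      Real.norm_of_nonneg (mul_pos hν hκ).le, abs_of_nonneg (by positivity [wlen_nonneg k])]
    exact (mul_left_comm _ _ _).le
  · set s := (ν * kappa L ^ 2)⁻¹ * t with hs
    obtain ⟨-, h2, h3⟩ := hu s
    refine ⟨((ν * kappa L : ℝ) : ℂ)⁻¹ • rhoCLM L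
      ((ν * kappa L ^ 2)⁻¹ • rhs ν L g (u s)), fun k => ?_, ?_⟩
    · have e1 : (((ν * kappa L : ℝ) : ℂ)⁻¹ • rhoCLM L
          ((ν * kappa L ^ 2)⁻¹ • rhs ν L g (u s))) k
          = ((ν * kappa L : ℝ) : ℂ)⁻¹ * (((ν * kappa L ^ 2)⁻¹ : ℝ) * rho L (rhs ν L g (u s)) k) := by
        rw [← rho_smul]
        rfl
      have e2 : (amplitudes ν L u t : (Fin 2 → ℤ) → ℂ)
          = fun l => ((ν * kappa L : ℝ) : ℂ)⁻¹ * rho L (u s) l := rfl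
      rw [e1, rho_rhs h2, e2, nl_smul_smul, forceAmp]
      push_cast
      have hν' : (ν : ℂ) ≠ 0 := by exact_mod_cast hν.ne'
      have hκ' : (kappa L : ℂ) ≠ 0 := by exact_mod_cast hκ.ne'
      field_simp
    · have h4 : HasDerivAt (fun t : ℝ => (ν * kappa L ^ 2)⁻¹ * t) (ν * kappa L ^ 2)⁻¹ t :=
        hasDerivAt_const_mul _
      have h5 : HasDerivAt (fun t => u ((ν * kappa L ^ 2)⁻¹ * t))
          ((ν * kappa L ^ 2)⁻¹ • rhs ν L g (u s)) t := HasDerivAt.scomp t h3 h4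
      have h6 := (((rhoCLM L).restrictScalars ℝ).hasFDerivAt.comp_hasDerivAt t h5).const_smul
        ((ν * kappa L : ℝ) : ℂ)⁻¹
      exact h6

theorem IsSolution.norm_amplitudes_le {ν : ℝ} (hν : 0 < ν) {g : Field L} {u : ℝ → Field L}
    (hu : IsSolution ν L g u) {M : ℝ} (hM : ∀ t, ‖u t‖ ≤ M) (t : ℝ) :
    ‖amplitudes ν L u t‖ ≤ grashof ν L g / (2 * Real.pi) := by
  refine (hu.seqSol hν).norm_le_of_bounded (l2Bd_forceAmp hν g)
    (M := ‖((ν * kappa L : ℝ) : ℂ)⁻¹‖ * (‖rhoCLM L‖ * M)) (fun t => ?_) t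
  rw [amplitudes, norm_smul]
  refine mul_le_mul_of_nonneg_left (((rhoCLM L).le_opNorm _).trans ?_) (norm_nonneg _)
  exact mul_le_mul_of_nonneg_left (hM _) (norm_nonneg _)

/-- Each value lies on some bounded solution, possibly a different one for each time, and the bound
for bounded solutions is uniform. -/
theorem IsSolutionInAttractor.norm_amplitudes_le {ν : ℝ} (hν : 0 < ν) {g : Field L}
    {u : ℝ → Field L} (hu : IsSolutionInAttractor ν L g u) (t : ℝ) :
    ‖amplitudes ν L u t‖ ≤ grashof ν L g / (2 * Real.pi) := by
  obtain ⟨v, hv, hv0, M, hM⟩ := hu.2 ((ν * kappa L ^ 2)⁻¹ * t)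
  have h := hv.norm_amplitudes_le hν hM 0
  rwa [amplitudes, mul_zero, hv0] at h

theorem mul_mem_strip {c δ : ℝ} (hc : 0 < c) {ζ : ℂ} (hζ : ζ ∈ strip (δ / c)) :
    (c : ℂ) * ζ ∈ strip δ := by
  change |((c : ℂ) * ζ).im| < δ
  rw [Complex.im_ofReal_mul, abs_mul, abs_of_pos hc, mul_comm]
  exact (lt_div_iff₀ hc).1 hζ

/-! ### Fields with prescribed amplitudes: analyticity and the complexified equation. -/

section Reconstruction

variable {V : ℂ → (Fin 2 → ℤ) → ℂ} {δ : ℝ} {R : ℕ → ℝ}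

/-- The field with nondimensional amplitudes `V`, in the original variables. -/
noncomputable def rebuild (ν L : ℝ) [Fact (0 < L)] (V : ℂ → (Fin 2 → ℤ) → ℂ) (ζ : ℂ) : Field L :=
  synth L fun k => ((ν * kappa L : ℝ) : ℂ) * V (((ν * kappa L ^ 2 : ℝ) : ℂ) * ζ) k

theorem rebuild_mem_HC (ν : ℝ) (V : ℂ → (Fin 2 → ℤ) → ℂ) (ζ : ℂ) : rebuild ν L V ζ ∈ HC L :=
  synth_mem_HC _

theorem l2Bd_weighted_rebuild {ν : ℝ} (hν : 0 < ν)
    (hR : ∀ ζ ∈ strip δ, ∀ α, L2Bd (fun k => wlen k ^ α * ‖V ζ k‖) (R α)) (α : ℕ) {ζ : ℂ}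
    (hζ : ζ ∈ strip (δ / (ν * kappa L ^ 2))) :
    L2Bd (fun k => ‖((eigenvalue L k ^ ((α : ℝ) / 2) : ℝ) : ℂ)
      * (((ν * kappa L : ℝ) : ℂ) * V (((ν * kappa L ^ 2 : ℝ) : ℂ) * ζ) k)‖)
      (kappa L ^ α * (ν * kappa L) * R α) := by
  have hκ := kappa_pos (L := L)
  have h := (hR _ (mul_mem_strip (by positivity) hζ) α).const_mul
    (c := kappa L ^ α * (ν * kappa L)) (by positivity)
  refine h.mono fun k => le_of_eq ?_
  have hw := wlen_nonneg k
  rw [abs_norm, norm_mul, norm_mul, Complex.norm_real, Complex.norm_real, eigenvalue_rpow,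
    Real.norm_of_nonneg (by positivity), Real.norm_of_nonneg (by positivity)]
  ring

theorem rho_rebuild {ν : ℝ} (hν : 0 < ν)
    (hR : ∀ ζ ∈ strip δ, ∀ α, L2Bd (fun k => wlen k ^ α * ‖V ζ k‖) (R α))
    (h0 : ∀ ζ ∈ strip δ, V ζ 0 = 0) {ζ : ℂ} (hζ : ζ ∈ strip (δ / (ν * kappa L ^ 2)))
    (k : Fin 2 → ℤ) :
    rho L (rebuild ν L V ζ) k
      = ((ν * kappa L : ℝ) : ℂ) * V (((ν * kappa L ^ 2 : ℝ) : ℂ) * ζ) k := by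
  have hκ := kappa_pos (L := L)
  have h := l2Bd_weighted_rebuild (L := L) hν hR 0 hζ
  simp only [Nat.cast_zero, zero_div, Real.rpow_zero, Complex.ofReal_one, one_mul] at h
  exact rho_synth h (by rw [h0 _ (mul_mem_strip (by positivity) hζ), mul_zero]) k

theorem stokesPow_rebuild {ν : ℝ} (hν : 0 < ν)
    (hR : ∀ ζ ∈ strip δ, ∀ α, L2Bd (fun k => wlen k ^ α * ‖V ζ k‖) (R α))
    (h0 : ∀ ζ ∈ strip δ, V ζ 0 = 0) {ζ : ℂ} (hζ : ζ ∈ strip (δ / (ν * kappa L ^ 2))) (σ : ℝ) :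
    stokesPow L σ (rebuild ν L V ζ) = synth L fun k => ((eigenvalue L k ^ σ : ℝ) : ℂ)
      * (((ν * kappa L : ℝ) : ℂ) * V (((ν * kappa L ^ 2 : ℝ) : ℂ) * ζ) k) := by
  rw [stokesPow_eq_synth (rebuild_mem_HC ν V _)]
  simp only [rho_rebuild hν hR h0 hζ]

theorem rebuild_mem_stokesDom {ν : ℝ} (hν : 0 < ν)
    (hR : ∀ ζ ∈ strip δ, ∀ α, L2Bd (fun k => wlen k ^ α * ‖V ζ k‖) (R α))
    (h0 : ∀ ζ ∈ strip δ, V ζ 0 = 0) {ζ : ℂ} (hζ : ζ ∈ strip (δ / (ν * kappa L ^ 2))) (α : ℕ) :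
    rebuild ν L V ζ ∈ stokesDom L ((α : ℝ) / 2) := by
  refine (mem_stokesDom_iff (rebuild_mem_HC ν V _) _).2 ⟨kappa L ^ α * (ν * kappa L) * R α, ?_⟩
  simp only [rho_rebuild hν hR h0 hζ]
  exact l2Bd_weighted_rebuild hν hR α hζ

theorem norm_stokesPow_rebuild_le {ν : ℝ} (hν : 0 < ν)
    (hR : ∀ ζ ∈ strip δ, ∀ α, L2Bd (fun k => wlen k ^ α * ‖V ζ k‖) (R α))
    (h0 : ∀ ζ ∈ strip δ, V ζ 0 = 0) {ζ : ℂ} (hζ : ζ ∈ strip (δ / (ν * kappa L ^ 2))) (α : ℕ) :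
    ‖stokesPow L ((α : ℝ) / 2) (rebuild ν L V ζ)‖
      ≤ 2 * Real.pi * R α * ν * kappa L ^ α := by
  rw [stokesPow_rebuild hν hR h0 hζ]
  refine (norm_synth_le (l2Bd_weighted_rebuild hν hR α hζ)).trans_eq ?_
  rw [← length_mul_kappa (L := L)]
  ring

/-- The bound of order `α + 3` makes the Fourier series of `A^{α/2} u` converge uniformly, with
majorant `|k|⁻³`. -/
theorem analyticOnNhd_stokesPow_rebuild {ν : ℝ} (hν : 0 < ν)
    (hR : ∀ ζ ∈ strip δ, ∀ α, L2Bd (fun k => wlen k ^ α * ‖V ζ k‖) (R α))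
    (h0 : ∀ ζ ∈ strip δ, V ζ 0 = 0)
    (hd : ∀ ζ ∈ strip δ, ∀ k, DifferentiableAt ℂ (fun z => V z k) ζ) (α : ℕ) :
    AnalyticOnNhd ℂ (fun ζ => stokesPow L ((α : ℝ) / 2) (rebuild ν L V ζ))
      (strip (δ / (ν * kappa L ^ 2))) := by
  have hκ := kappa_pos (L := L)
  have hc : 0 < ν * kappa L ^ 2 := by positivity
  have ho : IsOpen (strip (δ / (ν * kappa L ^ 2))) := isOpen_strip _
  have h : DifferentiableOn ℂ (fun ζ => synth L fun k => ((eigenvalue L k ^ ((α : ℝ) / 2) : ℝ) : ℂ)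
      * (((ν * kappa L : ℝ) : ℂ) * V (((ν * kappa L ^ 2 : ℝ) : ℂ) * ζ) k))
      (strip (δ / (ν * kappa L ^ 2))) := by
    refine Complex.differentiableOn_tsum_of_summable_norm
      (u := fun k => (if k = 0 then 0 else wlen k ^ (-3 : ℝ))
        * (L * (kappa L ^ α * (ν * kappa L) * R (α + 3))))
      ((summable_wlen_rpow (by norm_num)).mul_right _) (fun k ζ hζ => ?_) ho fun k ζ hζ => ?_
    · have h1 : DifferentiableAt ℂ (fun ζ : ℂ => V (((ν * kappa L ^ 2 : ℝ) : ℂ) * ζ) k) ζ :=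
        DifferentiableAt.comp ζ (hd _ (mul_mem_strip hc hζ) k)
          (differentiableAt_id.const_mul _)
      simp only [mode_smul]
      exact (((h1.const_mul _).const_mul _).smul_const _).differentiableWithinAt
    · by_cases hk : k = 0
      · simp [hk, evec_zero, mode_zero]
      · have hw := wlen_pos hk
        rw [if_neg hk, norm_mode, norm_smul, norm_evec hk, mul_one, norm_mul, norm_mul,
          Complex.norm_real, Complex.norm_real, eigenvalue_rpow,
          Real.norm_of_nonneg (by positivity), Real.norm_of_nonneg (by positivity),
          Real.rpow_neg hw.le]
        have h2 := (hR _ (mul_mem_strip hc hζ) (α + 3)).abs_le k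
        rw [abs_of_nonneg (by positivity), pow_add] at h2
        have h3 : wlen k ^ (3 : ℝ) = wlen k ^ 3 := by norm_cast
        have h4 : wlen k ^ α * ‖V (((ν * kappa L ^ 2 : ℝ) : ℂ) * ζ) k‖
            ≤ (wlen k ^ 3)⁻¹ * R (α + 3) := by
          rw [inv_mul_eq_div, le_div_iff₀ (by positivity)]
          linarith
        have h5 := mul_le_mul_of_nonneg_left h4
          (show 0 ≤ L * (kappa L ^ α * (ν * kappa L)) by have := hL.out; positivity)
        rw [h3]
        linarith
  refine (h.analyticOnNhd ho).congr ho fun ζ hζ => ?_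
  exact (stokesPow_rebuild hν hR h0 hζ _).symm

theorem isComplexSolutionOn_rebuild {ν : ℝ} (hν : 0 < ν) {g : Field L} (hg : g ∈ HC L)
    (hR : ∀ ζ ∈ strip δ, ∀ α, L2Bd (fun k => wlen k ^ α * ‖V ζ k‖) (R α))
    (h0 : ∀ ζ ∈ strip δ, V ζ 0 = 0)
    (hd : ∀ ζ ∈ strip δ, ∀ k, HasDerivAt (fun z => V z k)
      (forceAmp ν L g k - (wlen k ^ 2 : ℝ) * V ζ k - nl (V ζ) (V ζ) k) ζ) :
    IsComplexSolutionOn ν L g (strip (δ / (ν * kappa L ^ 2))) (rebuild ν L V) := by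
  intro ζ hζ
  have hκ := kappa_pos (L := L)
  have hc : 0 < ν * kappa L ^ 2 := by positivity
  have hdom : rebuild ν L V ζ ∈ stokesDom L 1 := by
    have := rebuild_mem_stokesDom (L := L) hν hR h0 hζ 2
    norm_num at this
    exact this
  refine ⟨rebuild_mem_HC ν V _, hdom, ?_⟩
  have ho : IsOpen (strip (δ / (ν * kappa L ^ 2))) := isOpen_strip _
  -- Order `0` gives differentiability of the field itself in `L²`.
  have han := analyticOnNhd_stokesPow_rebuild (L := L) hν hR h0
    (fun ζ hζ k => (hd ζ hζ k).differentiableAt) 0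
  have heq : (fun ζ => stokesPow L (((0 : ℕ) : ℝ) / 2) (rebuild ν L V ζ)) =ᶠ[𝓝 ζ]
      rebuild ν L V := by
    filter_upwards [ho.mem_nhds hζ] with z hz
    rw [stokesPow_rebuild hν hR h0 hz]
    simp [rebuild]
  have hdiff : HasDerivAt (rebuild ν L V) (deriv (rebuild ν L V) ζ) ζ :=
    ((han ζ hζ).differentiableAt.congr_of_eventuallyEq heq.symm).hasDerivAt
  -- `HC L` is closed, so the derivative stays in it and is determined by its amplitudes.
  have hmem : deriv (rebuild ν L V) ζ ∈ HC L := by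
    refine isClosed_HC.mem_of_tendsto hdiff.tendsto_slope (Eventually.of_forall fun z => ?_)
    rw [slope_def_module]
    exact (HC L).smul_mem _ ((HC L).sub_mem (rebuild_mem_HC ν V _) (rebuild_mem_HC ν V _))
  have hval : deriv (rebuild ν L V) ζ = rhs ν L g (rebuild ν L V ζ) := by
    refine eq_of_rho_eq hmem (rhs_mem_HC hg hdom) fun k => ?_
    have h1 : HasDerivAt (fun z => rho L (rebuild ν L V z) k)
        (rho L (deriv (rebuild ν L V) ζ) k) ζ :=
      ((innerSL ℂ (evec k)).comp (coeffCLM L k)).hasFDerivAt.comp_hasDerivAt ζ hdiff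
    have h2 : HasDerivAt (fun z : ℂ => ((ν * kappa L ^ 2 : ℝ) : ℂ) * z)
        ((ν * kappa L ^ 2 : ℝ) : ℂ) ζ := hasDerivAt_const_mul _
    have h3 := (HasDerivAt.comp ζ (hd _ (mul_mem_strip hc hζ) k) h2).const_mul
      ((ν * kappa L : ℝ) : ℂ)
    have h4 : (fun z => rho L (rebuild ν L V z) k) =ᶠ[𝓝 ζ]
        fun z => ((ν * kappa L : ℝ) : ℂ) * V (((ν * kappa L ^ 2 : ℝ) : ℂ) * z) k := by
      filter_upwards [ho.mem_nhds hζ] with z hz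
      exact rho_rebuild hν hR h0 hz k
    have h5 : rho L (rebuild ν L V ζ)
        = fun l => ((ν * kappa L : ℝ) : ℂ) * V (((ν * kappa L ^ 2 : ℝ) : ℂ) * ζ) l :=
      funext (rho_rebuild hν hR h0 hζ)
    rw [h1.unique (h3.congr_of_eventuallyEq h4), rho_rhs hdom, h5, nl_smul_smul, forceAmp]
    push_cast
    have hν' : (ν : ℂ) ≠ 0 := by exact_mod_cast hν.ne'
    have hκ' : (kappa L : ℂ) ≠ 0 := by exact_mod_cast hκ.ne'
    field_simp
  rw [← hval]
  exact hdiff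

end Reconstruction

end NSE2D

/-! ### Assembly of the main theorem. -/

theorem theorem2p1 (G : ℝ) :
    ∃ (δ₀ : ℝ) (R : ℕ → ℝ), 0 < δ₀ ∧ (∀ α, 0 ≤ R α) ∧
      ∀ (ν L : ℝ) [Fact (0 < L)] (g : NSE2D.Field L),
        0 < ν → g ∈ NSE2D.H L → NSE2D.grashof ν L g = G →
        (0 : NSE2D.Field L) ∈ NSE2D.attractor ν L g →
        ∃ δ : ℝ, 0 < δ ∧ δ = δ₀ / (ν * NSE2D.kappa L ^ 2) ∧
          ∀ u : ℝ → NSE2D.Field L, NSE2D.IsSolutionInAttractor ν L g u →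
            ∃ U : ℂ → NSE2D.Field L,
              (∀ t : ℝ, U (t : ℂ) = u t) ∧
              NSE2D.IsComplexSolutionOn ν L g (NSE2D.strip δ) U ∧
              ∀ α : ℕ,
                (∀ ζ ∈ NSE2D.strip δ,
                  U ζ ∈ NSE2D.stokesDom L ((α : ℝ) / 2) ∧
                  NSE2D.stokesPow L ((α : ℝ) / 2) (U ζ) ∈ NSE2D.HC L) ∧
                AnalyticOnNhd ℂ (fun ζ => NSE2D.stokesPow L ((α : ℝ) / 2) (U ζ))
                  (NSE2D.strip δ) ∧
                ∀ ζ ∈ NSE2D.strip δ,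
                  ‖NSE2D.stokesPow L ((α : ℝ) / 2) (U ζ)‖ ≤ R α * ν * NSE2D.kappa L ^ α := by
  obtain ⟨δ₀, hδ₀, R, hR0, hext⟩ := NSE2D.SeqSol.exists_smooth_extension (G / (2 * Real.pi))
  refine ⟨δ₀, fun α => 2 * Real.pi * R α, hδ₀, fun α => mul_nonneg Real.two_pi_pos.le (hR0 α), ?_⟩
  intro ν L _ g hν hg hG hattr
  have hκ := NSE2D.kappa_pos (L := L)
  have hc : 0 < ν * NSE2D.kappa L ^ 2 := by positivity
  refine ⟨δ₀ / (ν * NSE2D.kappa L ^ 2), div_pos hδ₀ hc, rfl, fun u hu => ?_⟩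
  obtain ⟨v, hv, hv0, M, hM⟩ := hattr
  have hf := NSE2D.l2Bd_forceAmp hν g
  have hvb := hv.norm_amplitudes_le hν hM
  have hub := hu.norm_amplitudes_le hν
  rw [hG] at hf
  simp only [hG] at hvb hub
  have hv0' : NSE2D.amplitudes ν L v 0 = 0 := by
    rw [NSE2D.amplitudes, mul_zero, hv0, map_zero, smul_zero]
  have hf0 : NSE2D.forceAmp ν L g 0 = 0 := by
    rw [NSE2D.forceAmp, NSE2D.rho_zero_mode, mul_zero]
  obtain ⟨V, hVt, hV⟩ := hext _ _ hf0 hf (hv.seqSol hν) hvb hv0' _ (hu.1.seqSol hν) hub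
  have hVR := fun ζ hζ => (hV ζ hζ).2.1
  have hV0 := fun ζ hζ => (hV ζ hζ).1
  have hVd := fun ζ hζ => (hV ζ hζ).2.2
  refine ⟨NSE2D.rebuild ν L V, fun t => ?_,
    NSE2D.isComplexSolutionOn_rebuild hν (NSE2D.H_subset_HC hg) hVR hV0 hVd, fun α =>
    ⟨fun ζ hζ => ⟨NSE2D.rebuild_mem_stokesDom hν hVR hV0 hζ α,
      NSE2D.stokesPow_mem_HC (NSE2D.rebuild_mem_HC ν V _) _⟩,
      NSE2D.analyticOnNhd_stokesPow_rebuild hν hVR hV0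
        (fun ζ hζ k => (hVd ζ hζ k).differentiableAt) α,
      fun ζ hζ => NSE2D.norm_stokesPow_rebuild_le hν hVR hV0 hζ α⟩⟩
  -- At real times both fields lie in `HC L` and undoing the scaling gives equal amplitudes.
  refine NSE2D.eq_of_rho_eq (NSE2D.rebuild_mem_HC ν V _) (NSE2D.H_subset_HC (hu.1 t).1) fun k => ?_
  have ht : (t : ℂ) ∈ NSE2D.strip (δ₀ / (ν * NSE2D.kappa L ^ 2)) :=
    NSE2D.ofReal_mem_strip (div_pos hδ₀ hc) t
  have hνκ : ((ν * NSE2D.kappa L : ℝ) : ℂ) ≠ 0 := by exact_mod_cast (mul_pos hν hκ).ne'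
  rw [NSE2D.rho_rebuild hν hVR hV0 ht, ← Complex.ofReal_mul, hVt, NSE2D.amplitudes_apply,
    mul_inv_cancel_left₀ hνκ, inv_mul_cancel_left₀ hc.ne']
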